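/- Let $Q$ be a smooth manifold with a Riemannian metric, $\lambda=p\,dq$ and $\omega=d\lambda$ the canonical forms on $T^*Q$, $\rho(q,p)=\langle p,p\rangle^{1/2}$, and for a function $F$ on $T^*Q$ let $X_F$ be given by $\omega(X_F,\cdot)=-dF$. Fix $\ell>0$ and write $S^*_\ell Q=\{\rho=\ell\}$. Let $\overline\Sigma$ be a compact Riemann surface with boundary (corners allowed, not necessarily connected) with complex structure $j$, let $z_1,\dots,z_e\in\partial\overline\Sigma$ ($e\ge 0$) be distinct, and $\Sigma=\overline\Sigma\setminus\{z_1,\dots,z_e\}$. Let $\partial\Sigma=\partial^n\Sigma\cup\partial^l\Sigma$ be a decomposition into closed $1$-manifolds with boundary which meet in finitely many points, with $\partial^n\Sigma\neq\emptyset$. Let $\epsilon_i\colon B^-=(-\infty,0]\times[0,1]\to\Sigma$ be negative strip-like ends at the $z_i$ (biholomorphisms onto punctured neighbourhoods of $z_i$, taking the sides $t=0,1$ to $\partial\Sigma$ and converging to $z_i$ as $s\to-\infty$) with pairwise disjoint images which are disjoint from $\partial^n\Sigma$. For every connected component $I$ of $\partial^l\Sigma$ fix a point $q_I\in Q$. Let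 $\alpha_0,\dots,\alpha_k$ be smooth $1$-forms on $\Sigma$, $h_0,\dots,h_k$ smooth functions on $[\ell,\infty)$ (smooth up to $\ell$), regarded as the functions $h_m(\rho)$ on $\{\rho\ge\ell\}\subset T^*Q$, and $(J_z)_{z\in\Sigma}$ a smooth family of $\omega$-compatible almost complex structures on $T^*Q$. Assume that, for all $i$, $m$ and $z$: 1. $\epsilon_i^*\alpha_m=dt$; 2. $\alpha_m|_{\partial^l\Sigma}=0$; 3. $J_z$ is convex near $S^*_\ell Q$, i.e. $d\rho\circ J_z=-e^{f}\lambda$ on a neighbourhood of $S^*_\ell Q$ for some smooth function $f$ (depending on $z$); 4. $h_m$ is non-decreasing and convex on $[\ell,\infty)$; 5. $d\alpha_m\le0$ on $\Sigma$, i.e. $d\alpha_m(v,jv)\le 0$ for all tangent vectors $v$. Write $|v|_z^2=\omega(v,J_zv)$. Then there is no smooth map $u\colon\Sigma\to\{\rho\ge\ell\}\subset T^*Q$ such that * $\bigl(du-\sum_{m=0}^k\alpha_m\otimes X_{h_m}\bigr)^{0,1}=0$; * $u$ is transverse to $S^*_\ell Q$ and $u^{-1}(S^*_\ell Q)=\partial^n\Sigma$;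 * $u(I)\subset T^*_{q_I}Q$ for every component $I$ of $\partial^l\Sigma$; * $E_{geo}(u)=\tfrac12\int_\Sigma\bigl\|du-\sum_m\alpha_m\otimes X_{h_m}\bigr\|^2<\infty$, the norm being $|\cdot|_z$ on the target; * the geometry is tame along the ends of $u$: for each $i$ there are a $C^1$ function $\psi$ on $T^*Q$ and a constant $C$ such that, for all $z\in\epsilon_i(B^-)$ and $v\in T_{u(z)}T^*Q$, $\lambda(v)^2\le\psi(u(z))^2|v|_z^2$ and $d\psi(v)^2\le C|v|_z^2$. (This is automatic, with $\psi$ constant, if $J_{\epsilon_i(s,t)}$ is independent of $s$ and $u\circ\epsilon_i$ has relatively compact image, in particular if $u\circ\epsilon_i(s,\cdot)$ converges uniformly as $s\to-\infty$. It holds for every $u$ if, for all $z\in\epsilon_i(B^-)$, one has $\lambda(v)^2,d\rho(v)^2\le C\rho\,|v|_z^2$ on $\{\rho\ge\ell\}$.) -/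

import Mathlib

open Set Filter Topology Bundle
open scoped ContDiff Manifold ENNReal

noncomputable section

namespace IntegratedMax

section ExteriorDerivative

/-- Exterior derivative at `x` of a 1-form `α` on a manifold (boundary and corners allowed), with
the convention `dα(v, w) = v(α(w)) - w(α(v)) - α([v, w])`. The form is read in the preferred chart
at `x`, in which `T_x M` is the model vector space `E`. -/
def extDeriv₁ {E : Type*} [NormedAddCommGroup E] [NormedSpace ℝ E]
    {H : Type*} [TopologicalSpace H] (I : ModelWithCorners ℝ E H)
    {M : Type*} [TopologicalSpace M] [ChartedSpace H M]
    (α : ∀ x : M, TangentSpace I x →L[ℝ] ℝ) (x : M) (v w : TangentSpace I x) : ℝ :=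
  let a : E → E →L[ℝ] ℝ := fun y =>
    (α ((extChartAt I x).symm y)).comp
      (mfderivWithin 𝓘(ℝ, E) I (extChartAt I x).symm (range I) y)
  fderivWithin ℝ a (range I) (extChartAt I x x) v w -
    fderivWithin ℝ a (range I) (extChartAt I x x) w v

end ExteriorDerivative

section Cotangent

variable {n : ℕ} {Q : Type*} [TopologicalSpace Q] [ChartedSpace (EuclideanSpace ℝ (Fin n)) Q]
  [IsManifold (𝓡 n) ∞ Q]

variable (n Q) in
/-- The total space of the cotangent bundle `T*Q`. A point `x` has base point `x.proj` (written
`q` in the literature) and covector `x.snd` (written `p`). -/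
abbrev Cot : Type _ :=
  TotalSpace (EuclideanSpace ℝ (Fin n) →L[ℝ] ℝ)
    (fun q : Q => TangentSpace (𝓡 n) q →L[ℝ] Trivial Q ℝ q)

variable (n) in
/-- The model (without boundary) of the manifold `T*Q`. -/
abbrev cotModel := (𝓡 n).prod 𝓘(ℝ, EuclideanSpace ℝ (Fin n) →L[ℝ] ℝ)

variable (n Q) in
/-- Smooth Riemannian metrics on `Q`. -/
abbrev Metric := ContMDiffRiemannianMetric (𝓡 n) ∞ (EuclideanSpace ℝ (Fin n))
  (fun q : Q => TangentSpace (𝓡 n) q)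

/-- The canonical 1-form `λ = p dq` on `T*Q`. -/
def liouville (x : Cot n Q) : TangentSpace (cotModel n) x →L[ℝ] ℝ :=
  ContinuousLinearMap.comp (show TangentSpace (𝓡 n) x.proj →L[ℝ] ℝ from x.snd)
    (mfderiv (cotModel n) (𝓡 n) (fun y : Cot n Q => y.proj) x)

/-- The canonical symplectic form `ω = dλ = dp ∧ dq` on `T*Q`. -/
def symplectic (x : Cot n Q) (v w : TangentSpace (cotModel n) x) : ℝ :=
  extDeriv₁ (cotModel n) liouville x v w

/-- The tangent vector `g(p)` which is dual to the covector `p` for the metric `g`. -/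
def dualVector (g : Metric n Q) (x : Cot n Q) : TangentSpace (𝓡 n) x.proj :=
  (ContinuousLinearMap.inverse (g.inner x.proj)) x.snd

/-- The radial function `ρ(q, p) = ⟨p, p⟩^{1/2}`. -/
def radial (g : Metric n Q) (x : Cot n Q) : ℝ :=
  Real.sqrt ((show TangentSpace (𝓡 n) x.proj →L[ℝ] ℝ from x.snd) (dualVector g x))

/-- The differential `dρ`. -/
def dRadial (g : Metric n Q) (x : Cot n Q) : TangentSpace (cotModel n) x →L[ℝ] ℝ :=
  mvfderiv (cotModel n) (radial g) x

/-- The Hamiltonian vector field `X_F` of `F : T*Q → ℝ`: the unique vector field with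
`ω(X_F, ·) = -dF`. -/
def hamVF (F : Cot n Q → ℝ) (x : Cot n Q) : TangentSpace (cotModel n) x :=
  Classical.epsilon fun X : TangentSpace (cotModel n) x =>
    ∀ v, symplectic x X v = - mvfderiv (cotModel n) F x v

/-- Endomorphism fields of `T(T*Q)`. -/
abbrev EndField (n : ℕ) (Q : Type*) [TopologicalSpace Q]
    [ChartedSpace (EuclideanSpace ℝ (Fin n)) Q] [IsManifold (𝓡 n) ∞ Q] :=
  ∀ x : Cot n Q, TangentSpace (cotModel n) x →L[ℝ] TangentSpace (cotModel n) x

/-- `J` is an almost complex structure on `T*Q` compatible with the symplectic form. -/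
structure IsCompatible (J : EndField n Q) : Prop where
  sq : ∀ x v, J x (J x v) = -v
  pos : ∀ x v, v ≠ 0 → 0 < symplectic x v (J x v)
  invariant : ∀ x v w, symplectic x (J x v) (J x w) = symplectic x v w

/-- `J` is convex near the sphere bundle of radius `ℓ`: on a neighbourhood of it,
`dρ ∘ J = - e^f λ` for a smooth function `f`. -/
def IsConvexNear (g : Metric n Q) (ℓ : ℝ) (J : EndField n Q) : Prop :=
  ∃ (U : Set (Cot n Q)) (f : Cot n Q → ℝ), IsOpen U ∧ {x | radial g x = ℓ} ⊆ U ∧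
    ContMDiffOn (cotModel n) 𝓘(ℝ) ∞ f U ∧
    ∀ x ∈ U, ∀ v, dRadial g x (J x v) = - Real.exp (f x) * liouville x v

end Cotangent

section Surface

/-- The model for surfaces with boundary and (convex) corners. Every surface with smooth boundary
is such a surface, without corner points. -/
abbrev surfModel : ModelWithCorners ℝ (EuclideanSpace ℝ (Fin 2)) (EuclideanQuadrant 2) :=
  modelWithCornersEuclideanQuadrant 2

variable {S : Type*} [TopologicalSpace S] [ChartedSpace (EuclideanQuadrant 2) S]
  [IsManifold surfModel ∞ S]

/-- `j` is a smooth (almost) complex structure on the surface `S`. It makes `S` a Riemann surface,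
oriented by the bases `(v, j v)`. -/
structure IsComplexStructure
    (j : ∀ z : S, TangentSpace surfModel z →L[ℝ] TangentSpace surfModel z) : Prop where
  smooth : ContMDiff surfModel
    (surfModel.prod 𝓘(ℝ, EuclideanSpace ℝ (Fin 2) →L[ℝ] EuclideanSpace ℝ (Fin 2))) ∞
    (fun z => TotalSpace.mk' (EuclideanSpace ℝ (Fin 2) →L[ℝ] EuclideanSpace ℝ (Fin 2))
      (E := fun z : S => TangentSpace surfModel z →L[ℝ] TangentSpace surfModel z) z (j z))
  sq : ∀ z v, j z (j z v) = -v

/-- Smoothness of a 1-form on a subset of `S`. -/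
def SmoothFormOn (α : ∀ z : S, TangentSpace surfModel z →L[ℝ] ℝ) (A : Set S) : Prop :=
  ContMDiffOn surfModel (surfModel.prod 𝓘(ℝ, EuclideanSpace ℝ (Fin 2) →L[ℝ] ℝ)) ∞
    (fun z => TotalSpace.mk' (EuclideanSpace ℝ (Fin 2) →L[ℝ] ℝ)
      (E := fun z : S => TangentSpace surfModel z →L[ℝ] Trivial S ℝ z) z (α z)) A

/-- The negative half-strip `B⁻ = (-∞, 0] × [0, 1]`, with complex coordinate `s + i t`. -/
def halfStrip : Set ℂ := {w | w.re ≤ 0 ∧ 0 ≤ w.im ∧ w.im ≤ 1}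

/-- `φ` is smooth and holomorphic on `D ⊆ ℂ`. -/
structure IsHolomorphicOn
    (j : ∀ z : S, TangentSpace surfModel z →L[ℝ] TangentSpace surfModel z)
    (φ : ℂ → S) (D : Set ℂ) : Prop where
  smooth : ContMDiffOn 𝓘(ℝ, ℂ) surfModel ∞ φ D
  holo : ∀ w ∈ D, ∀ v : ℂ, mfderivWithin 𝓘(ℝ, ℂ) surfModel φ D w (Complex.I * v : ℂ) =
    j (φ w) (mfderivWithin 𝓘(ℝ, ℂ) surfModel φ D w v)

/-- `ε` is a negative strip-like end at the boundary puncture `p`: a biholomorphism of `B⁻` onto a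
punctured neighbourhood of `p`, taking the sides `t = 0, 1` to the boundary and converging to
`p` as `s → -∞`. -/
structure IsNegativeEnd
    (j : ∀ z : S, TangentSpace surfModel z →L[ℝ] TangentSpace surfModel z)
    (p : S) (ε : ℂ → S) : Prop where
  holo : IsHolomorphicOn j ε halfStrip
  inj : InjOn ε halfStrip
  notMem : p ∉ ε '' halfStrip
  nhd : insert p (ε '' halfStrip) ∈ 𝓝 p
  sides : ∀ w ∈ halfStrip, w.im = 0 ∨ w.im = 1 → ε w ∈ surfModel.boundary S
  lim : Tendsto ε (comap Complex.re atBot ⊓ 𝓟 halfStrip) (𝓝 p)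

/-- The punctured surface `Σ`, as a subset of the compact surface `S = Σ̄`. -/
def punctured {e : ℕ} (p : Fin e → S) : Set S := (range p)ᶜ

/-- A decomposition `∂Σ = ∂ⁿΣ ∪ ∂ˡΣ` of the boundary of `Σ` into 1-manifolds with boundary (that is,
closed subsets of `Σ` without isolated points) meeting in finitely many points. -/
structure IsBoundaryDecomposition {e : ℕ} (p : Fin e → S) (N L : Set S) : Prop where
  union : N ∪ L = surfModel.boundary S ∩ punctured p
  closedN : IsClosed ((↑) ⁻¹' N : Set (punctured p))
  closedL : IsClosed ((↑) ⁻¹' L : Set (punctured p))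
  perfectN : Preperfect N
  perfectL : Preperfect L
  finite : (N ∩ L).Finite

/-- The restriction of the 1-form `α` to the curve `L` vanishes: `α` is zero on the velocity of
every smooth path which stays in `L`. -/
def VanishesAlong (α : ∀ z : S, TangentSpace surfModel z →L[ℝ] ℝ) (L : Set S) : Prop :=
  ∀ γ : ℝ → S, ContMDiff 𝓘(ℝ) surfModel ∞ γ → (∀ t, γ t ∈ L) →
    ∀ t, α (γ t) (mfderiv 𝓘(ℝ) surfModel γ t (1 : ℝ)) = 0

end Surface

section Floer

variable {n : ℕ} {Q : Type*} [TopologicalSpace Q] [ChartedSpace (EuclideanSpace ℝ (Fin n)) Q]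
  [IsManifold (𝓡 n) ∞ Q]
  {S : Type*} [TopologicalSpace S] [ChartedSpace (EuclideanQuadrant 2) S]
  [IsManifold surfModel ∞ S]

/-- Smoothness of a family `J_z` of endomorphism fields of `T(T*Q)`, jointly in `z ∈ A` and in the
point of `T*Q`. -/
def SmoothFamilyOn (J : S → EndField n Q) (A : Set S) : Prop :=
  ContMDiffOn (surfModel.prod (cotModel n))
    ((cotModel n).prod 𝓘(ℝ, (EuclideanSpace ℝ (Fin n) × (EuclideanSpace ℝ (Fin n) →L[ℝ] ℝ)) →L[ℝ]
      (EuclideanSpace ℝ (Fin n) × (EuclideanSpace ℝ (Fin n) →L[ℝ] ℝ)))) ∞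
    (fun a : S × Cot n Q => TotalSpace.mk'
      ((EuclideanSpace ℝ (Fin n) × (EuclideanSpace ℝ (Fin n) →L[ℝ] ℝ)) →L[ℝ]
        (EuclideanSpace ℝ (Fin n) × (EuclideanSpace ℝ (Fin n) →L[ℝ] ℝ)))
      (E := fun x : Cot n Q => TangentSpace (cotModel n) x →L[ℝ] TangentSpace (cotModel n) x)
      a.2 (J a.1 a.2))
    (A ×ˢ univ)

/-- The conditions on the Floer data: `α₀, …, α_k` are smooth 1-forms on `Σ` which restrict to `dt`
on the ends, vanish on `∂ˡΣ` and satisfy `dα_j ≤ 0`; `J_z` is a smooth family of compatible almost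
complex structures, convex near the sphere bundle of radius `ℓ`; and each `h_j`, a smooth function
of `ρ ∈ [ℓ, ∞)` (extended smoothly to `ℝ`), is non-decreasing and convex there. -/
structure IsFloerData (g : Metric n Q) (ℓ : ℝ)
    (j : ∀ z : S, TangentSpace surfModel z →L[ℝ] TangentSpace surfModel z)
    {e : ℕ} (p : Fin e → S) (ε : Fin e → ℂ → S) (L : Set S)
    {k : ℕ} (α : Fin (k + 1) → ∀ z : S, TangentSpace surfModel z →L[ℝ] ℝ)
    (h : Fin (k + 1) → ℝ → ℝ) (J : S → EndField n Q) : Prop where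
  α_smooth : ∀ m, SmoothFormOn (α m) (punctured p)
  α_ends : ∀ m i, ∀ w ∈ halfStrip, ∀ v : ℂ,
    α m (ε i w) (mfderivWithin 𝓘(ℝ, ℂ) surfModel (ε i) halfStrip w v) = v.im
  α_lagrangian : ∀ m, VanishesAlong (α m) L
  α_sub : ∀ m, ∀ z ∈ punctured p, ∀ v, extDeriv₁ surfModel (α m) z v (j z v) ≤ 0
  J_smooth : SmoothFamilyOn J (punctured p)
  J_compatible : ∀ z ∈ punctured p, IsCompatible (J z)
  J_convex : ∀ z ∈ punctured p, IsConvexNear g ℓ (J z)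
  h_smooth : ∀ m, ContDiff ℝ ∞ (h m)
  h_mono : ∀ m, MonotoneOn (h m) (Ici ℓ)
  h_convex : ∀ m, ConvexOn ℝ (Ici ℓ) (h m)

/-- `η = du - ∑ₘ αₘ ⊗ X_{hₘ}`, where `hₘ` is regarded as the function `hₘ(ρ)` on `T*Q`. -/
def eta (g : Metric n Q) {k : ℕ}
    (α : Fin (k + 1) → ∀ z : S, TangentSpace surfModel z →L[ℝ] ℝ)
    (h : Fin (k + 1) → ℝ → ℝ) (u : S → Cot n Q) (z : S) (v : TangentSpace surfModel z) :
    TangentSpace (cotModel n) (u z) :=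
  mfderiv surfModel (cotModel n) u z v -
    ∑ m, α m z v • hamVF (fun x => h m (radial g x)) (u z)

/-- The square of the norm of `X ∈ T_x T*Q` for the metric `ω(·, J ·)`. -/
def sqNorm (J : EndField n Q) (x : Cot n Q) (X : TangentSpace (cotModel n) x) : ℝ :=
  symplectic x X (J x X)

/-- The pseudoholomorphic curve equation `(du - ∑ₘ αₘ ⊗ X_{hₘ})^{0,1} = 0`, that is
`η + J ∘ η ∘ j = 0`, at all points of `A`. -/
def SolvesCR (g : Metric n Q)
    (j : ∀ z : S, TangentSpace surfModel z →L[ℝ] TangentSpace surfModel z)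
    {k : ℕ} (α : Fin (k + 1) → ∀ z : S, TangentSpace surfModel z →L[ℝ] ℝ)
    (h : Fin (k + 1) → ℝ → ℝ) (J : S → EndField n Q) (u : S → Cot n Q) (A : Set S) : Prop :=
  ∀ z ∈ A, ∀ v, eta g α h u z v + J z (u z) (eta g α h u z (j z v)) = 0

/-- The geometric energy `½ ∫_A ‖du - ∑ₘ αₘ ⊗ X_{hₘ}‖²`. The integrand is a non-negative 2-form,
which in a holomorphic coordinate `s + i t` is `½ (‖η(∂ₛ)‖² + ‖η(∂ₜ)‖²) ds ∧ dt`; the integral is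
the supremum of the sums of the integrals over finitely many disjoint holomorphic coordinate
patches of `A`. -/
def geomEnergy (g : Metric n Q)
    (j : ∀ z : S, TangentSpace surfModel z →L[ℝ] TangentSpace surfModel z)
    {k : ℕ} (α : Fin (k + 1) → ∀ z : S, TangentSpace surfModel z →L[ℝ] ℝ)
    (h : Fin (k + 1) → ℝ → ℝ) (J : S → EndField n Q) (u : S → Cot n Q) (A : Set S) : ℝ≥0∞ :=
  ⨆ (r : ℕ) (D : Fin r → Set ℂ) (φ : Fin r → ℂ → S)
    (_ : ∀ i, IsOpen (D i) ∧ IsHolomorphicOn j (φ i) (D i) ∧ InjOn (φ i) (D i) ∧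
      φ i '' D i ⊆ A)
    (_ : Pairwise fun i i' => Disjoint (φ i '' D i) (φ i' '' D i')),
    ∑ i, ∫⁻ w in D i, ENNReal.ofReal (1 / 2 *
      (sqNorm (J (φ i w)) (u (φ i w)) (eta g α h u (φ i w)
          (mfderivWithin 𝓘(ℝ, ℂ) surfModel (φ i) (D i) w (1 : ℂ))) +
        sqNorm (J (φ i w)) (u (φ i w)) (eta g α h u (φ i w)
          (mfderivWithin 𝓘(ℝ, ℂ) surfModel (φ i) (D i) w Complex.I))))

/-- Normal boundary conditions: `u` is transverse to the sphere bundle `{ρ = ℓ}` (whose tangent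
spaces are the kernels of `dρ`), and `u⁻¹{ρ = ℓ}` is `N`. -/
structure NormalBoundary (g : Metric n Q) (ℓ : ℝ) (u : S → Cot n Q) (A N : Set S) : Prop where
  preimage : {z | z ∈ A ∧ radial g (u z) = ℓ} = N
  transverse : ∀ z ∈ A, radial g (u z) = ℓ →
    LinearMap.range (mfderiv surfModel (cotModel n) u z).toLinearMap ⊔
      LinearMap.ker (dRadial g (u z)).toLinearMap = ⊤

/-- Lagrangian boundary conditions: each component `I` of `L` is mapped to the cotangent fibre
at `q I`. -/
def LagrangianBoundary (L : Set S) (q : ConnectedComponents L → Q) (u : S → Cot n Q) : Prop :=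
  ∀ z : L, (u z).proj = q (z : ConnectedComponents L)

/-- The geometry is tame along the image under `u` of the end `ε`: the length of `λ` is bounded by a
function `ψ` which is Lipschitz, both with respect to the metrics `ω(·, J_z ·)`. This holds with
`ψ` constant if `J` is independent of `s` on the end and `u` maps the end into a compact set; it
holds for arbitrary `u`, with `ψ` a multiple of `ρ^{1/2}`, if for instance `J` is uniformly
conical at infinity. -/
def TameAlongEnd (J : S → EndField n Q) (ε : ℂ → S) (u : S → Cot n Q) : Prop :=
  ∃ (C : ℝ) (ψ : Cot n Q → ℝ), ContMDiff (cotModel n) 𝓘(ℝ) 1 ψ ∧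
    ∀ w ∈ halfStrip, ∀ v : TangentSpace (cotModel n) (u (ε w)),
      (liouville (u (ε w)) v) ^ 2 ≤ ψ (u (ε w)) ^ 2 * sqNorm (J (ε w)) (u (ε w)) v ∧
      (mvfderiv (cotModel n) ψ (u (ε w)) v) ^ 2 ≤ C * sqNorm (J (ε w)) (u (ε w)) v

end Floer

end IntegratedMax

end

open Set Filter Topology Bundle
open scoped ContDiff Manifold ENNReal

noncomputable section

namespace IntegratedMax

/-! The argument is an integrated maximum principle: an exact 2-form is non-negative pointwise,
while Stokes' theorem makes its integral non-positive.

Suppose `u` exists. Write `η = du - ∑ αₘ ⊗ X_{hₘ}` and consider the 1-form `β = u^*λ - ∑ (hₘ(ρ∘u) +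
cₘ) αₘ` (`primitive`), with `cₘ = ℓ hₘ'(ℓ) - hₘ(ℓ)`. Three facts about `β` matter.

Interior. `dβ = ω(η, η) - ∑ (hₘ(ρ) + cₘ) dαₘ` (`curvature_eq`). Since `η` is complex linear, `hₘ +
cₘ ≥ 0` and `dαₘ ≤ 0`, one gets `dβ(v, jv) ≥ ‖η(v)‖² ≥ 0`. At a point of `N` transversality prevents
`η = 0`, so `dβ > 0` there (`exists_curvature_pos`).

Boundary. Since `λ(X_ρ) = ρ`, the constants `cₘ` make the Hamiltonian terms cancel where `ρ = ℓ`.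
Convexity of `J` then gives `β = -e^{-f} d(ρ∘u)∘j` on `N`, and `ρ∘u` has its minimum there, so `β ≤
0` on the oriented boundary (`primitive_bottom`, `primitive_left`). On `L` both `u^*λ` and the `αₘ`
vanish, so `β = 0` (`primitive_lagrangian`).

Ends. There `β(∂ₜ) = λ(η(∂ₜ)) + ∑ (ρ hₘ'(ρ) - hₘ(ρ) - cₘ)`, and the sum is non-negative because the
`hₘ` are convex. Finite energy and tameness give slices `s = -R` arbitrarily far out on which `∫
|λ(η(∂ₜ))| dt` is as small as desired (`exists_small_slice`). The contribution of an end in Stokes'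
theorem is therefore also non-positive.

To stay on the compact surface, take cutoffs `κᵢ` equal to `1` near the punctures and `χ = 1 - ∑
κᵢ`. Then `χ dβ = d(χβ) + ∑ dκᵢ ∧ β`. The first term has integral `≤ 0` by Stokes
(`OrientedCover.int_nonpos`), each of the others by the estimate on a strip (`int_cutoff_nonpos`).
Hence the non-negative form `χ dβ` vanishes identically, contradicting its positivity on the
non-empty set `N`, where `χ = 1`. -/

theorem three_le_infty : (3 : WithTop ℕ∞) ≤ ((⊤ : ℕ∞) : WithTop ℕ∞) :=
  WithTop.coe_le_coe.2 (le_top : (3 : ℕ∞) ≤ ⊤)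

/-! ### Exterior derivatives of 1-forms, tested on parametrized surfaces -/

section EuclideanPullback

variable {F E : Type*} [NormedAddCommGroup F] [NormedSpace ℝ F] [NormedAddCommGroup E]
  [NormedSpace ℝ E]

/-- The exterior derivative of 1-forms on subsets of normed spaces commutes with pullback. -/
theorem fderivWithin_comp_fderivWithin_antisymm {a : E → E →L[ℝ] ℝ} {W : F → E} {s : Set F}
    {t : Set E} {y : F} (hs : UniqueDiffOn ℝ s) (hy : y ∈ s) (hy' : y ∈ closure (interior s))
    (hW : ContDiffWithinAt ℝ 3 W s y) (hst : ∀ᶠ y' in 𝓝[s] y, W y' ∈ t)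
    (ha : ContDiffWithinAt ℝ 1 a t (W y)) :
    ContDiffWithinAt ℝ 1 (fun y' => (a (W y')).comp (fderivWithin ℝ W s y')) s y ∧
    ∀ v w, fderivWithin ℝ (fun y' => (a (W y')).comp (fderivWithin ℝ W s y')) s y v w -
      fderivWithin ℝ (fun y' => (a (W y')).comp (fderivWithin ℝ W s y')) s y w v =
      fderivWithin ℝ a t (W y) (fderivWithin ℝ W s y v) (fderivWithin ℝ W s y w) -
      fderivWithin ℝ a t (W y) (fderivWithin ℝ W s y w) (fderivWithin ℝ W s y v) := by
  have hd : ContDiffWithinAt ℝ 2 (fderivWithin ℝ W s) s y :=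
    hW.fderivWithin_right hs (by norm_num) hy
  have hmem : W ⁻¹' t ∈ 𝓝[s] y := hst
  have haW : ContDiffWithinAt ℝ 1 (fun y' => a (W y')) s y :=
    (ha.comp_of_preimage_mem_nhdsWithin (f := W) y (hW.of_le (by norm_num)) hmem)
  refine ⟨haW.clm_comp (hd.of_le (by norm_num)), fun v w => ?_⟩
  -- The term containing the second derivative of `W` is symmetric, so antisymmetrization removes
  -- it. Symmetry within `s` is where `y ∈ closure (interior s)` enters.
  have hsym : IsSymmSndFDerivWithinAt ℝ W s y :=
    (hW.of_le (by norm_num : (2 : WithTop ℕ∞) ≤ 3)).isSymmSndFDerivWithinAt (by simp) hs hy' hy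
  have h1 := (hW.differentiableWithinAt (by norm_num)).hasFDerivWithinAt
  have h2 := (hd.differentiableWithinAt (by norm_num)).hasFDerivWithinAt
  have h3 : HasFDerivWithinAt (fun y' => a (W y'))
      ((fderivWithin ℝ a t (W y)).comp (fderivWithin ℝ W s y)) s y := by
    have h4 := (ha.differentiableWithinAt (by norm_num)).hasFDerivWithinAt
    have h5 : HasFDerivWithinAt W (fderivWithin ℝ W s y) (s ∩ W ⁻¹' t) y :=
      h1.mono inter_subset_left
    have h6 := h4.comp y h5 (fun z hz => hz.2)
    exact h6.mono_of_mem_nhdsWithin (inter_mem self_mem_nhdsWithin hmem)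
  have h7 := (h3.clm_comp h2).fderivWithin (hs y hy)
  rw [h7]
  have := hsym.eq v w
  simp
  rw [this]
  ring

end EuclideanPullback

section Forms

variable {E : Type*} [NormedAddCommGroup E] [NormedSpace ℝ E]
    {H : Type*} [TopologicalSpace H] (I : ModelWithCorners ℝ E H)
    {M : Type*} [TopologicalSpace M] [ChartedSpace H M]

/-- The 1-form `α` in the preferred chart at `x`. -/
def formRep (α : ∀ x : M, TangentSpace I x →L[ℝ] ℝ) (x : M) (y : E) : E →L[ℝ] ℝ :=
  (α ((extChartAt I x).symm y)).comp
      (mfderivWithin 𝓘(ℝ, E) I (extChartAt I x).symm (range I) y)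

theorem extDeriv₁_eq_formRep (α : ∀ x : M, TangentSpace I x →L[ℝ] ℝ) (x : M)
    (v w : TangentSpace I x) : extDeriv₁ I α x v w =
    fderivWithin ℝ (formRep I α x) (range I) (extChartAt I x x) v w -
    fderivWithin ℝ (formRep I α x) (range I) (extChartAt I x x) w v := rfl

/-- The pullback of the 1-form `α` by the parametrized surface `Φ`, defined on `s`. -/
def pull (Φ : ℝ × ℝ → M) (s : Set (ℝ × ℝ)) (α : ∀ x : M, TangentSpace I x →L[ℝ] ℝ)
    (y : ℝ × ℝ) : ℝ × ℝ →L[ℝ] ℝ :=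
  (α (Φ y)).comp (mfderivWithin 𝓘(ℝ, ℝ × ℝ) I Φ s y)

/-- The 1-form `α` is continuously differentiable near `x`, with exterior derivative `θ` at `x`,
in the sense that this is true of the pullbacks to parametrized surfaces. -/
def HasExtDeriv (α : ∀ x : M, TangentSpace I x →L[ℝ] ℝ)
    (θ : ∀ x : M, TangentSpace I x → TangentSpace I x → ℝ) (x : M) : Prop :=
  ∀ (Φ : ℝ × ℝ → M) (s : Set (ℝ × ℝ)) (y : ℝ × ℝ), y ∈ s → UniqueDiffOn ℝ s →
    s ⊆ closure (interior s) → Φ y = x → ContMDiffWithinAt 𝓘(ℝ, ℝ × ℝ) I 3 Φ s y →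
    ContDiffWithinAt ℝ 1 (pull I Φ s α) s y ∧
    ∀ v w : ℝ × ℝ, fderivWithin ℝ (pull I Φ s α) s y v w - fderivWithin ℝ (pull I Φ s α) s y w v =
      θ (Φ y) (mfderivWithin 𝓘(ℝ, ℝ × ℝ) I Φ s y v) (mfderivWithin 𝓘(ℝ, ℝ × ℝ) I Φ s y w)

variable {I}

/-- Tangent vectors at `x` are by definition read in the preferred chart at `x`, so the derivative
of that chart at its own centre is the identity. -/
theorem mfderiv_extChartAt_self [IsManifold I 1 M] (x : M) (v : TangentSpace I x) :
    mfderiv I 𝓘(ℝ, E) (extChartAt I x) x v = v := by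
  rw [← TangentBundle.continuousLinearMapAt_trivializationAt (mem_chart_source H x),
    TangentBundle.continuousLinearMapAt_trivializationAt_eq_core (mem_chart_source H x)]
  exact tangentCoordChange_self (I := I) (mem_extChartAt_source (I := I) x)

/-- `extDeriv₁` is computed in a chart that changes with the point. Near `y` one has `Φ = φ⁻¹ ∘ W`
for the chart `φ` at `Φ y`, so the pullback of `α` is the pullback by `W` of its chart
representative, and naturality in normed spaces applies. -/
theorem hasExtDeriv_of_formRep [IsManifold I ∞ M] {α : ∀ x : M, TangentSpace I x →L[ℝ] ℝ} {x : M}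
    (h : ContDiffWithinAt ℝ 1 (formRep I α x) (range I) (extChartAt I x x)) :
    HasExtDeriv I α (extDeriv₁ I α) x := by
  rintro Φ s y hy hs hs' rfl hΦ
  have : IsManifold I 3 M := IsManifold.of_le three_le_infty
  have : IsManifold I 1 M := IsManifold.of_le (by norm_num : (1 : WithTop ℕ∞) ≤ 3)
  set W : ℝ × ℝ → E := fun y' => extChartAt I (Φ y) (Φ y') with hWdef
  have hWm : ContMDiffWithinAt 𝓘(ℝ, ℝ × ℝ) 𝓘(ℝ, E) 3 W s y :=
    (contMDiffAt_extChartAt (n := 3)).comp_contMDiffWithinAt y hΦ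
  have hW : ContDiffWithinAt ℝ 3 W s y := contMDiffWithinAt_iff_contDiffWithinAt.1 hWm
  have hsrc : ∀ᶠ y' in 𝓝[s] y, Φ y' ∈ (extChartAt I (Φ y)).source :=
    hΦ.continuousWithinAt.eventually (extChartAt_source_mem_nhds (I := I) (Φ y))
  have hrange : ∀ᶠ y' in 𝓝[s] y, W y' ∈ range I := by
    filter_upwards [hsrc] with y' hy'
    exact extChartAt_target_subset_range _ ((extChartAt I (Φ y)).map_source hy')
  obtain ⟨U, hU, hΦU⟩ := (contMDiffWithinAt_iff_contMDiffOn_nhds (n := 3)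
    (by norm_num)).1 hΦ
  rw [insert_eq_of_mem hy] at hU
  have hpull : ∀ᶠ y' in 𝓝[s] y, pull I Φ s α y' =
      (formRep I α (Φ y) (W y')).comp (fderivWithin ℝ W s y') := by
    have hsrc2 := eventually_eventually_nhdsWithin.2 hsrc
    have hU2 : ∀ᶠ y' in 𝓝[s] y, U ∈ 𝓝[s] y' := eventually_eventually_nhdsWithin.2 hU
    filter_upwards [hsrc2, hU2, hsrc, hU, self_mem_nhdsWithin] with y' h1 h2 h3 h4 h5
    have hd : MDifferentiableWithinAt 𝓘(ℝ, ℝ × ℝ) I Φ s y' :=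
      ((hΦU y' h4).mdifferentiableWithinAt (by norm_num)).mono_of_mem_nhdsWithin h2
    have hud : UniqueMDiffWithinAt 𝓘(ℝ, ℝ × ℝ) s y' := (hs y' h5).uniqueMDiffWithinAt
    have hWd : MDifferentiableWithinAt 𝓘(ℝ, ℝ × ℝ) 𝓘(ℝ, E) W s y' :=
      (mdifferentiableAt_extChartAt (by simpa using h3)).comp_mdifferentiableWithinAt y' hd
    have htgt : W y' ∈ (extChartAt I (Φ y)).target := (extChartAt I (Φ y)).map_source h3
    have hsd : MDifferentiableWithinAt 𝓘(ℝ, E) I (extChartAt I (Φ y)).symm (range I) (W y') :=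
      mdifferentiableWithinAt_extChartAt_symm htgt
    have hWr : ∀ᶠ y'' in 𝓝[s] y', W y'' ∈ range I := by
      filter_upwards [h1] with y'' hy''
      exact extChartAt_target_subset_range _ ((extChartAt I (Φ y)).map_source hy'')
    have key : mfderivWithin 𝓘(ℝ, ℝ × ℝ) I Φ s y' =
        (mfderivWithin 𝓘(ℝ, E) I (extChartAt I (Φ y)).symm (range I) (W y')).comp
          (mfderivWithin 𝓘(ℝ, ℝ × ℝ) 𝓘(ℝ, E) W s y') := by
      have hcomp : HasMFDerivWithinAt 𝓘(ℝ, ℝ × ℝ) I ((extChartAt I (Φ y)).symm ∘ W)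
          (s ∩ W ⁻¹' (range I)) y' _ := hsd.hasMFDerivWithinAt.comp y'
            (hWd.hasMFDerivWithinAt.mono inter_subset_left) (fun z hz => hz.2)
      have hcomp2 := hcomp.mono_of_mem_nhdsWithin (t := s)
        (inter_mem self_mem_nhdsWithin hWr)
      have hcomp3 : HasMFDerivWithinAt 𝓘(ℝ, ℝ × ℝ) I Φ s y' _ :=
        hcomp2.congr_of_eventuallyEq (by
          filter_upwards [h1] with z hz
          exact ((extChartAt I (Φ y)).left_inv hz).symm)
          ((extChartAt I (Φ y)).left_inv h3).symm
      exact hcomp3.mfderivWithin hud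
    have hpt : (extChartAt I (Φ y)).symm (W y') = Φ y' := (extChartAt I (Φ y)).left_inv h3
    unfold pull formRep
    rw [key, mfderivWithin_eq_fderivWithin, hpt]
    rfl
  have hmain := fderivWithin_comp_fderivWithin_antisymm hs hy (hs' hy) hW hrange h
  have heq : pull I Φ s α y = _ := hpull.self_of_nhdsWithin hy
  refine ⟨hmain.1.congr_of_eventuallyEq hpull heq, fun v w => ?_⟩
  rw [Filter.EventuallyEq.fderivWithin_eq hpull heq, hmain.2 v w, extDeriv₁_eq_formRep]
  have hd : MDifferentiableWithinAt 𝓘(ℝ, ℝ × ℝ) I Φ s y :=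
    hΦ.mdifferentiableWithinAt (by norm_num)
  have key : fderivWithin ℝ W s y = mfderivWithin 𝓘(ℝ, ℝ × ℝ) I Φ s y := by
    rw [← mfderivWithin_eq_fderivWithin, hWdef]
    have hud : UniqueMDiffWithinAt 𝓘(ℝ, ℝ × ℝ) s y := (hs y hy).uniqueMDiffWithinAt
    have h1 := mfderiv_comp_mfderivWithin (I := 𝓘(ℝ, ℝ × ℝ)) (I' := I) (I'' := 𝓘(ℝ, E)) y
      (mdifferentiableAt_extChartAt (x := Φ y) (y := Φ y) (mem_chart_source H (Φ y))) hd hud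
    have h2 : (extChartAt I (Φ y)) ∘ Φ = fun y' => extChartAt I (Φ y) (Φ y') := rfl
    rw [← h2, h1]
    exact ContinuousLinearMap.ext fun v => mfderiv_extChartAt_self (I := I) (Φ y) _
  rw [key]
  rfl

theorem HasExtDeriv.congr {α α' : ∀ x : M, TangentSpace I x →L[ℝ] ℝ}
    {θ θ' : ∀ x : M, TangentSpace I x → TangentSpace I x → ℝ} {x : M} (h : HasExtDeriv I α θ x)
    (hα : ∀ᶠ y in 𝓝 x, α' y = α y) (hθ : ∀ v w, θ' x v w = θ x v w) : HasExtDeriv I α' θ' x := by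
  rintro Φ s y hy hs hs' rfl hΦ
  obtain ⟨h1, h2⟩ := h Φ s y hy hs hs' rfl hΦ
  have he : pull I Φ s α' =ᶠ[𝓝[s] y] pull I Φ s α := by
    filter_upwards [hΦ.continuousWithinAt.eventually hα] with y' hy'
    simp only [pull, hy']
  have he' := he.self_of_nhdsWithin hy
  refine ⟨h1.congr_of_eventuallyEq he he', fun v w => ?_⟩
  rw [he.fderivWithin_eq he', h2, hθ]

theorem hasExtDeriv_zero (x : M) :
    HasExtDeriv I (fun x : M => (0 : TangentSpace I x →L[ℝ] ℝ)) (fun _ _ _ => 0) x := by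
  rintro Φ s y hy hs hs' rfl hΦ
  have : pull I Φ s (fun x : M => (0 : TangentSpace I x →L[ℝ] ℝ)) = fun _ => 0 := by
    ext1 y'; exact ContinuousLinearMap.zero_comp _
  rw [this]
  exact ⟨contDiffWithinAt_const, by simp⟩

theorem HasExtDeriv.sub {α α' : ∀ x : M, TangentSpace I x →L[ℝ] ℝ}
    {θ θ' : ∀ x : M, TangentSpace I x → TangentSpace I x → ℝ} {x : M} (h : HasExtDeriv I α θ x)
    (h' : HasExtDeriv I α' θ' x) :
    HasExtDeriv I (fun x => α x - α' x) (fun x v w => θ x v w - θ' x v w) x := by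
  rintro Φ s y hy hs hs' rfl hΦ
  obtain ⟨h1, h2⟩ := h Φ s y hy hs hs' rfl hΦ
  obtain ⟨h1', h2'⟩ := h' Φ s y hy hs hs' rfl hΦ
  have : pull I Φ s (fun x => α x - α' x) = fun y => pull I Φ s α y - pull I Φ s α' y := by
    ext1 y'; exact ContinuousLinearMap.sub_comp _ _ _
  rw [this]
  refine ⟨h1.sub h1', fun v w => ?_⟩
  rw [fderivWithin_fun_sub (hs y hy) (h1.differentiableWithinAt (by norm_num))
    (h1'.differentiableWithinAt (by norm_num))]
  refine Eq.trans ?_ (congrArg₂ (· - ·) (h2 v w) (h2' v w))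
  simp
  ring

theorem HasExtDeriv.sum {ι : Type*} (t : Finset ι) {α : ι → ∀ x : M, TangentSpace I x →L[ℝ] ℝ}
    {θ : ι → ∀ x : M, TangentSpace I x → TangentSpace I x → ℝ} {x : M}
    (h : ∀ i ∈ t, HasExtDeriv I (α i) (θ i) x) :
    HasExtDeriv I (fun x => ∑ i ∈ t, α i x) (fun x v w => ∑ i ∈ t, θ i x v w) x := by
  rintro Φ s y hy hs hs' rfl hΦ
  have h1 := fun i hi => (h i hi Φ s y hy hs hs' rfl hΦ).1
  have h2 := fun i hi => (h i hi Φ s y hy hs hs' rfl hΦ).2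
  have : pull I Φ s (fun x => ∑ i ∈ t, α i x) = fun y => ∑ i ∈ t, pull I Φ s (α i) y := by
    ext1 y'; exact ContinuousLinearMap.finsetSum_comp _ _
  rw [this]
  refine ⟨ContDiffWithinAt.sum h1, fun v w => ?_⟩
  rw [fderivWithin_fun_sum (hs y hy) (fun i hi => (h1 i hi).differentiableWithinAt (by norm_num))]
  simp only [sum_apply, ← Finset.sum_sub_distrib]
  exact Finset.sum_congr rfl fun i hi => h2 i hi v w

/-- The wedge product of `df` with the 1-form `α`. -/
def dWedge (I : ModelWithCorners ℝ E H) (f : M → ℝ) (α : ∀ x : M, TangentSpace I x →L[ℝ] ℝ)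
    (x : M) (v w : TangentSpace I x) : ℝ :=
  mvfderiv I f x v * α x w - mvfderiv I f x w * α x v

theorem fderivWithin_comp_eq_mvfderiv {f : M → ℝ} {Φ : ℝ × ℝ → M} {s : Set (ℝ × ℝ)}
    {y : ℝ × ℝ} (hs : UniqueDiffWithinAt ℝ s y) (hf : MDifferentiableAt I 𝓘(ℝ) f (Φ y))
    (hΦ : MDifferentiableWithinAt 𝓘(ℝ, ℝ × ℝ) I Φ s y) (v : ℝ × ℝ) :
    fderivWithin ℝ (fun y => f (Φ y)) s y v =
      mvfderiv I f (Φ y) (mfderivWithin 𝓘(ℝ, ℝ × ℝ) I Φ s y v) := by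
  rw [← mfderivWithin_eq_fderivWithin]
  have := mfderiv_comp_mfderivWithin (I := 𝓘(ℝ, ℝ × ℝ)) (I' := I) (I'' := 𝓘(ℝ)) y hf hΦ
    hs.uniqueMDiffWithinAt
  change (mfderivWithin 𝓘(ℝ, ℝ × ℝ) 𝓘(ℝ) (f ∘ Φ) s y) v = _
  rw [this]
  rfl

theorem HasExtDeriv.mul {f : M → ℝ} {α : ∀ x : M, TangentSpace I x →L[ℝ] ℝ}
    {θ : ∀ x : M, TangentSpace I x → TangentSpace I x → ℝ} {x : M} (h : HasExtDeriv I α θ x)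
    (hf : ContMDiffAt I 𝓘(ℝ) 1 f x) :
    HasExtDeriv I (fun x => f x • α x) (fun x v w => f x * θ x v w + dWedge I f α x v w) x := by
  rintro Φ s y hy hs hs' rfl hΦ
  obtain ⟨h1, h2⟩ := h Φ s y hy hs hs' rfl hΦ
  have hfΦ : ContDiffWithinAt ℝ 1 (fun y => f (Φ y)) s y :=
    contMDiffWithinAt_iff_contDiffWithinAt.1
      (hf.comp_contMDiffWithinAt y (hΦ.of_le (by norm_num)))
  have : pull I Φ s (fun x => f x • α x) = fun y => f (Φ y) • pull I Φ s α y := by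
    ext1 y'; exact ContinuousLinearMap.smul_comp _ _ _
  rw [this]
  refine ⟨hfΦ.smul h1, fun v w => ?_⟩
  rw [fderivWithin_fun_smul (hs y hy) (hfΦ.differentiableWithinAt (by norm_num))
    (h1.differentiableWithinAt (by norm_num))]
  refine Eq.trans ?_ (congrArg (fun a => f (Φ y) * a + _) (h2 v w))
  have h3 := fderivWithin_comp_eq_mvfderiv (hs y hy) (hf.mdifferentiableAt (by norm_num))
    (hΦ.mdifferentiableWithinAt (by norm_num))
  simp only [dWedge, ← h3]
  simp [pull]
  ring_nf
  rfl

/-- The pullback of a 1-form by a map of manifolds. -/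
def pullForm {E' : Type*} [NormedAddCommGroup E'] [NormedSpace ℝ E']
    {H' : Type*} [TopologicalSpace H'] (I' : ModelWithCorners ℝ E' H')
    {M' : Type*} [TopologicalSpace M'] [ChartedSpace H' M'] (I : ModelWithCorners ℝ E H)
    (u : M' → M) (α : ∀ x : M, TangentSpace I x →L[ℝ] ℝ) (z : M') : TangentSpace I' z →L[ℝ] ℝ :=
  (α (u z)).comp (mfderiv I' I u z)

/-- Functoriality: near `y`, pulling `u^*α` back by `Φ` is the same as pulling `α` back by `u ∘ Φ`,
which is again an admissible test surface. -/
theorem HasExtDeriv.pullForm {E' : Type*} [NormedAddCommGroup E'] [NormedSpace ℝ E']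
    {H' : Type*} [TopologicalSpace H'] {I' : ModelWithCorners ℝ E' H'}
    {M' : Type*} [TopologicalSpace M'] [ChartedSpace H' M'] [IsManifold I' ∞ M']
    [IsManifold I ∞ M] {u : M' → M} {α : ∀ x : M, TangentSpace I x →L[ℝ] ℝ}
    {θ : ∀ x : M, TangentSpace I x → TangentSpace I x → ℝ} {z : M'} (h : HasExtDeriv I α θ (u z))
    (hu : ContMDiffAt I' I 3 u z) :
    HasExtDeriv I' (IntegratedMax.pullForm I' I u α)
      (fun z v w => θ (u z) (mfderiv I' I u z v) (mfderiv I' I u z w)) z := by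
  rintro Φ s y hy hs hs' rfl hΦ
  have : IsManifold I 3 M := IsManifold.of_le three_le_infty
  have : IsManifold I' 3 M' := IsManifold.of_le three_le_infty
  obtain ⟨U, hU, hΦU⟩ := (contMDiffWithinAt_iff_contMDiffOn_nhds (n := 3) (by norm_num)).1 hΦ
  obtain ⟨V, hV, huV⟩ := (contMDiffAt_iff_contMDiffOn_nhds (n := 3) (by norm_num)).1 hu
  rw [insert_eq_of_mem hy] at hU
  obtain ⟨h1, h2⟩ := h (u ∘ Φ) s y hy hs hs' rfl (hu.comp_contMDiffWithinAt y hΦ)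
  have hcomp : ∀ᶠ y' in 𝓝[s] y, mfderivWithin 𝓘(ℝ, ℝ × ℝ) I (u ∘ Φ) s y' =
      (mfderiv I' I u (Φ y')).comp (mfderivWithin 𝓘(ℝ, ℝ × ℝ) I' Φ s y') := by
    have hU2 : ∀ᶠ y' in 𝓝[s] y, U ∈ 𝓝[s] y' := eventually_eventually_nhdsWithin.2 hU
    have hV2 : ∀ᶠ y' in 𝓝[s] y, V ∈ 𝓝 (Φ y') :=
      hΦ.continuousWithinAt.eventually (eventually_eventually_nhds.2 hV)
    filter_upwards [hU2, hV2, hU, self_mem_nhdsWithin] with y' g1 g2 g3 g4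
    exact mfderiv_comp_mfderivWithin y'
      (((huV _ (mem_of_mem_nhds g2)).contMDiffAt g2).mdifferentiableAt (by norm_num))
      (((hΦU y' g3).mdifferentiableWithinAt (by norm_num)).mono_of_mem_nhdsWithin g1)
      (hs y' g4).uniqueMDiffWithinAt
  have he : pull I' Φ s (IntegratedMax.pullForm I' I u α) =ᶠ[𝓝[s] y] pull I (u ∘ Φ) s α := by
    filter_upwards [hcomp] with y' hy'
    simp only [pull, hy']
    rfl
  have he' := he.self_of_nhdsWithin hy
  refine ⟨h1.congr_of_eventuallyEq he he', fun v w => ?_⟩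
  rw [he.fderivWithin_eq he', h2, hcomp.self_of_nhdsWithin hy]
  rfl

end Forms

theorem continuousLinearMapAt_trivial {B : Type*} [TopologicalSpace B] (x y : B) (v : ℝ) :
    (trivializationAt ℝ (Trivial B ℝ) x).continuousLinearMapAt ℝ y v = v := by
  have h : y ∈ (trivializationAt ℝ (Trivial B ℝ) x).baseSet := mem_univ _
  rw [Trivialization.continuousLinearMapAt_apply, Trivialization.coe_linearMapAt_of_mem _ h]
  rfl

section SmoothForms

variable {S : Type*} [TopologicalSpace S] [ChartedSpace (EuclideanQuadrant 2) S]
  [IsManifold surfModel ∞ S]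

theorem isManifold_one {E : Type*} [NormedAddCommGroup E] [NormedSpace ℝ E]
    {H : Type*} [TopologicalSpace H] {I : ModelWithCorners ℝ E H}
    {M : Type*} [TopologicalSpace M] [ChartedSpace H M] [IsManifold I ∞ M] : IsManifold I 1 M :=
  IsManifold.of_le ((by norm_num : (1 : WithTop ℕ∞) ≤ 3).trans three_le_infty)

/-- Smoothness as a section of the Hom bundle is smoothness in the trivialization at `x`, and on the
chart domain that expression is exactly `formRep`. -/
theorem SmoothFormOn.hasExtDeriv {α : ∀ z : S, TangentSpace surfModel z →L[ℝ] ℝ} {A : Set S}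
    (h : SmoothFormOn α A) (hA : IsOpen A) {x : S} (hx : x ∈ A) :
    HasExtDeriv surfModel α (extDeriv₁ surfModel α) x := by
  have : IsManifold surfModel 1 S := isManifold_one
  apply hasExtDeriv_of_formRep
  have h1 := ((contMDiffAt_hom_bundle _).1 ((h x hx).contMDiffAt (hA.mem_nhds hx))).2
  have h2 : ContMDiffWithinAt 𝓘(ℝ, EuclideanSpace ℝ (Fin 2)) surfModel ∞ (extChartAt surfModel x).symm
      (range surfModel) (extChartAt surfModel x x) :=
    contMDiffWithinAt_extChartAt_symm_range_self x
  have h3 : (extChartAt surfModel x).symm (extChartAt surfModel x x) = x :=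
    extChartAt_to_inv (I := surfModel) x
  have h4 := ContMDiffAt.comp_contMDiffWithinAt_of_eq (x := extChartAt surfModel x x) h1 h2 h3
  refine ((contMDiffWithinAt_iff_contDiffWithinAt.1 h4).of_le
    ((by norm_num : (1 : WithTop ℕ∞) ≤ 3).trans three_le_infty)).congr_of_eventuallyEq ?_ ?_
  all_goals
    have key : ∀ y ∈ (extChartAt surfModel x).target, formRep surfModel α x y =
        ContinuousLinearMap.inCoordinates (EuclideanSpace ℝ (Fin 2)) (fun z : S => TangentSpace surfModel z) ℝ (Trivial S ℝ) x
          ((extChartAt surfModel x).symm y) x ((extChartAt surfModel x).symm y)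
          (α ((extChartAt surfModel x).symm y)) := by
      intro y hy
      have h5 : (extChartAt surfModel x).symm y ∈ (chartAt (EuclideanQuadrant 2) x).source := by
        simpa using (extChartAt surfModel x).map_target hy
      have h6 := TangentBundle.symmL_trivializationAt (I := surfModel) h5
      rw [(extChartAt surfModel x).right_inv hy] at h6
      unfold ContinuousLinearMap.inCoordinates formRep
      rw [h6]
      ext v
      exact (continuousLinearMapAt_trivial x _ _).symm
  · filter_upwards [extChartAt_target_mem_nhdsWithin (I := surfModel) x] with y hy
    exact key y hy
  · exact key _ (mem_extChartAt_target x)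

end SmoothForms

/-! ### Canonical coordinates on the cotangent bundle, and the radial function -/

section Cotangent

variable {n : ℕ} {Q : Type*} [TopologicalSpace Q] [ChartedSpace (EuclideanSpace ℝ (Fin n)) Q]
  [IsManifold (𝓡 n) ∞ Q]

/-- The covector `p` of a point of `T*Q`. -/
def covector (x : Cot n Q) : EuclideanSpace ℝ (Fin n) →L[ℝ] ℝ := x.snd

theorem extChartAt_cot_apply (x y : Cot n Q) : extChartAt (cotModel n) x y =
    (extChartAt (𝓡 n) x.proj y.proj,
      ContinuousLinearMap.inCoordinates (EuclideanSpace ℝ (Fin n))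
        (fun q : Q => TangentSpace (𝓡 n) q) ℝ (Trivial Q ℝ) x.proj y.proj x.proj y.proj y.snd) := by
  rw [FiberBundle.extChartAt]
  rfl

theorem mem_extChartAt_cot_source {x y : Cot n Q} : y ∈ (extChartAt (cotModel n) x).source ↔
    y.proj ∈ (chartAt (EuclideanSpace ℝ (Fin n)) x.proj).source := by
  rw [FiberBundle.extChartAt]
  simp only [PartialEquiv.trans_source, PartialEquiv.prod_source, mem_inter_iff, mem_preimage,
    mem_prod, extChartAt_source, PartialEquiv.refl_source, mem_univ, and_true]
  constructor
  · exact fun h => h.2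
  · exact fun h => ⟨by simpa using h, h⟩

theorem mem_extChartAt_cot_target {x : Cot n Q}
    {a : EuclideanSpace ℝ (Fin n) × (EuclideanSpace ℝ (Fin n) →L[ℝ] ℝ)} :
    a ∈ (extChartAt (cotModel n) x).target ↔ a.1 ∈ (extChartAt (𝓡 n) x.proj).target := by
  rw [FiberBundle.extChartAt_target]
  simp only [mem_inter_iff, mem_prod, mem_univ, and_true, mem_preimage]
  constructor
  · exact fun h => h.1
  · intro h
    refine ⟨h, ?_⟩
    have := (extChartAt (𝓡 n) x.proj).map_target h
    simpa using this

theorem extChartAt_cot_symm_proj {x : Cot n Q}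
    {a : EuclideanSpace ℝ (Fin n) × (EuclideanSpace ℝ (Fin n) →L[ℝ] ℝ)}
    (ha : a ∈ (extChartAt (cotModel n) x).target) :
    ((extChartAt (cotModel n) x).symm a).proj = (extChartAt (𝓡 n) x.proj).symm a.1 := by
  have h1 := (extChartAt (cotModel n) x).right_inv ha
  have h3 := (extChartAt (cotModel n) x).map_target ha
  rw [extChartAt_cot_apply] at h1
  rw [← congrArg Prod.fst h1]
  refine ((extChartAt (𝓡 n) x.proj).left_inv ?_).symm
  rw [extChartAt_source]
  exact mem_extChartAt_cot_source.1 h3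

theorem inCoordinates_covector {q b : Q} (hb : b ∈ (chartAt (EuclideanSpace ℝ (Fin n)) q).source)
    (P : TangentSpace (𝓡 n) b →L[ℝ] Trivial Q ℝ b) :
    ContinuousLinearMap.inCoordinates (EuclideanSpace ℝ (Fin n))
        (fun q : Q => TangentSpace (𝓡 n) q) ℝ (Trivial Q ℝ) q b q b P =
      ContinuousLinearMap.comp (show TangentSpace (𝓡 n) b →L[ℝ] ℝ from P)
        (mfderivWithin 𝓘(ℝ, EuclideanSpace ℝ (Fin n)) (𝓡 n) (extChartAt (𝓡 n) q).symm
          (range (𝓡 n)) (extChartAt (𝓡 n) q b)) := by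
  have : IsManifold (𝓡 n) 1 Q := isManifold_one
  have h6 := TangentBundle.symmL_trivializationAt (I := 𝓡 n) hb
  unfold ContinuousLinearMap.inCoordinates
  rw [h6]
  ext v
  exact continuousLinearMapAt_trivial q b _

theorem mfderivWithin_extChartAt_symm_self {E : Type*} [NormedAddCommGroup E] [NormedSpace ℝ E]
    {H : Type*} [TopologicalSpace H] {I : ModelWithCorners ℝ E H}
    {M : Type*} [TopologicalSpace M] [ChartedSpace H M] [IsManifold I 1 M] (x : M) (v : E) :
    mfderivWithin 𝓘(ℝ, E) I (extChartAt I x).symm (range I) (extChartAt I x x) v = v := by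
  rw [← TangentBundle.symmL_trivializationAt (mem_chart_source H x),
    TangentBundle.symmL_trivializationAt_eq_core (mem_chart_source H x)]
  exact tangentCoordChange_self (I := I) (mem_extChartAt_source (I := I) x)

/-- In the bundle chart `λ` becomes literally `p dq`: the fibre coordinate of a covector is its
composition with the derivative of the inverse base chart, and the projection becomes `Prod.fst`. -/
theorem formRep_liouville {x : Cot n Q}
    {a : EuclideanSpace ℝ (Fin n) × (EuclideanSpace ℝ (Fin n) →L[ℝ] ℝ)}
    (ha : a ∈ (extChartAt (cotModel n) x).target) :
    formRep (cotModel n) liouville x a = a.2.comp (ContinuousLinearMap.fst ℝ _ _) := by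
  have : IsManifold (𝓡 n) 1 Q := isManifold_one
  have : IsManifold (cotModel n) 1 (Cot n Q) := isManifold_one
  have hb := mem_extChartAt_cot_target.1 ha
  have h1 := (extChartAt (cotModel n) x).right_inv ha
  have h2 := extChartAt_cot_symm_proj ha
  have h3 : MDifferentiableWithinAt 𝓘(ℝ, EuclideanSpace ℝ (Fin n) × (EuclideanSpace ℝ (Fin n) →L[ℝ] ℝ))
      (cotModel n) (extChartAt (cotModel n) x).symm (range (cotModel n)) a :=
    mdifferentiableWithinAt_extChartAt_symm ha
  have hru : range (cotModel n) = univ := (cotModel n).range_eq_univ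
  have hru' : range (𝓡 n) = univ := (𝓡 n).range_eq_univ
  have h4 : MDifferentiableAt (cotModel n) (𝓡 n) (fun y : Cot n Q => y.proj)
      ((extChartAt (cotModel n) x).symm a) :=
    (contMDiffAt_proj (n := 1) _).mdifferentiableAt (by norm_num)
  have h5 := mfderiv_comp_mfderivWithin a h4 h3
    ((cotModel n).uniqueDiffOn.uniqueDiffWithinAt (by rw [hru]; trivial)).uniqueMDiffWithinAt
  have h6 : ((fun y : Cot n Q => y.proj) ∘ (extChartAt (cotModel n) x).symm) =ᶠ[𝓝[range (cotModel n)] a]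
      (extChartAt (𝓡 n) x.proj).symm ∘ Prod.fst := by
    have : (extChartAt (cotModel n) x).target ∈ 𝓝[range (cotModel n)] a :=
      extChartAt_target_mem_nhdsWithin_of_mem ha
    filter_upwards [this] with b hb using extChartAt_cot_symm_proj hb
  rw [h6.mfderivWithin_eq (h2 : _ = _)] at h5
  have h7 : ∀ v : EuclideanSpace ℝ (Fin n) × (EuclideanSpace ℝ (Fin n) →L[ℝ] ℝ),
      mfderivWithin 𝓘(ℝ, EuclideanSpace ℝ (Fin n) × (EuclideanSpace ℝ (Fin n) →L[ℝ] ℝ)) (𝓡 n)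
      ((extChartAt (𝓡 n) x.proj).symm ∘ Prod.fst) (range (cotModel n)) a v =
      mfderivWithin 𝓘(ℝ, EuclideanSpace ℝ (Fin n)) (𝓡 n) (extChartAt (𝓡 n) x.proj).symm
          (range (𝓡 n)) a.1 v.1 := by
    intro v
    rw [hru, hru', mfderivWithin_univ, mfderivWithin_univ]
    have h8 : MDifferentiableWithinAt 𝓘(ℝ, EuclideanSpace ℝ (Fin n)) (𝓡 n)
        (extChartAt (𝓡 n) x.proj).symm (range (𝓡 n)) a.1 :=
      mdifferentiableWithinAt_extChartAt_symm hb
    rw [hru', mdifferentiableWithinAt_univ] at h8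
    have h9 : HasMFDerivAt 𝓘(ℝ, EuclideanSpace ℝ (Fin n) × (EuclideanSpace ℝ (Fin n) →L[ℝ] ℝ))
        𝓘(ℝ, EuclideanSpace ℝ (Fin n)) (Prod.fst) a (ContinuousLinearMap.fst ℝ
          (EuclideanSpace ℝ (Fin n)) (EuclideanSpace ℝ (Fin n) →L[ℝ] ℝ)) :=
      hasFDerivAt_fst.hasMFDerivAt
    rw [(h8.hasMFDerivAt.comp a h9).mfderiv]
    rfl
  rw [extChartAt_cot_apply] at h1
  have h10 : ((extChartAt (cotModel n) x).symm a).proj ∈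
      (chartAt (EuclideanSpace ℝ (Fin n)) x.proj).source := by
    rw [h2]; simpa using (extChartAt (𝓡 n) x.proj).map_target hb
  have h11 := congrArg Prod.snd h1
  simp only at h11
  rw [inCoordinates_covector h10] at h11
  have h12 : extChartAt (𝓡 n) x.proj ((extChartAt (cotModel n) x).symm a).proj = a.1 :=
    congrArg Prod.fst h1
  rw [h12] at h11
  rw [← h11]
  unfold formRep liouville
  refine ContinuousLinearMap.ext fun v => ?_
  exact congrArg (fun T : TangentSpace (𝓡 n) _ => (show TangentSpace (𝓡 n) _ →L[ℝ] ℝ from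
    ((extChartAt (cotModel n) x).symm a).snd) T) ((DFunLike.congr_fun h5.symm v).trans (h7 v))

end Cotangent

section Cotangent

variable {n : ℕ} {Q : Type*} [TopologicalSpace Q] [ChartedSpace (EuclideanSpace ℝ (Fin n)) Q]
  [IsManifold (𝓡 n) ∞ Q]

theorem extChartAt_cot_self (x : Cot n Q) :
    extChartAt (cotModel n) x x = (extChartAt (𝓡 n) x.proj x.proj, covector x) := by
  have : IsManifold (𝓡 n) 1 Q := isManifold_one
  rw [extChartAt_cot_apply, inCoordinates_covector (mem_chart_source _ _)]
  refine Prod.ext rfl (ContinuousLinearMap.ext fun v => ?_)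
  exact congrArg (covector x) (mfderivWithin_extChartAt_symm_self (I := 𝓡 n) x.proj v)

theorem hasFDerivAt_formRep_liouville (x : Cot n Q) :
    HasFDerivAt (formRep (cotModel n) (liouville (n := n) (Q := Q)) x)
      (((ContinuousLinearMap.compL ℝ (EuclideanSpace ℝ (Fin n) × (EuclideanSpace ℝ (Fin n) →L[ℝ] ℝ))
        (EuclideanSpace ℝ (Fin n)) ℝ).flip (ContinuousLinearMap.fst ℝ _ _)).comp
        (ContinuousLinearMap.snd ℝ _ _)) (extChartAt (cotModel n) x x) := by
  have h1 : (extChartAt (cotModel n) x).target ∈ 𝓝 (extChartAt (cotModel n) x x) :=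
    extChartAt_target_mem_nhds x
  refine HasFDerivAt.congr_of_eventuallyEq (ContinuousLinearMap.hasFDerivAt _) ?_
  filter_upwards [h1] with a ha
  rw [formRep_liouville ha]
  rfl

/-- The representative of `λ` is linear in the fibre coordinate, so its derivative is constant and
`ω` has the standard form `dp ∧ dq` in the preferred chart at each point. -/
theorem symplectic_apply (x : Cot n Q)
    (v w : EuclideanSpace ℝ (Fin n) × (EuclideanSpace ℝ (Fin n) →L[ℝ] ℝ)) :
    symplectic x v w = v.2 w.1 - w.2 v.1 := by
  refine (extDeriv₁_eq_formRep (cotModel n) liouville x v w).trans ?_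
  rw [(cotModel n).range_eq_univ, fderivWithin_univ, (hasFDerivAt_formRep_liouville x).fderiv]
  rfl

theorem hasExtDeriv_liouville (x : Cot n Q) :
    HasExtDeriv (cotModel n) (liouville (n := n) (Q := Q)) symplectic x := by
  apply hasExtDeriv_of_formRep
  have h1 : (extChartAt (cotModel n) x).target ∈ 𝓝 (extChartAt (cotModel n) x x) :=
    extChartAt_target_mem_nhds x
  refine ContDiffAt.contDiffWithinAt ?_
  refine ContDiffAt.congr_of_eventuallyEq (f := fun a =>
    (((ContinuousLinearMap.compL ℝ (EuclideanSpace ℝ (Fin n) × (EuclideanSpace ℝ (Fin n) →L[ℝ] ℝ))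
        (EuclideanSpace ℝ (Fin n)) ℝ).flip (ContinuousLinearMap.fst ℝ _ _)).comp
        (ContinuousLinearMap.snd ℝ _ _)) a) (ContinuousLinearMap.contDiff _).contDiffAt ?_
  filter_upwards [h1] with a ha
  rw [formRep_liouville ha]
  rfl

theorem liouville_apply (x : Cot n Q)
    (v : EuclideanSpace ℝ (Fin n) × (EuclideanSpace ℝ (Fin n) →L[ℝ] ℝ)) :
    liouville x v = covector x v.1 := by
  have : IsManifold (cotModel n) 1 (Cot n Q) := isManifold_one
  have h := DFunLike.congr_fun (formRep_liouville (mem_extChartAt_target (I := cotModel n) x)) v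
  unfold formRep at h
  have h2 := mfderivWithin_extChartAt_symm_self (I := cotModel n) x v
  rw [extChartAt_cot_self] at h
  have h3 : (extChartAt (cotModel n) x).symm (extChartAt (cotModel n) x x) = x :=
    extChartAt_to_inv (I := cotModel n) x
  rw [extChartAt_cot_self] at h2 h3
  have h4 : ∀ x' : Cot n Q, x' = x →
      ∀ w : EuclideanSpace ℝ (Fin n) × (EuclideanSpace ℝ (Fin n) →L[ℝ] ℝ),
        w = v → liouville x' w = liouville x v := by
    rintro _ rfl _ rfl
    rfl
  exact (h4 _ h3 _ h2).symm.trans h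

/-- The vertical tangent vector at `(q, p)` given by `p`. -/
def radialVector (x : Cot n Q) : TangentSpace (cotModel n) x :=
  show EuclideanSpace ℝ (Fin n) × (EuclideanSpace ℝ (Fin n) →L[ℝ] ℝ) from (0, covector x)

/-- The radial vector is the Liouville field. This turns evaluations of `λ` on Hamiltonian fields
into radial derivatives. -/
theorem symplectic_radialVector (x : Cot n Q) (v : TangentSpace (cotModel n) x) :
    symplectic x (radialVector x) v = liouville x v := by
  refine (symplectic_apply x _ _).trans (Eq.trans ?_ (liouville_apply x v).symm)
  simp [radialVector]

theorem symplectic_swap (x : Cot n Q) (v w : TangentSpace (cotModel n) x) :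
    symplectic x v w = - symplectic x w v := by
  refine (symplectic_apply x v w).trans (Eq.trans ?_ (congrArg (- ·) (symplectic_apply x w v).symm))
  ring

theorem symplectic_self (x : Cot n Q) (v : TangentSpace (cotModel n) x) : symplectic x v v = 0 := by
  have := symplectic_swap x v v
  linarith

theorem symplectic_add_left (x : Cot n Q) (v v' w : TangentSpace (cotModel n) x) :
    symplectic x (v + v') w = symplectic x v w + symplectic x v' w := by
  refine (symplectic_apply x _ _).trans (Eq.trans ?_
    (congrArg₂ (· + ·) (symplectic_apply x v w).symm (symplectic_apply x v' w).symm))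
  obtain ⟨a, b⟩ := v
  obtain ⟨a', b'⟩ := v'
  obtain ⟨a₁, b₁⟩ := w
  change (b + b') a₁ - b₁ (a + a') = (b a₁ - b₁ a) + (b' a₁ - b₁ a')
  rw [map_add, add_apply]
  ring

theorem symplectic_smul_left (x : Cot n Q) (c : ℝ) (v w : TangentSpace (cotModel n) x) :
    symplectic x (c • v) w = c * symplectic x v w := by
  refine (symplectic_apply x _ _).trans (Eq.trans ?_
    (congrArg (c * ·) (symplectic_apply x v w).symm))
  obtain ⟨a, b⟩ := v
  obtain ⟨a₁, b₁⟩ := w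
  change (c • b) a₁ - b₁ (c • a) = c * (b a₁ - b₁ a)
  rw [map_smul, smul_apply, smul_eq_mul, smul_eq_mul]
  ring

theorem symplectic_add_right (x : Cot n Q) (v w w' : TangentSpace (cotModel n) x) :
    symplectic x v (w + w') = symplectic x v w + symplectic x v w' := by
  rw [symplectic_swap, symplectic_add_left, symplectic_swap x w, symplectic_swap x w']
  ring

theorem symplectic_smul_right (x : Cot n Q) (c : ℝ) (v w : TangentSpace (cotModel n) x) :
    symplectic x v (c • w) = c * symplectic x v w := by
  rw [symplectic_swap, symplectic_smul_left, symplectic_swap x w]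
  ring

theorem symplectic_nondegenerate (x : Cot n Q) {v : TangentSpace (cotModel n) x}
    (h : ∀ w, symplectic x v w = 0) : v = 0 := by
  have h' : ∀ w : EuclideanSpace ℝ (Fin n) × (EuclideanSpace ℝ (Fin n) →L[ℝ] ℝ),
    (show EuclideanSpace ℝ (Fin n) × (EuclideanSpace ℝ (Fin n) →L[ℝ] ℝ) from v).2 w.1 -
    w.2 (show EuclideanSpace ℝ (Fin n) × (EuclideanSpace ℝ (Fin n) →L[ℝ] ℝ) from v).1 = 0 :=
    fun w => (symplectic_apply x v w).symm.trans (h w)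
  refine Prod.ext (?_ : (show EuclideanSpace ℝ (Fin n) × (EuclideanSpace ℝ (Fin n) →L[ℝ] ℝ) from v).1 = 0)
    (?_ : (show EuclideanSpace ℝ (Fin n) × (EuclideanSpace ℝ (Fin n) →L[ℝ] ℝ) from v).2 = 0)
  · ext i
    have := h' (0, EuclideanSpace.proj i)
    simpa using this
  · ext w
    have := h' (w, 0)
    simpa using this

theorem symplectic_surjective (x : Cot n Q) (L : TangentSpace (cotModel n) x →L[ℝ] ℝ) :
    ∃ X, ∀ v, symplectic x X v = L v := by
  let L' : EuclideanSpace ℝ (Fin n) × (EuclideanSpace ℝ (Fin n) →L[ℝ] ℝ) →L[ℝ] ℝ := L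
  -- Forced by `ω(X, v) = X.2 v.1 - v.2 X.1`: the vertical vectors `v = (0, dxᵢ)` determine the
  -- components of `X.1`, the horizontal ones determine `X.2`.
  let q : EuclideanSpace ℝ (Fin n) := WithLp.toLp 2 fun i => - L' (0, EuclideanSpace.proj i)
  let X : EuclideanSpace ℝ (Fin n) × (EuclideanSpace ℝ (Fin n) →L[ℝ] ℝ) :=
    (q, L'.comp (ContinuousLinearMap.inl ℝ _ _))
  refine ⟨X, fun v => ?_⟩
  refine (symplectic_apply x X v).trans ?_
  change _ = L' v
  obtain ⟨a, b⟩ := (show EuclideanSpace ℝ (Fin n) × (EuclideanSpace ℝ (Fin n) →L[ℝ] ℝ) from v)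
  have hb : b = ∑ i, b (EuclideanSpace.single i 1) • (EuclideanSpace.proj i : EuclideanSpace ℝ (Fin n) →L[ℝ] ℝ) := by
    ext w
    have hw : w = ∑ i, w i • EuclideanSpace.single i (1 : ℝ) := by
      simpa [EuclideanSpace.basisFun_apply] using ((EuclideanSpace.basisFun (Fin n) ℝ).sum_repr w).symm
    conv_lhs => rw [hw]
    simp [mul_comm]
  have h1 : L' (a, b) = L' (a, 0) + L' (0, b) := by rw [← map_add]; simp
  have h2 : L' (0, b) = ∑ i, b (EuclideanSpace.single i 1) * L' (0, EuclideanSpace.proj i) := by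
    have : ((0, b) : EuclideanSpace ℝ (Fin n) × (EuclideanSpace ℝ (Fin n) →L[ℝ] ℝ)) =
      ContinuousLinearMap.inr ℝ _ _ b := rfl
    rw [this, hb]
    simp only [map_sum, map_smul, smul_eq_mul]
    refine Finset.sum_congr rfl fun i _ => ?_
    rw [← hb]
    rfl
  have h3 : b q = - L' (0, b) := by
    rw [h2]
    conv_lhs => rw [hb]
    simp [q]
  rw [h1]
  simp only [X]
  rw [h3]
  simp

/-- The choice operator in `hamVF` does select a solution, because `ω` is surjective onto covectors.
-/
theorem symplectic_hamVF (F : Cot n Q → ℝ) (x : Cot n Q) (v : TangentSpace (cotModel n) x) :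
    symplectic x (hamVF F x) v = - mvfderiv (cotModel n) F x v := by
  have : ∃ X : TangentSpace (cotModel n) x,
      ∀ v, symplectic x X v = - mvfderiv (cotModel n) F x v :=
    symplectic_surjective x (- mvfderiv (cotModel n) F x)
  exact Classical.epsilon_spec this v

/-! The radial function -/

/-- Needed because `ContinuousLinearMap.inverse` has the default value `0` on non-invertible maps.
Positivity gives injectivity, and the two dimensions agree. -/
theorem isInvertible_inner (g : Metric n Q) (b : Q) : (g.inner b).IsInvertible := by
  have hinj : Function.Injective (g.inner b) := by
    refine (injective_iff_map_eq_zero (g.inner b)).2 fun v hv => ?_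
    by_contra h0
    have := g.pos b v h0
    rw [hv] at this
    simp at this
  have : FiniteDimensional ℝ (TangentSpace (𝓡 n) b) :=
    inferInstanceAs (FiniteDimensional ℝ (EuclideanSpace ℝ (Fin n)))
  have hfin : Module.finrank ℝ (EuclideanSpace ℝ (Fin n)) =
      Module.finrank ℝ (EuclideanSpace ℝ (Fin n) →L[ℝ] ℝ) := by
    rw [← (InnerProductSpace.toDual ℝ (EuclideanSpace ℝ (Fin n))).toLinearEquiv.finrank_eq]
  let G : EuclideanSpace ℝ (Fin n) →L[ℝ] EuclideanSpace ℝ (Fin n) →L[ℝ] ℝ := g.inner b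
  have hG : Function.Injective G := hinj
  let e := LinearEquiv.ofInjectiveOfFinrankEq G.toLinearMap hG hfin
  exact ⟨e.toContinuousLinearEquiv, by ext v; rfl⟩

theorem inner_dualVector (g : Metric n Q) (x : Cot n Q) :
    g.inner x.proj (dualVector g x) = (show TangentSpace (𝓡 n) x.proj →L[ℝ] ℝ from x.snd) :=
  (((isInvertible_inner g x.proj).inverse_apply_eq).1 rfl).symm

theorem radial_smul (g : Metric n Q) (x : Cot n Q) (t : ℝ) :
    radial g (⟨x.proj, t • x.snd⟩ : Cot n Q) = |t| * radial g x := by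
  have h : dualVector g (⟨x.proj, t • x.snd⟩ : Cot n Q) = t • dualVector g x :=
    map_smul (ContinuousLinearMap.inverse (g.inner x.proj)) t x.snd
  unfold radial
  rw [h, ← Real.sqrt_sq_eq_abs, ← Real.sqrt_mul (sq_nonneg t)]
  congr 1
  change t • (show TangentSpace (𝓡 n) x.proj →L[ℝ] ℝ from x.snd) (t • dualVector g x) = _
  rw [map_smul, smul_eq_mul, smul_eq_mul]
  ring

/-- The metric in the chart at `q`. -/
def metricRep (g : Metric n Q) (q b : Q) :
    EuclideanSpace ℝ (Fin n) →L[ℝ] EuclideanSpace ℝ (Fin n) →L[ℝ] ℝ :=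
  ContinuousLinearMap.inCoordinates (EuclideanSpace ℝ (Fin n))
    (fun q : Q => TangentSpace (𝓡 n) q) (EuclideanSpace ℝ (Fin n) →L[ℝ] ℝ)
    (fun q : Q => TangentSpace (𝓡 n) q →L[ℝ] Trivial Q ℝ q) q b q b (g.inner b)

theorem contMDiffAt_metricRep (g : Metric n Q) (q : Q) :
    ContMDiffAt (𝓡 n) 𝓘(ℝ, EuclideanSpace ℝ (Fin n) →L[ℝ] EuclideanSpace ℝ (Fin n) →L[ℝ] ℝ) ∞
      (metricRep g q) q :=
  ((contMDiffAt_hom_bundle _).1 (g.contMDiff q)).2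

theorem metricRep_apply (g : Metric n Q) {q b : Q}
    (hb : b ∈ (chartAt (EuclideanSpace ℝ (Fin n)) q).source) (v w : EuclideanSpace ℝ (Fin n)) :
    metricRep g q b v w = g.inner b
      ((trivializationAt (EuclideanSpace ℝ (Fin n)) (TangentSpace (𝓡 n)) q).symm b v)
      ((trivializationAt (EuclideanSpace ℝ (Fin n)) (TangentSpace (𝓡 n)) q).symm b w) := by
  unfold metricRep
  have := inCoordinates_apply_eq₂ (𝕜 := ℝ) (F₁ := EuclideanSpace ℝ (Fin n))
    (E₁ := fun q : Q => TangentSpace (𝓡 n) q) (F₂ := EuclideanSpace ℝ (Fin n))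
    (E₂ := fun q : Q => TangentSpace (𝓡 n) q) (F₃ := ℝ) (E₃ := Trivial Q ℝ) (x₀ := q) (x := b)
    (ϕ := g.inner b) (v := v) (w := w) (by simpa using hb) (by simpa using hb) (mem_univ _)
  refine this.trans ?_
  exact continuousLinearMapAt_trivial q b _

/-- Expresses `ρ² = p(g⁻¹ p)` in a fixed trivialization, where the metric is a smooth
operator-valued function of the base point; smoothness of `ρ` off its zero set then follows from
that of inversion and of the square root. -/
theorem radial_eq (g : Metric n Q) {q : Q} {x : Cot n Q}
    (hb : x.proj ∈ (chartAt (EuclideanSpace ℝ (Fin n)) q).source) :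
    (metricRep g q x.proj).IsInvertible ∧
    radial g x = Real.sqrt ((ContinuousLinearMap.inCoordinates (EuclideanSpace ℝ (Fin n))
        (fun q : Q => TangentSpace (𝓡 n) q) ℝ (Trivial Q ℝ) q x.proj q x.proj x.snd)
      ((metricRep g q x.proj).inverse (ContinuousLinearMap.inCoordinates (EuclideanSpace ℝ (Fin n))
        (fun q : Q => TangentSpace (𝓡 n) q) ℝ (Trivial Q ℝ) q x.proj q x.proj x.snd))) := by
  have hb' : x.proj ∈ (trivializationAt (EuclideanSpace ℝ (Fin n)) (TangentSpace (𝓡 n)) q).baseSet := by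
    simpa using hb
  let σ := (trivializationAt (EuclideanSpace ℝ (Fin n)) (TangentSpace (𝓡 n)) q).continuousLinearEquivAt
    ℝ x.proj hb'
  have hσ : ∀ v, σ.symm v =
    (trivializationAt (EuclideanSpace ℝ (Fin n)) (TangentSpace (𝓡 n)) q).symm x.proj v := fun v => rfl
  set p := ContinuousLinearMap.inCoordinates (EuclideanSpace ℝ (Fin n))
        (fun q : Q => TangentSpace (𝓡 n) q) ℝ (Trivial Q ℝ) q x.proj q x.proj x.snd with hp
  have hpa : ∀ v, p v = (show TangentSpace (𝓡 n) x.proj →L[ℝ] ℝ from x.snd) (σ.symm v) := by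
    intro v
    rw [hp, ContinuousLinearMap.inCoordinates_eq hb' (mem_univ _)]
    rfl
  have hinj : Function.Injective (metricRep g q x.proj) := by
    refine (injective_iff_map_eq_zero (metricRep g q x.proj)).2 fun v hv => ?_
    by_contra h0
    have h1 : σ.symm v ≠ 0 := by simpa using h0
    have h2 := g.pos x.proj _ h1
    rw [hσ, ← metricRep_apply g hb, hv] at h2
    simp at h2
  have hfin : Module.finrank ℝ (EuclideanSpace ℝ (Fin n)) =
      Module.finrank ℝ (EuclideanSpace ℝ (Fin n) →L[ℝ] ℝ) := by
    rw [← (InnerProductSpace.toDual ℝ (EuclideanSpace ℝ (Fin n))).toLinearEquiv.finrank_eq]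
  have hinv : (metricRep g q x.proj).IsInvertible := by
    let e := LinearEquiv.ofInjectiveOfFinrankEq (metricRep g q x.proj).toLinearMap hinj hfin
    exact ⟨e.toContinuousLinearEquiv, by ext v; rfl⟩
  refine ⟨hinv, ?_⟩
  have h3 : (metricRep g q x.proj).inverse p = σ (dualVector g x) := by
    rw [hinv.inverse_apply_eq]
    ext w
    rw [hpa, metricRep_apply g hb, ← hσ, ← hσ, σ.symm_apply_apply, inner_dualVector]
  rw [h3, hpa, σ.symm_apply_apply]
  rfl

theorem contMDiffAt_radial (g : Metric n Q) {x : Cot n Q} (hx : radial g x ≠ 0) :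
    ContMDiffAt (cotModel n) 𝓘(ℝ) ∞ (radial g) x := by
  have h1 : ContMDiffAt (cotModel n)
      𝓘(ℝ, EuclideanSpace ℝ (Fin n) →L[ℝ] EuclideanSpace ℝ (Fin n) →L[ℝ] ℝ) ∞
      (fun y : Cot n Q => metricRep g x.proj y.proj) x :=
    (contMDiffAt_metricRep g x.proj).comp x (contMDiffAt_proj _)
  have h2 : ContMDiffAt (cotModel n) 𝓘(ℝ, EuclideanSpace ℝ (Fin n) →L[ℝ] ℝ) ∞
      (fun y : Cot n Q => ContinuousLinearMap.inCoordinates (EuclideanSpace ℝ (Fin n))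
        (fun q : Q => TangentSpace (𝓡 n) q) ℝ (Trivial Q ℝ) x.proj y.proj x.proj y.proj y.snd) x :=
    ((contMDiffAt_hom_bundle (fun y : Cot n Q => y)).1 contMDiffAt_id).2
  have hx0 := radial_eq g (q := x.proj) (x := x) (mem_chart_source _ _)
  obtain ⟨e, he⟩ := hx0.1
  have h3 : ContMDiffAt (cotModel n)
      𝓘(ℝ, (EuclideanSpace ℝ (Fin n) →L[ℝ] ℝ) →L[ℝ] EuclideanSpace ℝ (Fin n)) ∞
      (fun y : Cot n Q => (metricRep g x.proj y.proj).inverse) x := by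
    have : ContDiffAt ℝ ∞ ContinuousLinearMap.inverse (metricRep g x.proj x.proj) := by
      rw [← he]
      exact contDiffAt_map_inverse e
    exact this.contMDiffAt.comp x h1
  have h4 := h2.clm_apply (h3.clm_apply h2)
  have hne := hx
  rw [hx0.2] at hne
  have h5 := (Real.contDiffAt_sqrt (n := ∞) (Real.sqrt_ne_zero'.1 hne).ne').contMDiffAt.comp x h4
  refine h5.congr_of_eventuallyEq ?_
  have : {y : Cot n Q | y.proj ∈ (chartAt (EuclideanSpace ℝ (Fin n)) x.proj).source} ∈ 𝓝 x :=
    ((FiberBundle.continuous_proj _ _).isOpen_preimage _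
      (chartAt (EuclideanSpace ℝ (Fin n)) x.proj).open_source).mem_nhds (mem_chart_source _ _)
  filter_upwards [this] with y hy
  exact (radial_eq g hy).2

/-- Euler's identity for a function homogeneous of degree one: differentiate `ρ(q, (1 + t) p) = |1 +
t| ρ(q, p)` at `t = 0`, along a straight line in the chart. -/
theorem dRadial_radialVector (g : Metric n Q) {x : Cot n Q} (hx : radial g x ≠ 0) :
    dRadial g x (radialVector x) = radial g x := by
  have hd : MDifferentiableAt (cotModel n) 𝓘(ℝ) (radial g) x :=
    (contMDiffAt_radial g hx).mdifferentiableAt (by simp)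
  let c : ℝ → EuclideanSpace ℝ (Fin n) × (EuclideanSpace ℝ (Fin n) →L[ℝ] ℝ) := fun t =>
    (extChartAt (𝓡 n) x.proj x.proj, (1 + t) • covector x)
  have hc0 : c 0 = extChartAt (cotModel n) x x := by rw [extChartAt_cot_self]; simp [c]
  have hc : HasDerivAt c (radialVector x) 0 := by
    refine HasDerivAt.prodMk (hasDerivAt_const _ _) ?_
    have := ((hasDerivAt_id (0 : ℝ)).const_add 1).smul_const (covector x)
    simpa using this
  have hpt : ∀ t, (extChartAt (cotModel n) x).symm (c t) = (⟨x.proj, (1 + t) • x.snd⟩ : Cot n Q) := by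
    intro t
    have hsrc : (⟨x.proj, (1 + t) • x.snd⟩ : Cot n Q) ∈ (extChartAt (cotModel n) x).source :=
      mem_extChartAt_cot_source.2 (mem_chart_source _ _)
    rw [← (extChartAt (cotModel n) x).left_inv hsrc]
    congr 1
    rw [extChartAt_cot_apply]
    refine Prod.ext rfl ?_
    have h1 := congrArg Prod.snd (extChartAt_cot_self x)
    rw [extChartAt_cot_apply] at h1
    simp only at h1
    rw [inCoordinates_covector (mem_chart_source _ _)] at h1 ⊢
    simp only [c]
    rw [← h1]
    rfl
  let D : EuclideanSpace ℝ (Fin n) × (EuclideanSpace ℝ (Fin n) →L[ℝ] ℝ) →L[ℝ] ℝ := dRadial g x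
  have hf : HasFDerivAt (radial g ∘ (extChartAt (cotModel n) x).symm) D (c 0) := by
    have : HasFDerivWithinAt (radial g ∘ (extChartAt (cotModel n) x).symm) D
      (range (cotModel n)) (extChartAt (cotModel n) x x) := hd.hasMFDerivAt.2
    rw [hc0]
    exact this.hasFDerivAt (by rw [(cotModel n).range_eq_univ]; exact univ_mem)
  have h1 := hf.comp_hasDerivAt 0 hc
  have h2 : (radial g ∘ (extChartAt (cotModel n) x).symm) ∘ c = fun t => |1 + t| * radial g x := by
    ext t
    simp only [Function.comp, hpt, radial_smul]
  rw [h2] at h1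
  have h3 : HasDerivAt (fun t : ℝ => |1 + t| * radial g x) (radial g x) 0 := by
    have h4 : HasDerivAt (fun t : ℝ => (1 + t) * radial g x) (radial g x) 0 := by
      simpa using ((hasDerivAt_id (0 : ℝ)).const_add 1).mul_const (radial g x)
    refine h4.congr_of_eventuallyEq ?_
    filter_upwards [lt_mem_nhds (show (-1 : ℝ) < 0 by norm_num)] with t ht
    rw [abs_of_pos (by linarith)]
  exact h1.unique h3

/-- With the Liouville field `Z`: `λ(X_ρ) = ω(Z, X_ρ) = dρ(Z) = ρ`. -/
theorem liouville_hamVF_radial (g : Metric n Q) {x : Cot n Q} (hx : radial g x ≠ 0) :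
    liouville x (hamVF (radial g) x) = radial g x := by
  rw [← symplectic_radialVector, symplectic_swap, symplectic_hamVF, neg_neg]
  exact dRadial_radialVector g hx

theorem dRadial_hamVF_radial (g : Metric n Q) (x : Cot n Q) :
    dRadial g x (hamVF (radial g) x) = 0 := by
  have h := symplectic_hamVF (radial g) x (hamVF (radial g) x)
  rw [symplectic_self] at h
  change mvfderiv (cotModel n) (radial g) x _ = 0
  linarith

theorem mvfderiv_comp_radial (g : Metric n Q) {x : Cot n Q} (hx : radial g x ≠ 0) {h : ℝ → ℝ}
    (hh : DifferentiableAt ℝ h (radial g x)) (v : TangentSpace (cotModel n) x) :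
    mvfderiv (cotModel n) (fun y => h (radial g y)) x v = deriv h (radial g x) * dRadial g x v := by
  have hd : MDifferentiableAt (cotModel n) 𝓘(ℝ) (radial g) x :=
    (contMDiffAt_radial g hx).mdifferentiableAt (by simp)
  have h1 : HasMFDerivAt 𝓘(ℝ) 𝓘(ℝ) h (radial g x) (ContinuousLinearMap.toSpanSingleton ℝ (deriv h (radial g x))) :=
    hh.hasDerivAt.hasFDerivAt.hasMFDerivAt
  have h2 := (h1.comp x hd.hasMFDerivAt).mfderiv
  have h3 : mvfderiv (cotModel n) (fun y => h (radial g y)) x v =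
    mfderiv (cotModel n) 𝓘(ℝ) (h ∘ radial g) x v := rfl
  rw [h3, h2, mul_comm]
  rfl

theorem hamVF_comp_radial (g : Metric n Q) {x : Cot n Q} (hx : radial g x ≠ 0) {h : ℝ → ℝ}
    (hh : DifferentiableAt ℝ h (radial g x)) :
    hamVF (fun y => h (radial g y)) x = deriv h (radial g x) • hamVF (radial g) x := by
  rw [← sub_eq_zero]
  apply symplectic_nondegenerate
  intro w
  rw [sub_eq_add_neg, symplectic_add_left, ← neg_smul, symplectic_smul_left, symplectic_hamVF,
    symplectic_hamVF, mvfderiv_comp_radial g hx hh]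
  change _ + _ * - dRadial g x w = 0
  ring

end Cotangent

open MeasureTheory

/-! ### Stokes' theorem on rectangles and on the quadrant -/

section Plane

/-- The value of the exterior derivative of the 1-form `b` on `s` on the standard basis. -/
def curl (s : Set (ℝ × ℝ)) (b : ℝ × ℝ → ℝ × ℝ →L[ℝ] ℝ) (y : ℝ × ℝ) : ℝ :=
  fderivWithin ℝ b s y (1, 0) (0, 1) - fderivWithin ℝ b s y (0, 1) (1, 0)

theorem continuousOn_curl {s : Set (ℝ × ℝ)} {b : ℝ × ℝ → ℝ × ℝ →L[ℝ] ℝ} (hs : UniqueDiffOn ℝ s)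
    (hb : ContDiffOn ℝ 1 b s) : ContinuousOn (curl s b) s := by
  have h := hb.continuousOn_fderivWithin hs le_rfl
  unfold curl
  fun_prop

theorem integral_curl_Icc {s : Set (ℝ × ℝ)} {b : ℝ × ℝ → ℝ × ℝ →L[ℝ] ℝ} (hs : UniqueDiffOn ℝ s)
    (hb : ContDiffOn ℝ 1 b s) {p q : ℝ × ℝ} (hpq : p ≤ q) (hsub : Icc p q ⊆ s) :
    ∫ y in Icc p q, curl s b y =
      (∫ x in p.1..q.1, b (x, p.2) (1, 0)) - (∫ x in p.1..q.1, b (x, q.2) (1, 0)) +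
      (∫ t in p.2..q.2, b (q.1, t) (0, 1)) - ∫ t in p.2..q.2, b (p.1, t) (0, 1) := by
  have hbc : ContinuousOn b (Icc p q) := hb.continuousOn.mono hsub
  have hd : ∀ y ∈ Ioo p.1 q.1 ×ˢ Ioo p.2 q.2 \ ∅, HasFDerivAt b (fderivWithin ℝ b s y) y := by
    rintro y ⟨⟨hy1, hy2⟩, -⟩
    have hn : s ∈ 𝓝 y := by
      refine mem_of_superset ((isOpen_Ioo.prod isOpen_Ioo).mem_nhds ⟨hy1, hy2⟩) ?_
      rintro z ⟨h1, h2⟩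
      exact hsub ⟨⟨h1.1.le, h2.1.le⟩, ⟨h1.2.le, h2.2.le⟩⟩
    exact ((hb y (mem_of_mem_nhds hn)).differentiableWithinAt
      (by norm_num)).hasFDerivWithinAt.hasFDerivAt hn
  have hi : IntegrableOn (fun y => curl s b y) (Icc p q) :=
    ((continuousOn_curl hs hb).mono hsub).integrableOn_compact isCompact_Icc
  -- Green's formula is the divergence theorem for the rotated field `(b(0,1), -b(1,0))`, whose
  -- divergence is `curl`.
  have key := integral_divergence_prod_Icc_of_hasFDerivAt_off_countable_of_le
    (fun y => b y (0, 1)) (fun y => - b y (1, 0))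
    (fun y => (ContinuousLinearMap.apply ℝ ℝ ((0, 1) : ℝ × ℝ)).comp (fderivWithin ℝ b s y))
    (fun y => - (ContinuousLinearMap.apply ℝ ℝ ((1, 0) : ℝ × ℝ)).comp (fderivWithin ℝ b s y))
    p q hpq ∅ countable_empty (by fun_prop) (by fun_prop)
    (fun y hy => (ContinuousLinearMap.apply ℝ ℝ ((0, 1) : ℝ × ℝ)).hasFDerivAt.comp y (hd y hy))
    (fun y hy =>
      ((ContinuousLinearMap.apply ℝ ℝ ((1, 0) : ℝ × ℝ)).hasFDerivAt.comp y (hd y hy)).neg)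
    (by simpa [curl, sub_eq_add_neg] using hi)
  have h1 : ∀ y, ((ContinuousLinearMap.apply ℝ ℝ ((0, 1) : ℝ × ℝ)).comp (fderivWithin ℝ b s y)) (1, 0)
    + (- (ContinuousLinearMap.apply ℝ ℝ ((1, 0) : ℝ × ℝ)).comp (fderivWithin ℝ b s y)) (0, 1) =
    curl s b y := fun y => by simp [curl, sub_eq_add_neg]
  simp only [h1] at key
  rw [key]
  simp only [intervalIntegral.integral_neg]
  ring

/-- The quadrant. -/
def quadrant : Set (ℝ × ℝ) := {y | 0 ≤ y.1 ∧ 0 ≤ y.2}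

/-- The half-strip, in real coordinates. -/
def strip : Set (ℝ × ℝ) := {y | y.1 ≤ 0 ∧ 0 ≤ y.2 ∧ y.2 ≤ 1}

theorem quadrant_eq : quadrant = Ici 0 ×ˢ Ici 0 := by 
  ext y; simp only [quadrant, mem_ofPred_eq, mem_prod, mem_Ici]

theorem strip_eq : strip = Iic 0 ×ˢ Icc 0 1 := by ext y; simp [strip]

theorem uniqueDiffOn_quadrant : UniqueDiffOn ℝ quadrant := by
  rw [quadrant_eq]
  exact (uniqueDiffOn_Ici 0).prod (uniqueDiffOn_Ici 0)

theorem uniqueDiffOn_strip : UniqueDiffOn ℝ strip := by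
  rw [strip_eq]
  exact (uniqueDiffOn_Iic 0).prod (uniqueDiffOn_Icc zero_lt_one)

theorem quadrant_subset_closure_interior : quadrant ⊆ closure (interior quadrant) := by
  rw [quadrant_eq, interior_prod_eq, closure_prod_eq, interior_Ici, closure_Ioi]

theorem strip_subset_closure_interior : strip ⊆ closure (interior strip) := by
  rw [strip_eq, interior_prod_eq, closure_prod_eq, interior_Iic, closure_Iio, interior_Icc,
    closure_Ioo zero_ne_one]

theorem isClosed_quadrant : IsClosed quadrant := by
  rw [quadrant_eq]
  exact isClosed_Ici.prod isClosed_Ici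

theorem isClosed_strip : IsClosed strip := by
  rw [strip_eq]
  exact isClosed_Iic.prod isClosed_Icc

/-- Stokes' theorem on the quadrant, for a form which is compactly supported and non-positive on
the oriented boundary. -/
theorem integral_curl_quadrant_nonpos {b : ℝ × ℝ → ℝ × ℝ →L[ℝ] ℝ}
    (hb : ContDiffOn ℝ 1 b quadrant) {K : Set (ℝ × ℝ)} (hK : IsCompact K)
    (hbK : ∀ y, y ∉ K → b y = 0)
    (h1 : ∀ x, 0 < x → b (x, 0) (1, 0) ≤ 0) (h2 : ∀ t, 0 < t → 0 ≤ b (0, t) (0, 1)) :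
    ∫ y in quadrant, curl quadrant b y ≤ 0 := by
  obtain ⟨M, hM⟩ := hK.isBounded.subset_closedBall (0 : ℝ × ℝ)
  -- The square of side `R` contains `K ∩ quadrant`, and its two outer sides miss `K`, so only the
  -- edges on the axes contribute.
  set R : ℝ := max M 0 + 1 with hR
  have hR0 : 0 < R := by positivity
  have hout : ∀ y : ℝ × ℝ, (R ≤ y.1 ∨ R ≤ y.2) → y ∉ K := by
    intro y hy hyK
    have h3 := hM hyK
    rw [mem_closedBall_zero_iff, Prod.norm_def, max_le_iff, Real.norm_eq_abs, Real.norm_eq_abs] at h3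
    have h4 := le_abs_self y.1
    have h5 := le_abs_self y.2
    have h6 := le_max_left M 0
    rcases hy with hy | hy <;> linarith [h3.1, h3.2]
  have hsub : Icc ((0, 0) : ℝ × ℝ) (R, R) ⊆ quadrant := fun y hy => ⟨hy.1.1, hy.1.2⟩
  have hcurl : ∀ y ∈ quadrant \ Icc ((0, 0) : ℝ × ℝ) (R, R), curl quadrant b y = 0 := by
    rintro y ⟨hy, hy2⟩
    have h3 : y ∉ K := by
      apply hout
      by_contra! h
      exact hy2 ⟨⟨hy.1, hy.2⟩, ⟨h.1.le, h.2.le⟩⟩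
    have h4 : b =ᶠ[𝓝[quadrant] y] fun _ => 0 := by
      refine mem_nhdsWithin_of_mem_nhds ?_
      filter_upwards [hK.isClosed.isOpen_compl.mem_nhds h3] with z hz using hbK z hz
    unfold curl
    rw [h4.fderivWithin_eq (hbK y h3)]
    simp
  rw [setIntegral_eq_of_subset_of_forall_sdiff_eq_zero isClosed_quadrant.measurableSet hsub hcurl,
    integral_curl_Icc uniqueDiffOn_quadrant hb (p := (0, 0)) (q := (R, R)) ⟨hR0.le, hR0.le⟩ hsub]
  have e1 : ∫ x in (0 : ℝ)..R, b (x, R) (1, 0) = 0 := by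
    rw [intervalIntegral.integral_congr (g := fun _ => (0 : ℝ))]
    · simp
    · intro x _
      simp [hbK (x, R) (hout _ (Or.inr le_rfl))]
  have e2 : ∫ x in (0 : ℝ)..R, b (R, x) (0, 1) = 0 := by
    rw [intervalIntegral.integral_congr (g := fun _ => (0 : ℝ))]
    · simp
    · intro x _
      simp [hbK (R, x) (hout _ (Or.inl le_rfl))]
  have e3 : ∫ x in (0 : ℝ)..R, b (x, 0) (1, 0) ≤ 0 := by
    rw [intervalIntegral.integral_of_le hR0.le]
    exact setIntegral_nonpos measurableSet_Ioc fun x hx => h1 x hx.1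
  have e4 : 0 ≤ ∫ x in (0 : ℝ)..R, b (0, x) (0, 1) := by
    rw [intervalIntegral.integral_of_le hR0.le]
    exact setIntegral_nonneg measurableSet_Ioc fun x hx => h2 x hx.1
  simp only [e1, e2]
  linarith

end Plane

/-! ### Small slices and the boundary term on a half-strip -/

section StripEstimate

/-- `G` is the energy density, `ψ` the Lipschitz bound on the length of `λ`, and `l` the value of
`λ` on `η(∂ₜ)`. A function whose `s`-derivative is square integrable grows at most like `√R`, so the
slice integral of `ψ²` is `O(1 + R)`. Integrability of `G` makes `(1 + R) ∫ G(-R, t) dt` small for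
suitable large `R`. Since `|l| ≤ |ψ| √G`, the two factors balance. -/
theorem exists_small_slice {G ψ l : ℝ × ℝ → ℝ} {C : ℝ} {ψ' : ℝ × ℝ → ℝ}
    (hG : ContinuousOn G strip) (hψ : ContinuousOn ψ strip) (hl : ContinuousOn l strip)
    (hG0 : ∀ y ∈ strip, 0 ≤ G y)
    (hfin : ∫⁻ y in interior strip, ENNReal.ofReal (G y) < ⊤)
    (hd : ∀ y ∈ strip, y.1 < 0 → HasDerivAt (fun s => ψ (s, y.2)) (ψ' y) y.1)
    (hψ' : ∀ y ∈ strip, y.1 < 0 → ψ' y ^ 2 ≤ C * G y)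
    (hlψ : ∀ y ∈ strip, l y ^ 2 ≤ ψ y ^ 2 * G y) {c : ℝ} (hc : 0 < c) (R₀ : ℝ) :
    ∃ R, R₀ ≤ R ∧ 0 ≤ R ∧ ∫ t in (0 : ℝ)..1, |l (-R, t)| < c := by
  wlog hC : 0 ≤ C generalizing C
  · refine this (C := 0) (fun y hy hy0 => (hψ' y hy hy0).trans ?_) le_rfl
    nlinarith [hG0 y hy, not_le.1 hC]
  have hint : IntegrableOn G (interior strip) := by
    refine ⟨(hG.mono interior_subset).aestronglyMeasurable isOpen_interior.measurableSet, ?_⟩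
    rw [hasFiniteIntegral_iff_ofReal]
    · exact hfin
    · filter_upwards [ae_restrict_mem isOpen_interior.measurableSet] with y hy
      exact hG0 y (interior_subset hy)
  set I : ℝ := ∫ y in interior strip, G y with hI
  have hstrip_mem : ∀ {s t : ℝ}, s ≤ 0 → t ∈ Icc (0 : ℝ) 1 → (s, t) ∈ strip :=
    fun hs ht => ⟨hs, ht.1, ht.2⟩
  have hrectint : ∀ a : ℝ, IntegrableOn G (Icc a 0 ×ˢ Icc (0 : ℝ) 1) := by
    intro a
    refine (hG.mono ?_).integrableOn_compact (isCompact_Icc.prod isCompact_Icc)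
    rintro ⟨s, t⟩ ⟨hs, ht⟩
    exact hstrip_mem hs.2 ht
  have hrect : ∀ a b : ℝ, a ≤ b → b ≤ 0 → ∫ y in Icc a b ×ˢ Icc (0 : ℝ) 1, G y ≤ I := by
    intro a b hab hb
    have h1 : (Icc a b ×ˢ Icc (0 : ℝ) 1 : Set (ℝ × ℝ)) =ᵐ[volume] (Ioo a b ×ˢ Ioo (0 : ℝ) 1 : Set (ℝ × ℝ)) :=
      (Measure.set_prod_ae_eq Ioo_ae_eq_Icc Ioo_ae_eq_Icc).symm
    rw [setIntegral_congr_set h1]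
    refine setIntegral_mono_set hint ?_ (LE.le.eventuallyLE ?_)
    · filter_upwards [ae_restrict_mem isOpen_interior.measurableSet] with y hy
      exact hG0 y (interior_subset hy)
    · rw [strip_eq, interior_prod_eq, interior_Iic, interior_Icc]
      exact prod_mono (fun x hx => hx.2.trans_le hb) Subset.rfl
  -- bound on `ψ`
  have hψbound : ∀ R : ℝ, 0 ≤ R → ∀ t ∈ Icc (0 : ℝ) 1,
      ψ (-R, t) ^ 2 / (1 + R) ≤ ψ (0, t) ^ 2 + C * ∫ s in (-R)..0, G (s, t) := by
    intro R hR t ht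
    have hGt : ContinuousOn (fun s => G (s, t)) (Iic 0) :=
      hG.comp (by fun_prop) (fun s hs => hstrip_mem hs ht)
    have hψt : ContinuousOn (fun s => ψ (s, t)) (Iic 0) :=
      hψ.comp (by fun_prop) (fun s hs => hstrip_mem hs ht)
    -- The weight `1 - s` absorbs the growth of `ψ²`. Comparing the end points `-R` and `0` gives
    -- the bound.
    have hmono : MonotoneOn (fun s => ψ (s, t) ^ 2 / (1 - s) + C * ∫ r in (-R)..s, G (r, t))
        (Icc (-R) 0) := by
      have hGi : IntervalIntegrable (fun s => G (s, t)) volume (-R) 0 :=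
        (hGt.mono (fun x hx => hx.2)).intervalIntegrable_of_Icc (by linarith)
      refine monotoneOn_of_deriv_nonneg (convex_Icc _ _) ?_ ?_ ?_
      · refine ContinuousOn.add ?_ (continuousOn_const.mul ?_)
        · refine ContinuousOn.div ((hψt.mono fun x hx => hx.2).pow 2) (by fun_prop) ?_
          intro s hs; have := hs.2; linarith
        · have := intervalIntegral.continuousOn_primitive_interval' hGi left_mem_uIcc
          rwa [uIcc_of_le (by linarith)] at this
      all_goals
        intro s hs
        rw [interior_Icc] at hs
        have hs0 : (s, t) ∈ strip := hstrip_mem hs.2.le ht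
        have h1 : HasDerivAt (fun s => ψ (s, t)) (ψ' (s, t)) s := hd (s, t) hs0 hs.2
        have h2 : HasDerivAt (fun s => ∫ r in (-R)..s, G (r, t)) (G (s, t)) s := by
          refine intervalIntegral.integral_hasDerivAt_right
            (hGi.mono_set ?_) ?_ ?_
          · rw [uIcc_of_le hs.1.le, uIcc_of_le (by linarith)]
            exact Icc_subset_Icc le_rfl hs.2.le
          · exact (hGt.mono Iio_subset_Iic_self).stronglyMeasurableAtFilter isOpen_Iio s hs.2
          · exact hGt.continuousAt (Iic_mem_nhds hs.2)
        have hne : (1 - s) ≠ 0 := by have := hs.2; linarith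
        have h3 := ((h1.pow 2).div ((hasDerivAt_id s).const_sub 1) hne).add (h2.const_mul C)
      · exact (h3.differentiableAt).differentiableWithinAt
      · have h4 := h3.deriv
        have h5 : (fun s => ψ (s, t) ^ 2 / (1 - s) + C * ∫ r in (-R)..s, G (r, t)) =
          ((fun s => ψ (s, t)) ^ 2 / fun x => 1 - id x) + fun y => C * ∫ r in (-R)..y, G (r, t) := by
          ext; simp
        rw [h5, h4]
        have h6 := hψ' (s, t) hs0 hs.2
        have hpos : 0 < 1 - s := by have := hs.2; linarith
        -- Completing the square: `(a + b d)² ≥ 0`. With `d = 1 - s` the derivative of `ψ² / (1 -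
        -- s)` is at least `-ψ'²`, which `C G` compensates.
        have h7 : ∀ a b d : ℝ, 0 < d → - b ^ 2 ≤ (2 * a * b * d + a ^ 2) / d ^ 2 := by
          intro a b d hd
          rw [le_div_iff₀ (by positivity)]
          nlinarith [sq_nonneg (a + b * d)]
        have h8 := h7 (ψ (s, t)) (ψ' (s, t)) (1 - s) hpos
        simp only [Pi.pow_apply, id] at *
        have h9 : (((2 : ℕ) : ℝ) * ψ (s, t) ^ (2 - 1) * ψ' (s, t) * (1 - s) - ψ (s, t) ^ 2 * -1) / (1 - s) ^ 2
          = (2 * ψ (s, t) * ψ' (s, t) * (1 - s) + ψ (s, t) ^ 2) / (1 - s) ^ 2 := by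
          norm_num
        rw [h9]
        linarith
    have h1 := hmono ⟨le_rfl, by linarith⟩ ⟨by linarith, le_rfl⟩ (by linarith : -R ≤ 0)
    simp only [intervalIntegral.integral_same, mul_zero, add_zero, sub_zero, div_one, sub_neg_eq_add] at h1
    exact h1
  set K : ℝ := ∫ t in (0 : ℝ)..1, ψ (0, t) ^ 2 with hK
  have hslice : ∀ {F : ℝ × ℝ → ℝ}, ContinuousOn F strip → ∀ {s : ℝ}, s ≤ 0 →
      ContinuousOn (fun t => F (s, t)) (Icc 0 1) := fun hF s hs =>
    hF.comp (by fun_prop) (fun t ht => hstrip_mem hs ht)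
  have hsliceI : ∀ {F : ℝ × ℝ → ℝ}, ContinuousOn F strip → ∀ {s : ℝ}, s ≤ 0 →
      IntervalIntegrable (fun t => F (s, t)) volume 0 1 := fun hF s hs =>
    (hslice hF hs).intervalIntegrable_of_Icc zero_le_one
  have hψint : ∀ R : ℝ, 0 ≤ R → ∫ t in (0 : ℝ)..1, ψ (-R, t) ^ 2 / (1 + R) ≤ K + C * I := by
    intro R hR
    have hGR := hrectint (-R)
    have hswap : ∫ y in Icc (-R) 0 ×ˢ Icc (0 : ℝ) 1, G y =
        ∫ t in (0 : ℝ)..1, ∫ s in (-R)..0, G (s, t) := by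
      rw [intervalIntegral.integral_of_le zero_le_one, ← integral_Icc_eq_integral_Ioc]
      simp_rw [intervalIntegral.integral_of_le (neg_nonpos.2 hR), ← integral_Icc_eq_integral_Ioc]
      have h1 : Integrable G ((volume.restrict (Icc (-R) 0)).prod (volume.restrict (Icc (0 : ℝ) 1))) := by
        rw [Measure.prod_restrict]
        exact hGR
      rw [← integral_prod_symm _ h1, Measure.prod_restrict]
      rfl
    have hii : IntervalIntegrable (fun t => ∫ s in (-R)..0, G (s, t)) volume 0 1 := by
      rw [intervalIntegrable_iff_integrableOn_Icc_of_le zero_le_one]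
      simp_rw [intervalIntegral.integral_of_le (neg_nonpos.2 hR), ← integral_Icc_eq_integral_Ioc]
      have h1 : Integrable G ((volume.restrict (Icc (-R) 0)).prod (volume.restrict (Icc (0 : ℝ) 1))) := by
        rw [Measure.prod_restrict]
        exact hGR
      exact h1.integral_prod_right
    have hψ0 : IntervalIntegrable (fun t => ψ (0, t) ^ 2) volume 0 1 := hsliceI (hψ.pow 2) le_rfl
    calc ∫ t in (0 : ℝ)..1, ψ (-R, t) ^ 2 / (1 + R)
        ≤ ∫ t in (0 : ℝ)..1, (ψ (0, t) ^ 2 + C * ∫ s in (-R)..0, G (s, t)) := by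
          refine intervalIntegral.integral_mono_on zero_le_one ?_ (hψ0.add (hii.const_mul C))
            fun t ht => hψbound R hR t ht
          exact (hsliceI (hψ.pow 2) (neg_nonpos.2 hR)).div_const _
      _ = K + C * ∫ y in Icc (-R) 0 ×ˢ Icc (0 : ℝ) 1, G y := by
          rw [intervalIntegral.integral_add hψ0 (hii.const_mul C), intervalIntegral.integral_const_mul,
            hswap]
      _ ≤ K + C * I := by
          gcongr
          exact hrect (-R) 0 (by linarith) le_rfl
  -- slices of `G`
  have hGslice : ∀ c' : ℝ, 0 < c' → ∃ R, R₀ ≤ R ∧ 0 ≤ R ∧ (1 + R) * ∫ t in (0 : ℝ)..1, G (-R, t) < c' := by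
    intro c' hc'
    by_contra! hcon
    set R₁ := max R₀ 0 with hR₁
    have hR₁0 : 0 ≤ R₁ := le_max_right _ _
    -- If every slice beyond `R₁` had integral at least `c' / (1 - s)`, the integral of `G` would
    -- dominate a logarithm and be infinite.
    have hlog : ∀ R, R₁ ≤ R → c' * (Real.log (1 + R) - Real.log (1 + R₁)) ≤ I := by
      intro R hR
      have hsub : IntegrableOn G (Icc (-R) (-R₁) ×ˢ Icc (0 : ℝ) 1) :=
        (hrectint (-R)).mono_set (prod_mono (Icc_subset_Icc le_rfl (by linarith)) Subset.rfl)
      have h1 : Integrable G ((volume.restrict (Icc (-R) (-R₁))).prod (volume.restrict (Icc (0 : ℝ) 1))) := by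
        rw [Measure.prod_restrict]
        exact hsub
      have h2 := h1.integral_prod_left
      have h3 : ∫ y in Icc (-R) (-R₁) ×ˢ Icc (0 : ℝ) 1, G y =
          ∫ s in (-R)..(-R₁), ∫ t in (0 : ℝ)..1, G (s, t) := by
        rw [intervalIntegral.integral_of_le (by linarith : -R ≤ -R₁), ← integral_Icc_eq_integral_Ioc]
        simp_rw [intervalIntegral.integral_of_le (zero_le_one (α := ℝ)), ← integral_Icc_eq_integral_Ioc]
        exact setIntegral_prod _ hsub
      have h4 : ∫ s in (-R)..(-R₁), c' * (1 - s)⁻¹ = c' * (Real.log (1 + R) - Real.log (1 + R₁)) := by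
        rw [intervalIntegral.integral_const_mul]
        congr 1
        have := intervalIntegral.integral_comp_sub_left (fun x : ℝ => x⁻¹) (a := -R) (b := -R₁) 1
        rw [this, integral_inv_of_pos (by linarith) (by linarith), Real.log_div (by linarith) (by linarith)]
        ring_nf
      rw [← h4]
      refine le_trans ?_ (hrect (-R) (-R₁) (by linarith) (by linarith))
      rw [h3]
      refine intervalIntegral.integral_mono_on (by linarith) ?_ ?_ ?_
      · refine ContinuousOn.intervalIntegrable_of_Icc (by linarith) ?_
        refine continuousOn_const.mul (ContinuousOn.inv₀ (by fun_prop) ?_)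
        intro s hs; have := hs.2; linarith
      · rw [intervalIntegrable_iff_integrableOn_Icc_of_le (by linarith)]
        simp_rw [intervalIntegral.integral_of_le (zero_le_one (α := ℝ)), ← integral_Icc_eq_integral_Ioc]
        exact h2
      · intro s hs
        have h5 := hcon (-s) ((le_max_left R₀ 0).trans (by linarith [hs.2])) (by linarith [hs.2])
        rw [neg_neg] at h5
        have h6 : 0 < 1 - s := by linarith [hs.2]
        rw [← div_eq_mul_inv, div_le_iff₀ h6]
        linarith
    have h7 : Tendsto (fun R : ℝ => c' * (Real.log (1 + R) - Real.log (1 + R₁))) atTop atTop := by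
      refine Tendsto.const_mul_atTop hc' (tendsto_atTop_add_const_right _ _ ?_)
      exact Real.tendsto_log_atTop.comp (tendsto_atTop_add_const_left _ _ tendsto_id)
    obtain ⟨R, hR1, hR2⟩ := ((h7.eventually_gt_atTop I).and (eventually_ge_atTop R₁)).exists
    exact absurd (hlog R hR2) (not_le.2 hR1)
  have hKI : 0 ≤ K + C * I := by
    have h1 : 0 ≤ K := intervalIntegral.integral_nonneg zero_le_one fun t _ => sq_nonneg _
    have h2 : 0 ≤ I := setIntegral_nonneg isOpen_interior.measurableSet fun y hy => hG0 y (interior_subset hy)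
    positivity
  -- The weight in the inequality between arithmetic and geometric means: with `(1 + R) ∫ G < δ c`,
  -- both halves of the bound contribute at most `c / 2`. The `+ 1` keeps the denominator positive.
  set δ : ℝ := c / (K + C * I + 1) with hδ
  have hδ0 : 0 < δ := by positivity
  obtain ⟨R, hR0, hR, hRG⟩ := hGslice (δ * c) (by positivity)
  refine ⟨R, hR0, hR, ?_⟩
  have hnR : -R ≤ 0 := by linarith
  have h1R : 0 < 1 + R := by linarith
  have hpt : ∀ t ∈ Icc (0 : ℝ) 1, |l (-R, t)| ≤
      δ / 2 * (ψ (-R, t) ^ 2 / (1 + R)) + (1 + R) / (2 * δ) * G (-R, t) := by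
    intro t ht
    have hm := hstrip_mem hnR ht
    have hg := hG0 _ hm
    apply abs_le_of_sq_le_sq _ (by positivity)
    refine (hlψ _ hm).trans ?_
    have h4 : ψ (-R, t) ^ 2 * G (-R, t) = 4 * (δ / 2 * (ψ (-R, t) ^ 2 / (1 + R))) *
        ((1 + R) / (2 * δ) * G (-R, t)) := by
      field_simp
      ring
    rw [h4]
    nlinarith [sq_nonneg (δ / 2 * (ψ (-R, t) ^ 2 / (1 + R)) - (1 + R) / (2 * δ) * G (-R, t))]
  have i1 : IntervalIntegrable (fun t => ψ (-R, t) ^ 2 / (1 + R)) volume 0 1 :=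
    (hsliceI (hψ.pow 2) hnR).div_const _
  have i2 : IntervalIntegrable (fun t => G (-R, t)) volume 0 1 := hsliceI hG hnR
  calc ∫ t in (0 : ℝ)..1, |l (-R, t)|
      ≤ ∫ t in (0 : ℝ)..1, (δ / 2 * (ψ (-R, t) ^ 2 / (1 + R)) + (1 + R) / (2 * δ) * G (-R, t)) :=
        intervalIntegral.integral_mono_on zero_le_one (hsliceI hl.abs hnR)
          ((i1.const_mul _).add (i2.const_mul _)) hpt
    _ = δ / 2 * (∫ t in (0 : ℝ)..1, ψ (-R, t) ^ 2 / (1 + R)) +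
        (1 / (2 * δ)) * ((1 + R) * ∫ t in (0 : ℝ)..1, G (-R, t)) := by
        rw [intervalIntegral.integral_add (i1.const_mul _) (i2.const_mul _),
          intervalIntegral.integral_const_mul, intervalIntegral.integral_const_mul]
        ring
    _ < δ / 2 * (K + C * I + 1) + (1 / (2 * δ)) * (δ * c) := by
        gcongr
        linarith [hψint R hR]
    _ = c := by
        rw [hδ]
        field_simp
        ring

theorem curl_smul {s : Set (ℝ × ℝ)} {b : ℝ × ℝ → ℝ × ℝ →L[ℝ] ℝ} {k : ℝ × ℝ → ℝ}
    {y : ℝ × ℝ} (hs : UniqueDiffWithinAt ℝ s y) (hb : DifferentiableWithinAt ℝ b s y)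
    (hk : DifferentiableWithinAt ℝ k s y) :
    curl s (fun y => k y • b y) y = k y * curl s b y +
      (fderivWithin ℝ k s y (1, 0) * b y (0, 1) - fderivWithin ℝ k s y (0, 1) * b y (1, 0)) := by
  unfold curl
  rw [fderivWithin_fun_smul hs hk hb]
  simp
  ring

/-- A cutoff function of a form with non-negative exterior derivative on the half-strip which
vanishes on the sides, and whose `dt`-component has slices with arbitrarily small negative part. -/
theorem integral_strip_nonpos {b : ℝ × ℝ → ℝ × ℝ →L[ℝ] ℝ} {k l : ℝ × ℝ → ℝ}
    (hb : ContDiffOn ℝ 1 b strip) (hk : ContDiffOn ℝ 1 k strip) {R₁ : ℝ}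
    (hk1 : ∀ y ∈ strip, y.1 ≤ -R₁ → k y = 1) (hk0 : ∀ y ∈ strip, y.1 = 0 → k y = 0)
    (hkn : ∀ y ∈ strip, 0 ≤ k y) (hcurl : ∀ y ∈ strip, 0 ≤ curl strip b y)
    (hside : ∀ s < 0, b (s, 0) (1, 0) = 0 ∧ b (s, 1) (1, 0) = 0)
    (hlc : ContinuousOn l strip) (hl : ∀ y ∈ strip, -|l y| ≤ b y (0, 1))
    (hsmall : ∀ c : ℝ, 0 < c → ∀ R₀, ∃ R, R₀ ≤ R ∧ 0 ≤ R ∧ ∫ t in (0 : ℝ)..1, |l (-R, t)| < c) :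
    ∫ y in strip, (fderivWithin ℝ k strip y (1, 0) * b y (0, 1) -
      fderivWithin ℝ k strip y (0, 1) * b y (1, 0)) ≤ 0 := by
  refine le_of_forall_pos_le_add fun c hc => ?_
  obtain ⟨R, hR1, hR, hRc⟩ := hsmall c hc (R₁ + 1)
  have hsub : Icc ((-R, 0) : ℝ × ℝ) (0, 1) ⊆ strip := fun y hy => ⟨hy.2.1, hy.1.2, hy.2.2⟩
  have hzero : ∀ y ∈ strip \ Icc ((-R, 0) : ℝ × ℝ) (0, 1), fderivWithin ℝ k strip y (1, 0) * b y (0, 1) -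
      fderivWithin ℝ k strip y (0, 1) * b y (1, 0) = 0 := by
    rintro y ⟨hy, hy2⟩
    have h1 : y.1 < -R₁ := by
      by_contra! h
      exact hy2 ⟨⟨by linarith, hy.2.1⟩, ⟨hy.1, hy.2.2⟩⟩
    have h2 : k =ᶠ[𝓝[strip] y] fun _ => 1 := by
      have h3 : {z : ℝ × ℝ | z.1 < -R₁} ∈ 𝓝 y :=
        (isOpen_lt continuous_fst continuous_const).mem_nhds h1
      filter_upwards [mem_nhdsWithin_of_mem_nhds h3, self_mem_nhdsWithin] with z hz hz2
      exact hk1 z hz2 (le_of_lt hz)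
    rw [h2.fderivWithin_eq (hk1 y hy h1.le)]
    simp
  have hkb : ContDiffOn ℝ 1 (fun y => k y • b y) strip := hk.smul hb
  have hint : ∀ {F : ℝ × ℝ → ℝ}, ContinuousOn F strip → IntegrableOn F (Icc ((-R, 0) : ℝ × ℝ) (0, 1)) :=
    fun hF => (hF.mono hsub).integrableOn_compact isCompact_Icc
  have hdk := hk.continuousOn_fderivWithin uniqueDiffOn_strip le_rfl
  have hbc := hb.continuousOn
  rw [setIntegral_eq_of_subset_of_forall_sdiff_eq_zero isClosed_strip.measurableSet hsub hzero]
  -- By the Leibniz rule `dk ∧ b = d(k b) - k db`, and the last term is discarded because `k ≥ 0`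
  -- and `db ≥ 0`. Green's formula for `k b` then leaves only the edge `s = -R`, where `k = 1`.
  have hle : ∫ y in Icc ((-R, 0) : ℝ × ℝ) (0, 1), (fderivWithin ℝ k strip y (1, 0) * b y (0, 1) -
      fderivWithin ℝ k strip y (0, 1) * b y (1, 0)) ≤
      ∫ y in Icc ((-R, 0) : ℝ × ℝ) (0, 1), curl strip (fun y => k y • b y) y := by
    refine setIntegral_mono_on (hint (by fun_prop)) (hint (continuousOn_curl uniqueDiffOn_strip hkb))
      measurableSet_Icc fun y hy => ?_
    have hy' := hsub hy
    rw [curl_smul (uniqueDiffOn_strip y hy') ((hb y hy').differentiableWithinAt (by norm_num))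
      ((hk y hy').differentiableWithinAt (by norm_num))]
    have := mul_nonneg (hkn y hy') (hcurl y hy')
    linarith
  refine hle.trans ?_
  rw [integral_curl_Icc uniqueDiffOn_strip hkb (p := (-R, 0)) (q := (0, 1)) ⟨by simpa using hR, zero_le_one⟩ hsub]
  have hedge : ∀ t : ℝ, t = 0 ∨ t = 1 → ∫ x in (-R)..0, (k (x, t) • b (x, t)) (1, 0) = 0 := by
    intro t ht
    rw [intervalIntegral.integral_congr (g := fun _ => (0 : ℝ))]
    · simp
    · intro x hx
      rw [uIcc_of_le (by linarith)] at hx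
      have ht' : (x, t) ∈ strip := by
        rcases ht with rfl | rfl
        · exact ⟨hx.2, le_rfl, zero_le_one⟩
        · exact ⟨hx.2, zero_le_one, le_rfl⟩
      rcases eq_or_lt_of_le hx.2 with h0 | h0
      · simp [hk0 (x, t) ht' h0]
      · rcases ht with rfl | rfl
        · simp [(hside x h0).1]
        · simp [(hside x h0).2]
  have hright : ∫ t in (0 : ℝ)..1, (k (0, t) • b (0, t)) (0, 1) = 0 := by
    rw [intervalIntegral.integral_congr (g := fun _ => (0 : ℝ))]
    · simp
    · intro t ht
      rw [uIcc_of_le zero_le_one] at ht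
      simp [hk0 (0, t) ⟨le_rfl, ht.1, ht.2⟩ rfl]
  have hleft : -c ≤ ∫ t in (0 : ℝ)..1, (k (-R, t) • b (-R, t)) (0, 1) := by
    have hsl : MapsTo (fun t : ℝ => (-R, t)) (Icc 0 1) strip := fun t ht => ⟨by simpa using hR, ht.1, ht.2⟩
    have h1 : ∫ t in (0 : ℝ)..1, -|l (-R, t)| ≤ ∫ t in (0 : ℝ)..1, (k (-R, t) • b (-R, t)) (0, 1) := by
      refine intervalIntegral.integral_mono_on zero_le_one ?_ ?_ ?_
      · exact ((hlc.abs.neg).comp (by fun_prop) hsl).intervalIntegrable_of_Icc zero_le_one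
      · have h2 : ContinuousOn (fun y => (k y • b y) (0, 1)) strip := by
          have := hkb.continuousOn
          fun_prop
        exact (h2.comp (by fun_prop) hsl).intervalIntegrable_of_Icc zero_le_one
      · intro t ht
        rw [hk1 _ (hsl ht) (by simpa using by linarith), one_smul]
        exact hl _ (hsl ht)
    rw [intervalIntegral.integral_neg] at h1
    linarith
  simp only [hedge 0 (Or.inl rfl), hedge 1 (Or.inr rfl), hright]
  linarith

end StripEstimate

/-! ### Two-forms on an oriented surface as multiples of an area form -/

section TwoForms

/-- The determinant of two vectors in the plane. -/
def planeDet (v w : EuclideanSpace ℝ (Fin 2)) : ℝ := v 0 * w 1 - v 1 * w 0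

theorem planeDet_single : planeDet (EuclideanSpace.single 0 1) (EuclideanSpace.single 1 1) = 1 := by
  simp [planeDet]

theorem planeDet_comb (v w : EuclideanSpace ℝ (Fin 2)) (a b c d : ℝ) :
    planeDet (a • v + b • w) (c • v + d • w) = (a * d - b * c) * planeDet v w := by
  simp [planeDet]
  ring

theorem eq_comb (v : EuclideanSpace ℝ (Fin 2)) :
    v = v 0 • EuclideanSpace.single 0 1 + v 1 • EuclideanSpace.single 1 1 := by
  ext i
  fin_cases i <;> simp

variable {S : Type*} [TopologicalSpace S] [ChartedSpace (EuclideanQuadrant 2) S]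
  (j : ∀ z : S, TangentSpace surfModel z →L[ℝ] TangentSpace surfModel z)

/-- A tangent vector, as an element of the model space. -/
def tvec {z : S} (v : TangentSpace surfModel z) : EuclideanSpace ℝ (Fin 2) := v

/-- The first vector of the preferred basis of a tangent space. -/
def frame₀ (z : S) : TangentSpace surfModel z :=
  show EuclideanSpace ℝ (Fin 2) from EuclideanSpace.single 0 1

/-- The second vector of the preferred basis of a tangent space. -/
def frame₁ (z : S) : TangentSpace surfModel z :=
  show EuclideanSpace ℝ (Fin 2) from EuclideanSpace.single 1 1

/-- A component of `j` in the preferred basis, whose sign is the orientation of that basis. -/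
def twist (z : S) : ℝ := (show EuclideanSpace ℝ (Fin 2) from j z (frame₀ z)) 1

/-- An area form which is positive on the bases `(v, j v)`. -/
def vol (z : S) (v w : TangentSpace surfModel z) : ℝ := planeDet v w * twist j z

theorem vol_comb (z : S) (v w : TangentSpace surfModel z) (a b c d : ℝ) :
    vol j z (a • v + b • w) (c • v + d • w) = (a * d - b * c) * vol j z v w := by
  unfold vol
  rw [← mul_assoc]
  exact congrArg (· * twist j z) (planeDet_comb v w a b c d)

theorem vol_map (z : S) (A : ℝ × ℝ →L[ℝ] TangentSpace surfModel z) (x y : ℝ × ℝ) :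
    vol j z (A x) (A y) = (x.1 * y.2 - x.2 * y.1) * vol j z (A (1, 0)) (A (0, 1)) := by
  rw [← vol_comb, ← map_smul, ← map_smul, ← map_smul, ← map_smul, ← map_add, ← map_add]
  simp

variable {j}

/-- If the component vanished, the first basis vector would be a real eigenvector of `j`, with
eigenvalue of square `-1`. -/
theorem twist_ne_zero {z : S} (hj : ∀ v, j z (j z v) = -v) : twist j z ≠ 0 := by
  intro h
  set a : ℝ := tvec (j z (frame₀ z)) 0
  have h1 : j z (frame₀ z) = a • frame₀ z := by
    refine (eq_comb (tvec (j z (frame₀ z)))).trans ?_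
    rw [show tvec (j z (frame₀ z)) 1 = 0 from h, zero_smul, add_zero]
    rfl
  have h3 := hj (frame₀ z)
  rw [h1, map_smul, h1, smul_smul] at h3
  have h4 : a * a = -1 := by
    have h5 : (a * a) • (EuclideanSpace.single 0 1 : EuclideanSpace ℝ (Fin 2)) =
      - EuclideanSpace.single 0 1 := h3
    have h6 := congrArg (fun v : EuclideanSpace ℝ (Fin 2) => v 0) h5
    simpa using h6
  nlinarith [mul_self_nonneg a]

theorem vol_pos {z : S} (hj : ∀ v, j z (j z v) = -v) {v : TangentSpace surfModel z} (hv : v ≠ 0) :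
    0 < vol j z v (j z v) := by
  let v' : EuclideanSpace ℝ (Fin 2) := v
  let je : EuclideanSpace ℝ (Fin 2) := j z (frame₀ z)
  let jf : EuclideanSpace ℝ (Fin 2) := j z (frame₁ z)
  have h1 : (j z v : EuclideanSpace ℝ (Fin 2)) = v' 0 • je + v' 1 • jf := by
    have : v = v' 0 • frame₀ z + v' 1 • frame₁ z := eq_comb v
    conv_lhs => rw [this]
    rw [map_add, map_smul, map_smul]
    rfl
  have hsq : (j z (j z (frame₀ z)) : EuclideanSpace ℝ (Fin 2)) = je 0 • je + je 1 • jf := by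
    have : j z (frame₀ z) = je 0 • frame₀ z + je 1 • frame₁ z := eq_comb (j z (frame₀ z))
    conv_lhs => rw [this]
    rw [map_add, map_smul, map_smul]
    rfl
  have hsq2 : (- EuclideanSpace.single 0 1 : EuclideanSpace ℝ (Fin 2)) = je 0 • je + je 1 • jf :=
    (hj (frame₀ z)).symm.trans hsq
  have c0 := congrArg (fun v : EuclideanSpace ℝ (Fin 2) => v 0) hsq2
  have c1 := congrArg (fun v : EuclideanSpace ℝ (Fin 2) => v 1) hsq2
  simp at c0 c1
  have hr : je 1 ≠ 0 := twist_ne_zero hj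
  have hjf1 : jf 1 = - je 0 := by
    have : je 1 * (jf 1 + je 0) = 0 := by linarith
    rcases mul_eq_zero.1 this with h | h
    · exact absurd h hr
    · linarith
  change 0 < planeDet v' (show EuclideanSpace ℝ (Fin 2) from j z v) * je 1
  rw [show (show EuclideanSpace ℝ (Fin 2) from j z v) = v' 0 • je + v' 1 • jf from h1]
  -- The quadratic form `v ↦ det(v, jv)`, multiplied by `twist`, is a sum of two squares by `j² =
  -- -1` (`c0` and the trace relation `hjf1`).
  have key : planeDet v' (v' 0 • je + v' 1 • jf) * je 1 =
      (v' 0 * je 1 - v' 1 * je 0) ^ 2 + (v' 1) ^ 2 := by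
    simp only [planeDet, PiLp.add_apply, PiLp.smul_apply, smul_eq_mul]
    rw [hjf1]
    linear_combination ((v' 1) ^ 2) * c0
  rw [key]
  by_cases h0 : v' 1 = 0
  · have h2 : v' 0 ≠ 0 := by
      intro h2
      apply hv
      have h3 : v' = 0 := by
        rw [eq_comb v', h2, h0]
        simp
      exact h3
    rw [h0]
    have := mul_ne_zero h2 hr
    have h4 : 0 < (v' 0 * je 1) ^ 2 := by positivity
    simpa using h4
  · positivity

/-- Alternating bilinear forms on a tangent space. -/
structure IsTwoForm (z : S) (θ : TangentSpace surfModel z → TangentSpace surfModel z → ℝ) : Prop where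
  add : ∀ v v' w, θ (v + v') w = θ v w + θ v' w
  smul : ∀ (c : ℝ) v w, θ (c • v) w = c * θ v w
  alt : ∀ v w, θ v w = - θ w v

/-- The quotient of a 2-form by the area form `vol`. -/
def coeff (j : ∀ z : S, TangentSpace surfModel z →L[ℝ] TangentSpace surfModel z)
    (θ : ∀ z : S, TangentSpace surfModel z → TangentSpace surfModel z → ℝ) (z : S) : ℝ :=
  θ z (frame₀ z) (frame₁ z) / twist j z

/-- The frame comes from the preferred chart at `z`, so `coeff` and `vol` separately need not depend
continuously on `z`. Only their product is intrinsic, and it recovers the form. -/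
theorem coeff_mul_vol {z : S} (hj : ∀ v, j z (j z v) = -v)
    {θ : ∀ z : S, TangentSpace surfModel z → TangentSpace surfModel z → ℝ} (h : IsTwoForm z (θ z))
    (v w : TangentSpace surfModel z) : coeff j θ z * vol j z v w = θ z v w := by
  have hr := twist_ne_zero hj
  have h0 : ∀ v, θ z v v = 0 := fun v => by have := h.alt v v; linarith
  have hadd : ∀ v w w', θ z v (w + w') = θ z v w + θ z v w' := fun v w w' => by
    rw [h.alt, h.add, h.alt w, h.alt w']; ring
  have hsmul : ∀ (c : ℝ) v w, θ z v (c • w) = c * θ z v w := fun c v w => by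
    rw [h.alt, h.smul, h.alt w]; ring
  have hv : v = tvec v 0 • frame₀ z + tvec v 1 • frame₁ z :=
    eq_comb v
  have hw : w = tvec w 0 • frame₀ z + tvec w 1 • frame₁ z :=
    eq_comb w
  have h1 : θ z v w = planeDet v w * θ z (frame₀ z) (frame₁ z) := by
    conv_lhs => rw [hv, hw]
    rw [h.add, h.smul, h.smul, hadd, hadd, hsmul, hsmul, hsmul, hsmul, h0, h0, h.alt (frame₁ z)]
    change _ = (tvec v 0 * tvec w 1 - tvec v 1 * tvec w 0) * _
    ring
  rw [h1]
  unfold coeff vol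
  field_simp

theorem IsTwoForm.coeff_nonneg {z : S} (hj : ∀ v, j z (j z v) = -v)
    {θ : ∀ z : S, TangentSpace surfModel z → TangentSpace surfModel z → ℝ} (h : IsTwoForm z (θ z))
    (hθ : ∀ v, 0 ≤ θ z v (j z v)) : 0 ≤ coeff j θ z := by
  have h0 : frame₀ z ≠ 0 := by
    intro h0
    have h1 : (EuclideanSpace.single 0 1 : EuclideanSpace ℝ (Fin 2)) = 0 := h0
    simpa using congrArg (fun v : EuclideanSpace ℝ (Fin 2) => v 0) h1
  have h2 := hθ (frame₀ z)
  rw [← coeff_mul_vol hj h] at h2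
  exact nonneg_of_mul_nonneg_left h2 (vol_pos hj h0)

theorem IsTwoForm.coeff_pos {z : S} (hj : ∀ v, j z (j z v) = -v)
    {θ : ∀ z : S, TangentSpace surfModel z → TangentSpace surfModel z → ℝ} (h : IsTwoForm z (θ z))
    {v : TangentSpace surfModel z} (hθ : 0 < θ z v (j z v)) : 0 < coeff j θ z := by
  have h0 : v ≠ 0 := by
    rintro rfl
    have := h.smul 0 0 (j z 0)
    rw [zero_smul, zero_mul] at this
    linarith
  rw [← coeff_mul_vol hj h] at hθ
  exact pos_of_mul_pos_left hθ (vol_pos hj h0).le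

theorem isTwoForm_wedge {z : S} (a b : TangentSpace surfModel z →L[ℝ] ℝ) :
    IsTwoForm z fun v w => a v * b w - a w * b v where
  add v v' w := by simp only [map_add]; ring
  smul c v w := by simp only [map_smul, smul_eq_mul]; ring
  alt v w := by ring

theorem isTwoForm_dWedge (f : S → ℝ) (α : ∀ z : S, TangentSpace surfModel z →L[ℝ] ℝ) (z : S) :
    IsTwoForm z (dWedge surfModel f α z) :=
  isTwoForm_wedge (mvfderiv surfModel f z) (α z)

theorem isTwoForm_extDeriv₁ (α : ∀ z : S, TangentSpace surfModel z →L[ℝ] ℝ) (z : S) :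
    IsTwoForm z (extDeriv₁ surfModel α z) where
  add v v' w := by
    have : ∀ (D : EuclideanSpace ℝ (Fin 2) →L[ℝ] EuclideanSpace ℝ (Fin 2) →L[ℝ] ℝ) v v' w,
        D (v + v') w - D w (v + v') = (D v w - D w v) + (D v' w - D w v') := by
      intro D v v' w
      simp only [map_add, add_apply]
      ring
    exact this _ (tvec v) (tvec v') (tvec w)
  smul c v w := by
    have : ∀ (D : EuclideanSpace ℝ (Fin 2) →L[ℝ] EuclideanSpace ℝ (Fin 2) →L[ℝ] ℝ) (c : ℝ) v w,
        D (c • v) w - D w (c • v) = c * (D v w - D w v) := by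
      intro D c v w
      simp only [map_smul, smul_apply, smul_eq_mul]
      ring
    exact this _ c (tvec v) (tvec w)
  alt v w := by
    rw [extDeriv₁_eq_formRep, extDeriv₁_eq_formRep]
    ring

end TwoForms

/-! ### Oriented coordinates modelled on the quadrant -/

section Charts

variable {S : Type*} [TopologicalSpace S] [ChartedSpace (EuclideanQuadrant 2) S]

/-- The derivative of a parametrized surface. -/
def dpar (Φ : ℝ × ℝ → S) (s : Set (ℝ × ℝ)) (y v : ℝ × ℝ) : TangentSpace surfModel (Φ y) :=
  mfderivWithin 𝓘(ℝ, ℝ × ℝ) surfModel Φ s y v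

/-- Positively oriented coordinates on an open subset of a surface with corners. -/
structure OrientedChart (j : ∀ z : S, TangentSpace surfModel z →L[ℝ] TangentSpace surfModel z) where
  /-- The parametrization. -/
  Φ : ℝ × ℝ → S
  /-- The coordinates. -/
  κ : S → ℝ × ℝ
  /-- The coordinate patch. -/
  O : Set S
  /-- The coordinate domain is the part of this open set in the quadrant. -/
  V : Set (ℝ × ℝ)
  isOpen_O : IsOpen O
  isOpen_V : IsOpen V
  κ_mem : ∀ z ∈ O, κ z ∈ quadrant ∩ V
  Φ_mem : ∀ y ∈ quadrant ∩ V, Φ y ∈ O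
  left_inv : ∀ z ∈ O, Φ (κ z) = z
  right_inv : ∀ y ∈ quadrant ∩ V, κ (Φ y) = y
  Φ_contMDiff : ∀ y ∈ quadrant ∩ V,
    ContMDiffWithinAt 𝓘(ℝ, ℝ × ℝ) surfModel ((⊤ : ℕ∞) : WithTop ℕ∞) Φ quadrant y
  κ_smooth : ∀ z ∈ O, ContMDiffAt surfModel 𝓘(ℝ, ℝ × ℝ) 3 κ z
  vol_pos : ∀ y ∈ quadrant ∩ V, 0 < vol j (Φ y) (dpar Φ quadrant y (1, 0)) (dpar Φ quadrant y (0, 1))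
  boundary : ∀ y ∈ quadrant ∩ V, y.1 = 0 ∨ y.2 = 0 → Φ y ∈ surfModel.boundary S

theorem OrientedChart.Φ_smooth
    {j : ∀ z : S, TangentSpace surfModel z →L[ℝ] TangentSpace surfModel z} (c : OrientedChart j)
    (y : ℝ × ℝ) (hy : y ∈ quadrant ∩ c.V) :
    ContMDiffWithinAt 𝓘(ℝ, ℝ × ℝ) surfModel 3 c.Φ quadrant y :=
  (c.Φ_contMDiff y hy).of_le three_le_infty

theorem range_surfModel : range surfModel = {x | ∀ i, 0 ≤ x i} := range_euclideanQuadrant 2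

variable [IsManifold surfModel ∞ S]

/-- Builds the coordinates from the preferred chart followed by a linear isomorphism `L` that
identifies the model quadrant with the real one. The edges go to the boundary because interior
points lie in the open quadrant. -/
theorem exists_orientedChart_aux
    {j : ∀ z : S, TangentSpace surfModel z →L[ℝ] TangentSpace surfModel z}
    {z₀ : S} (L : EuclideanSpace ℝ (Fin 2) ≃L[ℝ] ℝ × ℝ) (hL : ∀ x, L x ∈ quadrant ↔ x ∈ range surfModel)
    (hL0 : ∀ x, ((L x).1 = 0 ∨ (L x).2 = 0) → x 0 = 0 ∨ x 1 = 0)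
    {O : Set S} (hO : IsOpen O) (hz₀ : z₀ ∈ O)
    (hOs : O ⊆ (extChartAt surfModel z₀).source)
    (hvol : ∀ z ∈ O, 0 < vol j z
      (mfderivWithin 𝓘(ℝ, EuclideanSpace ℝ (Fin 2)) surfModel (extChartAt surfModel z₀).symm
        (range surfModel) (extChartAt surfModel z₀ z) (L.symm (1, 0)))
      (mfderivWithin 𝓘(ℝ, EuclideanSpace ℝ (Fin 2)) surfModel (extChartAt surfModel z₀).symm
        (range surfModel) (extChartAt surfModel z₀ z) (L.symm (0, 1)))) :
    ∃ c : OrientedChart j, z₀ ∈ c.O := by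
  have : IsManifold surfModel 3 S := IsManifold.of_le three_le_infty
  have : IsManifold surfModel 1 S := isManifold_one
  set φ := extChartAt surfModel z₀ with hφ
  let V : Set (ℝ × ℝ) := L.symm ⁻¹' (surfModel.symm ⁻¹'
    ((chartAt (EuclideanQuadrant 2) z₀).target ∩ (chartAt (EuclideanQuadrant 2) z₀).symm ⁻¹' O))
  have hV : IsOpen V :=
    (((chartAt (EuclideanQuadrant 2) z₀).isOpen_inter_preimage_symm hO).preimage
      surfModel.continuous_symm).preimage L.symm.continuous
  have hmem : ∀ y, y ∈ quadrant ∩ V ↔ L.symm y ∈ φ.target ∧ φ.symm (L.symm y) ∈ O := by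
    intro y
    have h1 : y ∈ quadrant ↔ L.symm y ∈ range surfModel := by rw [← hL, L.apply_symm_apply]
    rw [mem_inter_iff, h1, hφ, extChartAt_target, mem_inter_iff]
    simp only [V, mem_preimage, mem_inter_iff]
    have h2 : (extChartAt surfModel z₀).symm (L.symm y) =
      (chartAt (EuclideanQuadrant 2) z₀).symm (surfModel.symm (L.symm y)) := rfl
    rw [h2]
    tauto
  have hmaps : MapsTo L.symm quadrant (range surfModel) := fun y hy => by
    rw [← hL, L.apply_symm_apply]; exact hy
  have hdpar : ∀ y ∈ quadrant ∩ V, ∀ v, dpar (φ.symm ∘ L.symm) quadrant y v =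
      mfderivWithin 𝓘(ℝ, EuclideanSpace ℝ (Fin 2)) surfModel φ.symm (range surfModel) (L.symm y)
        (L.symm v) := by
    intro y hy v
    have h1 : MDifferentiableWithinAt 𝓘(ℝ, EuclideanSpace ℝ (Fin 2)) surfModel φ.symm
        (range surfModel) (L.symm y) := mdifferentiableWithinAt_extChartAt_symm ((hmem y).1 hy).1
    have h2 : HasMFDerivWithinAt 𝓘(ℝ, ℝ × ℝ) 𝓘(ℝ, EuclideanSpace ℝ (Fin 2)) L.symm quadrant y
        (L.symm : ℝ × ℝ →L[ℝ] EuclideanSpace ℝ (Fin 2)) :=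
      L.symm.hasFDerivAt.hasFDerivWithinAt.hasMFDerivWithinAt
    have h3 := (h1.hasMFDerivWithinAt.comp y h2 hmaps).mfderivWithin
      (uniqueDiffOn_quadrant y hy.1).uniqueMDiffWithinAt
    unfold dpar
    rw [h3]
    rfl
  refine ⟨⟨φ.symm ∘ L.symm, L ∘ φ, O, V, hO, hV, ?_, ?_, ?_, ?_, ?_, ?_, ?_, ?_⟩, hz₀⟩
  · intro z hz
    rw [hmem]
    simp only [Function.comp, L.symm_apply_apply]
    exact ⟨φ.map_source (hOs hz), by rwa [φ.left_inv (hOs hz)]⟩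
  · exact fun y hy => ((hmem y).1 hy).2
  · intro z hz
    simp only [Function.comp, L.symm_apply_apply]
    exact φ.left_inv (hOs hz)
  · intro y hy
    simp only [Function.comp]
    rw [φ.right_inv ((hmem y).1 hy).1, L.apply_symm_apply]
  · intro y hy
    have h1 : ContMDiffWithinAt 𝓘(ℝ, EuclideanSpace ℝ (Fin 2)) surfModel ((⊤ : ℕ∞) : WithTop ℕ∞) φ.symm
        (range surfModel) (L.symm y) := contMDiffWithinAt_extChartAt_symm_range z₀ ((hmem y).1 hy).1
    exact h1.comp y L.symm.contDiff.contMDiff.contMDiffAt.contMDiffWithinAt hmaps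
  · intro z hz
    have h1 : ContMDiffAt surfModel 𝓘(ℝ, EuclideanSpace ℝ (Fin 2)) 3 φ z :=
      contMDiffAt_extChartAt' (by simpa [hφ] using hOs hz)
    exact L.contDiff.contMDiff.contMDiffAt.comp z h1
  · intro y hy
    rw [hdpar y hy, hdpar y hy]
    have h1 := hvol _ ((hmem y).1 hy).2
    rw [φ.right_inv ((hmem y).1 hy).1] at h1
    exact h1
  · intro y hy hy0
    have h1 := ((hmem y).1 hy).1
    have hsrc : φ.symm (L.symm y) ∈ (chartAt (EuclideanQuadrant 2) z₀).source := by
      simpa [hφ] using φ.map_target h1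
    change surfModel.IsBoundaryPoint (φ.symm (L.symm y))
    rw [surfModel.isBoundaryPoint_iff_not_isInteriorPoint,
      surfModel.isInteriorPoint_iff_of_mem_atlas (n := 1) one_ne_zero (chart_mem_atlas _ z₀) hsrc]
    intro hint
    change φ (φ.symm (L.symm y)) ∈ interior φ.target at hint
    rw [φ.right_inv h1] at hint
    have h2 := interior_mono (extChartAt_target_subset_range z₀) hint
    rw [range_surfModel, interior_euclideanQuadrant] at h2
    rcases hL0 (L.symm y) (by rwa [L.apply_symm_apply]) with h | h
    · exact absurd (h2 0) (by simp [h])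
    · exact absurd (h2 1) (by simp [h])

/-- The coordinates of the plane. -/
def planeCoord : EuclideanSpace ℝ (Fin 2) ≃L[ℝ] ℝ × ℝ :=
  (EuclideanSpace.equiv (Fin 2) ℝ).trans (ContinuousLinearEquiv.finTwoArrow ℝ ℝ)

theorem planeCoord_apply (x : EuclideanSpace ℝ (Fin 2)) : planeCoord x = (x 0, x 1) := rfl

theorem planeCoord_symm_fst : planeCoord.symm (1, 0) = EuclideanSpace.single 0 1 := by
  rw [ContinuousLinearEquiv.symm_apply_eq, planeCoord_apply]; simp

theorem planeCoord_symm_snd : planeCoord.symm (0, 1) = EuclideanSpace.single 1 1 := by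
  rw [ContinuousLinearEquiv.symm_apply_eq, planeCoord_apply]; simp

/-- In the trivialization at `z₀` the orientation of the coordinate basis is the sign of `r`, a
component of `j`, which is nonzero at `z₀` and continuous there. If it is negative, swapping the two
coordinates reverses the orientation and preserves the quadrant. -/
theorem exists_orientedChart
    {j : ∀ z : S, TangentSpace surfModel z →L[ℝ] TangentSpace surfModel z}
    (hj : IsComplexStructure j) (z₀ : S) : ∃ c : OrientedChart j, z₀ ∈ c.O := by
  have : IsManifold surfModel 1 S := isManifold_one
  set φ := extChartAt surfModel z₀ with hφ
  let M : S → EuclideanSpace ℝ (Fin 2) →L[ℝ] EuclideanSpace ℝ (Fin 2) := fun z =>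
    ContinuousLinearMap.inCoordinates (EuclideanSpace ℝ (Fin 2)) (fun z : S => TangentSpace surfModel z)
      (EuclideanSpace ℝ (Fin 2)) (fun z : S => TangentSpace surfModel z) z₀ z z₀ z (j z)
  have hM : ContinuousAt M z₀ := ((contMDiffAt_hom_bundle _).1 (hj.smooth z₀)).2.continuousAt
  let r : S → ℝ := fun z => M z (EuclideanSpace.single 0 1) 1
  have hr : ContinuousAt r z₀ := by
    have h1 : ContinuousAt (fun z => M z (EuclideanSpace.single 0 1)) z₀ := hM.clm_apply continuousAt_const
    exact (EuclideanSpace.proj (𝕜 := ℝ) (1 : Fin 2)).continuous.continuousAt.comp h1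
  let T : ∀ z : S, EuclideanSpace ℝ (Fin 2) →L[ℝ] TangentSpace surfModel z := fun z =>
    (trivializationAt (EuclideanSpace ℝ (Fin 2)) (TangentSpace surfModel) z₀).symmL ℝ z
  have hT : ∀ z ∈ φ.source, ∀ v, T z v = mfderivWithin 𝓘(ℝ, EuclideanSpace ℝ (Fin 2)) surfModel φ.symm
      (range surfModel) (φ z) v := by
    intro z hz v
    have hz' : z ∈ (chartAt (EuclideanQuadrant 2) z₀).source := by simpa [hφ] using hz
    exact DFunLike.congr_fun (TangentBundle.symmL_trivializationAt (I := surfModel) hz') v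
  have hTvol : ∀ z (v w : EuclideanSpace ℝ (Fin 2)), vol j z (T z v) (T z w) = planeDet v w *
      vol j z (T z (EuclideanSpace.single 0 1)) (T z (EuclideanSpace.single 1 1)) := by
    intro z v w
    have hd : planeDet v w = v 0 * w 1 - v 1 * w 0 := rfl
    conv_lhs => rw [eq_comb v, eq_comb w]
    rw [hd, ← vol_comb, map_add, map_add, map_smul, map_smul, map_smul, map_smul]
  have hVr : ∀ z ∈ φ.source, 0 < vol j z (T z (EuclideanSpace.single 0 1)) (T z (EuclideanSpace.single 1 1)) * r z := by
    intro z hz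
    have hz' : z ∈ (trivializationAt (EuclideanSpace ℝ (Fin 2)) (TangentSpace surfModel) z₀).baseSet := by
      simpa [hφ] using hz
    have hjT : ∀ v, j z (T z v) = T z (M z v) := fun v =>
      ((trivializationAt (EuclideanSpace ℝ (Fin 2)) (TangentSpace surfModel)
        z₀).symmL_continuousLinearMapAt (R := ℝ) hz' (j z (T z v))).symm
    have hne : T z (EuclideanSpace.single 0 1) ≠ 0 := by
      intro h0
      have h1 := (trivializationAt (EuclideanSpace ℝ (Fin 2)) (TangentSpace surfModel)
        z₀).continuousLinearMapAt_symmL (R := ℝ) hz' (EuclideanSpace.single 0 1)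
      change (trivializationAt (EuclideanSpace ℝ (Fin 2)) (TangentSpace surfModel)
        z₀).continuousLinearMapAt ℝ z (T z (EuclideanSpace.single 0 1)) = _ at h1
      rw [h0, map_zero] at h1
      simpa using congrArg (fun v : EuclideanSpace ℝ (Fin 2) => v 0) h1
    have h2 := vol_pos (hj.sq z) hne
    rw [hjT, hTvol] at h2
    have h3 : planeDet (EuclideanSpace.single 0 1) (M z (EuclideanSpace.single 0 1)) = r z := by
      simp [planeDet, r]
    rw [h3] at h2
    linarith
  have hz₀s : z₀ ∈ φ.source := mem_extChartAt_source z₀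
  have hrz₀ : r z₀ ≠ 0 := fun h => by have := hVr z₀ hz₀s; rw [h] at this; simp at this
  have hmain : ∀ L : EuclideanSpace ℝ (Fin 2) ≃L[ℝ] ℝ × ℝ, (∀ x, L x ∈ quadrant ↔ x ∈ range surfModel) →
      (∀ x, ((L x).1 = 0 ∨ (L x).2 = 0) → x 0 = 0 ∨ x 1 = 0) →
      0 < planeDet (L.symm (1, 0)) (L.symm (0, 1)) * r z₀ → ∃ c : OrientedChart j, z₀ ∈ c.O := by
    intro L hL hL0 hdet
    have h1 : ∀ᶠ z in 𝓝 z₀, z ∈ φ.source ∧ 0 < planeDet (L.symm (1, 0)) (L.symm (0, 1)) * r z :=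
      Filter.Eventually.and (extChartAt_source_mem_nhds z₀)
        ((continuousAt_const.mul hr).eventually (lt_mem_nhds hdet))
    obtain ⟨O, hO, hO1, hO2⟩ := eventually_nhds_iff.1 h1
    refine exists_orientedChart_aux L hL hL0 hO1 hO2 (fun z hz => (hO z hz).1) fun z hz => ?_
    rw [← hT z (hO z hz).1, ← hT z (hO z hz).1, hTvol]
    have h2 := hVr z (hO z hz).1
    have h3 := (hO z hz).2
    have h4 := mul_pos h2 h3
    have h5 : 0 < r z ^ 2 := by
      have : r z ≠ 0 := fun h => by rw [h] at h2; simp at h2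
      positivity
    refine pos_of_mul_pos_left (b := r z ^ 2) ?_ h5.le
    linarith
  rcases lt_or_gt_of_ne hrz₀ with hneg | hpos
  · refine hmain (planeCoord.trans (ContinuousLinearEquiv.prodComm ℝ ℝ ℝ)) ?_ ?_ ?_
    · intro x
      rw [range_surfModel]
      simp [quadrant, planeCoord_apply, Fin.forall_fin_two, and_comm]
    · intro x
      simp [planeCoord_apply, or_comm]
    · have e1 : (planeCoord.trans (ContinuousLinearEquiv.prodComm ℝ ℝ ℝ)).symm (1, 0) =
        EuclideanSpace.single 1 1 := planeCoord_symm_snd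
      have e2 : (planeCoord.trans (ContinuousLinearEquiv.prodComm ℝ ℝ ℝ)).symm (0, 1) =
        EuclideanSpace.single 0 1 := planeCoord_symm_fst
      rw [e1, e2]
      simp [planeDet]
      linarith
  · refine hmain planeCoord ?_ ?_ ?_
    · intro x
      rw [range_surfModel]
      simp [quadrant, planeCoord_apply, Fin.forall_fin_two]
    · intro x
      simp [planeCoord_apply]
    · rw [planeCoord_symm_fst, planeCoord_symm_snd, planeDet_single]
      linarith

end Charts

/-! ### Integration of 2-forms and Stokes' theorem on the compact surface -/

theorem det_prod (T : ℝ × ℝ →L[ℝ] ℝ × ℝ) :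
    T.det = (T (1, 0)).1 * (T (0, 1)).2 - (T (1, 0)).2 * (T (0, 1)).1 := by
  change LinearMap.det T.toLinearMap = _
  rw [← LinearMap.det_toMatrix (Module.Basis.finTwoProd ℝ), Matrix.det_fin_two]
  simp [LinearMap.toMatrix_apply]
  ring

section Integral

variable {S : Type*} [TopologicalSpace S] [ChartedSpace (EuclideanQuadrant 2) S]
  {j : ∀ z : S, TangentSpace surfModel z →L[ℝ] TangentSpace surfModel z}

/-- The coordinate expression of the 2-form `f • vol` for the parametrized surface `Φ`. -/
def raw (j : ∀ z : S, TangentSpace surfModel z →L[ℝ] TangentSpace surfModel z) (Φ : ℝ × ℝ → S)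
    (s : Set (ℝ × ℝ)) (f : S → ℝ) (y : ℝ × ℝ) : ℝ :=
  f (Φ y) * vol j (Φ y) (dpar Φ s y (1, 0)) (dpar Φ s y (0, 1))

namespace OrientedChart

/-- The domain of the coordinates. -/
def D (c : OrientedChart j) : Set (ℝ × ℝ) := quadrant ∩ c.V

open Classical in
/-- The coordinate expression of the 2-form `f • vol`, extended by zero. -/
def dens (c : OrientedChart j) (f : S → ℝ) (y : ℝ × ℝ) : ℝ :=
  if y ∈ c.D then raw j c.Φ quadrant f y else 0

/-- The integral of the 2-form `f • vol` over a coordinate patch. -/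
def int (c : OrientedChart j) (f : S → ℝ) : ℝ := ∫ y in quadrant, c.dens f y

variable (c : OrientedChart j)

theorem D_mem_nhdsWithin {y : ℝ × ℝ} (hy : y ∈ c.D) : c.D ∈ 𝓝[quadrant] y :=
  inter_mem_nhdsWithin _ (c.isOpen_V.mem_nhds hy.2)

theorem measurableSet_D : MeasurableSet c.D :=
  isClosed_quadrant.measurableSet.inter c.isOpen_V.measurableSet

theorem isCompact_image {K : Set S} (hK : IsCompact K) (hKO : K ⊆ c.O) : IsCompact (c.κ '' K) :=
  hK.image_of_continuousOn fun z hz => (c.κ_smooth z (hKO hz)).continuousAt.continuousWithinAt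

theorem dens_eq_zero {K : Set S} (f : S → ℝ) (hf : ∀ z, z ∉ K → f z = 0)
    {y : ℝ × ℝ} (hy : y ∉ c.κ '' K) : c.dens f y = 0 := by
  unfold dens
  split_ifs with h
  · unfold raw
    rw [hf, zero_mul]
    exact fun hz => hy ⟨_, hz, c.right_inv y h⟩
  · rfl

/-- The support of `f` is a compact subset of the patch, so its image in the coordinates is closed
and the extension by zero is locally zero at points outside the coordinate domain. -/
theorem continuousOn_dens {K : Set S} (hK : IsCompact K) (hKO : K ⊆ c.O) {f : S → ℝ}
    (hf : ∀ z, z ∉ K → f z = 0) (hc : ContinuousOn (raw j c.Φ quadrant f) c.D) :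
    ContinuousOn (c.dens f) quadrant := by
  intro y hy
  by_cases hyD : y ∈ c.D
  · have h1 : ContinuousWithinAt (raw j c.Φ quadrant f) quadrant y :=
      (hc y hyD).mono_of_mem_nhdsWithin (c.D_mem_nhdsWithin hyD)
    refine h1.congr_of_eventuallyEq ?_ (if_pos hyD)
    filter_upwards [c.D_mem_nhdsWithin hyD] with z hz using if_pos hz
  · have hyK : y ∉ c.κ '' K := by
      rintro ⟨z, hz, rfl⟩
      exact hyD (c.κ_mem z (hKO hz))
    have h1 : c.dens f =ᶠ[𝓝[quadrant] y] fun _ => 0 := by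
      refine mem_nhdsWithin_of_mem_nhds ?_
      filter_upwards [(c.isCompact_image hK hKO).isClosed.isOpen_compl.mem_nhds hyK] with z hz
      exact c.dens_eq_zero f hf hz
    exact continuousWithinAt_const.congr_of_eventuallyEq h1 (c.dens_eq_zero f hf hyK)

theorem integrableOn_dens {K : Set S} (hK : IsCompact K) (hKO : K ⊆ c.O) {f : S → ℝ}
    (hf : ∀ z, z ∉ K → f z = 0) (hc : ContinuousOn (raw j c.Φ quadrant f) c.D) :
    IntegrableOn (c.dens f) quadrant := by
  have h1 : c.κ '' K ⊆ quadrant := by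
    rintro _ ⟨z, hz, rfl⟩
    exact (c.κ_mem z (hKO hz)).1
  refine IntegrableOn.of_forall_sdiff_eq_zero (s := c.κ '' K)
    (((c.continuousOn_dens hK hKO hf hc).mono h1).integrableOn_compact (c.isCompact_image hK hKO))
    isClosed_quadrant.measurableSet fun y hy => c.dens_eq_zero f hf hy.2

theorem raw_eq_curl {γ : ∀ z : S, TangentSpace surfModel z →L[ℝ] ℝ} {f : S → ℝ}
    {y : ℝ × ℝ} (hy : y ∈ c.D)
    (h : HasExtDeriv surfModel γ (fun z v w => f z * vol j z v w) (c.Φ y)) :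
    raw j c.Φ quadrant f y = curl quadrant (pull surfModel c.Φ quadrant γ) y :=
  ((h c.Φ quadrant y hy.1 uniqueDiffOn_quadrant quadrant_subset_closure_interior rfl
    (c.Φ_smooth y hy)).2 (1, 0) (0, 1)).symm

theorem contDiffWithinAt_pull {γ : ∀ z : S, TangentSpace surfModel z →L[ℝ] ℝ}
    {θ : ∀ z : S, TangentSpace surfModel z → TangentSpace surfModel z → ℝ}
    {y : ℝ × ℝ} (hy : y ∈ c.D) (h : HasExtDeriv surfModel γ θ (c.Φ y)) :
    ContDiffWithinAt ℝ 1 (pull surfModel c.Φ quadrant γ) quadrant y :=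
  (h c.Φ quadrant y hy.1 uniqueDiffOn_quadrant quadrant_subset_closure_interior rfl
    (c.Φ_smooth y hy)).1

/-- An exterior derivative of a form with `C¹` pullbacks has a continuous coordinate expression,
namely the `curl` of the pullback. No separate regularity of `f` is needed. -/
theorem continuousWithinAt_raw {γ : ∀ z : S, TangentSpace surfModel z →L[ℝ] ℝ} {f : S → ℝ}
    {y : ℝ × ℝ} (hy : y ∈ c.D)
    (h : ∀ᶠ z in 𝓝 (c.Φ y), HasExtDeriv surfModel γ (fun z v w => f z * vol j z v w) z) :
    ContinuousWithinAt (raw j c.Φ quadrant f) c.D y := by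
  have h2 := (c.contDiffWithinAt_pull hy h.self_of_nhds).fderivWithin_right (m := 0)
    uniqueDiffOn_quadrant (by norm_num) hy.1
  have h3 := h2.continuousWithinAt.mono (inter_subset_left : c.D ⊆ quadrant)
  have h4 : ContinuousWithinAt (curl quadrant (pull surfModel c.Φ quadrant γ)) c.D y := by
    unfold curl
    exact ((h3.clm_apply continuousWithinAt_const).clm_apply continuousWithinAt_const).sub
      ((h3.clm_apply continuousWithinAt_const).clm_apply continuousWithinAt_const)
  refine h4.congr_of_eventuallyEq ?_ (c.raw_eq_curl hy h.self_of_nhds)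
  have h5 := ((c.Φ_smooth y hy).continuousWithinAt.mono (inter_subset_left : c.D ⊆ quadrant)).eventually h
  filter_upwards [h5, self_mem_nhdsWithin] with y' hy' hD using c.raw_eq_curl hD hy'

theorem continuousOn_Φ : ContinuousOn c.Φ c.D := fun y hy =>
  (c.Φ_smooth y hy).continuousWithinAt.mono inter_subset_left

theorem continuousOn_raw_mul {f g : S → ℝ} (hf : ContinuousOn (raw j c.Φ quadrant f) c.D)
    (hg : Continuous g) : ContinuousOn (raw j c.Φ quadrant fun z => g z * f z) c.D := by
  have h1 := (hg.comp_continuousOn c.continuousOn_Φ).mul hf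
  refine h1.congr fun y _ => ?_
  simp only [raw, Function.comp, Pi.mul_apply]
  ring

theorem dens_add (f g : S → ℝ) (y : ℝ × ℝ) :
    c.dens (fun z => f z + g z) y = c.dens f y + c.dens g y := by
  unfold dens raw
  split_ifs <;> ring

/-- Stokes' theorem for a form which is supported in a coordinate patch and non-positive on the
oriented boundary. -/
theorem int_nonpos {γ : ∀ z : S, TangentSpace surfModel z →L[ℝ] ℝ} {f : S → ℝ}
    (h : ∀ z ∈ c.O, HasExtDeriv surfModel γ (fun z v w => f z * vol j z v w) z)
    {K : Set S} (hK : IsCompact K) (hKO : K ⊆ c.O) (hγ : ∀ z, z ∉ K → γ z = 0)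
    (h1 : ∀ x, 0 < x → (x, 0) ∈ c.D → γ (c.Φ (x, 0)) (dpar c.Φ quadrant (x, 0) (1, 0)) ≤ 0)
    (h2 : ∀ t, 0 < t → (0, t) ∈ c.D → 0 ≤ γ (c.Φ (0, t)) (dpar c.Φ quadrant (0, t) (0, 1))) :
    c.int f ≤ 0 := by
  classical
  -- The coordinate expression of `γ`, extended by zero. It is `C¹` on the whole quadrant because
  -- the support of `γ` is compact in the patch.
  let b : ℝ × ℝ → ℝ × ℝ →L[ℝ] ℝ := fun y => if y ∈ c.D then pull surfModel c.Φ quadrant γ y else 0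
  have hb0 : ∀ y, y ∉ c.κ '' K → b y = 0 := by
    intro y hy
    by_cases hyD : y ∈ c.D
    · have h3 : c.Φ y ∉ K := fun hz => hy ⟨_, hz, c.right_inv y hyD⟩
      simp only [b, if_pos hyD, pull, hγ _ h3]
      exact ContinuousLinearMap.zero_comp _
    · exact if_neg hyD
  have hbD : ∀ y ∈ c.D, b =ᶠ[𝓝[quadrant] y] pull surfModel c.Φ quadrant γ := by
    intro y hy
    filter_upwards [c.D_mem_nhdsWithin hy] with z hz using if_pos hz
  have hKD : c.κ '' K ⊆ c.D := by
    rintro _ ⟨z, hz, rfl⟩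
    exact c.κ_mem z (hKO hz)
  have hbN : ∀ y, y ∉ c.D → b =ᶠ[𝓝[quadrant] y] fun _ => 0 := by
    intro y hy
    refine mem_nhdsWithin_of_mem_nhds ?_
    filter_upwards [(c.isCompact_image hK hKO).isClosed.isOpen_compl.mem_nhds
      fun hz => hy (hKD hz)] with z hz using hb0 z hz
  have hb : ContDiffOn ℝ 1 b quadrant := by
    intro y hy
    by_cases hyD : y ∈ c.D
    · exact (c.contDiffWithinAt_pull hyD (h _ (c.Φ_mem y hyD))).congr_of_eventuallyEq (hbD y hyD)
        (if_pos hyD)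
    · exact contDiffWithinAt_const.congr_of_eventuallyEq (hbN y hyD) (if_neg hyD)
  have hcurl : ∀ y ∈ quadrant, c.dens f y = curl quadrant b y := by
    intro y hy
    by_cases hyD : y ∈ c.D
    · have e1 : c.dens f y = raw j c.Φ quadrant f y := if_pos hyD
      rw [e1, c.raw_eq_curl hyD (h _ (c.Φ_mem y hyD))]
      unfold curl
      rw [(hbD y hyD).fderivWithin_eq (if_pos hyD)]
    · have e1 : c.dens f y = 0 := if_neg hyD
      rw [e1]
      unfold curl
      rw [(hbN y hyD).fderivWithin_eq (if_neg hyD)]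
      simp
  unfold int
  rw [setIntegral_congr_fun isClosed_quadrant.measurableSet hcurl]
  refine integral_curl_quadrant_nonpos hb (c.isCompact_image hK hKO) hb0 ?_ ?_
  · intro x hx
    by_cases hyD : (x, (0 : ℝ)) ∈ c.D
    · simp only [b, if_pos hyD]
      exact h1 x hx hyD
    · simp only [b, if_neg hyD]
      simp
  · intro t ht
    by_cases hyD : ((0 : ℝ), t) ∈ c.D
    · simp only [b, if_pos hyD]
      exact h2 t ht hyD
    · simp only [b, if_neg hyD]
      simp

/-- Change of variables for integrals of 2-forms. -/
theorem int_eq_setIntegral [IsManifold surfModel ∞ S] {Ψ : ℝ × ℝ → S} {s B : Set (ℝ × ℝ)}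
    (hBs : B ⊆ s) (hB : MeasurableSet B)
    (hΨ : ∀ y ∈ B, ContMDiffWithinAt 𝓘(ℝ, ℝ × ℝ) surfModel 3 Ψ s y) (hinj : InjOn Ψ B)
    (hpos : ∀ y ∈ B, 0 < vol j (Ψ y) (dpar Ψ s y (1, 0)) (dpar Ψ s y (0, 1)))
    {f : S → ℝ} (hfO : ∀ z, z ∉ c.O → f z = 0) (hfB : ∀ z, z ∉ Ψ '' B → f z = 0) :
    c.int f = ∫ y in B, raw j Ψ s f y := by
  have : IsManifold surfModel 3 S := IsManifold.of_le three_le_infty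
  have hΨc : ContinuousOn Ψ B := fun y hy => (hΨ y hy).continuousWithinAt.mono hBs
  set B' := B ∩ Ψ ⁻¹' c.O with hB'
  have hB'm : MeasurableSet B' := by
    obtain ⟨U, hU, hUB⟩ := continuousOn_iff'.1 hΨc c.O c.isOpen_O
    rw [hB', inter_comm, hUB]
    exact hU.measurableSet.inter hB
  let T : ℝ × ℝ → ℝ × ℝ := c.κ ∘ Ψ
  let T' : ℝ × ℝ → ℝ × ℝ →L[ℝ] ℝ × ℝ := fun y =>
    (mfderiv surfModel 𝓘(ℝ, ℝ × ℝ) c.κ (Ψ y)).comp (mfderivWithin 𝓘(ℝ, ℝ × ℝ) surfModel Ψ s y)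
  have hT' : ∀ y ∈ B', HasFDerivWithinAt T (T' y) B' y := by
    intro y hy
    have h1 := ((c.κ_smooth _ hy.2).mdifferentiableAt (by norm_num)).hasMFDerivAt
    have h2 := ((hΨ y hy.1).mdifferentiableWithinAt (by norm_num)).hasMFDerivWithinAt
    exact ((h1.comp_hasMFDerivWithinAt y h2).mono
      (inter_subset_left.trans hBs)).hasFDerivWithinAt
  have hTD : ∀ y ∈ B', T y ∈ c.D := fun y hy => c.κ_mem _ hy.2
  have hΦT : ∀ y ∈ B', c.Φ (T y) = Ψ y := fun y hy => c.left_inv _ hy.2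
  have hTinj : InjOn T B' := by
    intro y hy y' hy' h
    apply hinj hy.1 hy'.1
    rw [← hΦT y hy, ← hΦT y' hy', h]
  have hdet : ∀ y ∈ B', |(T' y).det| * raw j c.Φ quadrant f (T y) = raw j Ψ s f y := by
    intro y hy
    have hd : ∀ v, ∀ z : S, z = Ψ y → dpar c.Φ quadrant (T y) (T' y v) = dpar Ψ s y v := by
      intro v z _
      have hO := hy.2
      have h1 := ((c.κ_smooth _ hy.2).mdifferentiableAt (by norm_num)).hasMFDerivAt
      have h2 := ((c.Φ_smooth _ (hTD y hy)).mdifferentiableWithinAt (by norm_num)).hasMFDerivWithinAt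
      have hpre : c.κ ⁻¹' quadrant ∈ 𝓝 (Ψ y) := by
        filter_upwards [c.isOpen_O.mem_nhds hO] with z hz using (c.κ_mem z hz).1
      have h3 : HasMFDerivWithinAt surfModel surfModel (c.Φ ∘ c.κ) (c.κ ⁻¹' quadrant) (Ψ y) _ :=
        h2.comp (Ψ y) h1.hasMFDerivWithinAt (fun z hz => hz)
      have h4 := h3.hasMFDerivAt hpre
      have h5 : HasMFDerivAt surfModel surfModel (c.Φ ∘ c.κ) (Ψ y)
          (ContinuousLinearMap.id ℝ (TangentSpace surfModel (Ψ y))) := by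
        refine (hasMFDerivAt_id (Ψ y)).congr_of_eventuallyEq ?_
        filter_upwards [c.isOpen_O.mem_nhds hO] with z hz using c.left_inv z hz
      have h6 := hasMFDerivAt_unique h4 h5
      exact DFunLike.congr_fun h6 (mfderivWithin 𝓘(ℝ, ℝ × ℝ) surfModel Ψ s y v)
    have hvol : ∀ (z z' : S) (v w : EuclideanSpace ℝ (Fin 2)), z = z' → vol j z v w = vol j z' v w := by
      rintro z _ v w rfl
      rfl
    -- The transition map `T = κ ∘ Ψ` satisfies `dΦ ∘ dT = dΨ`, so its Jacobian is the ratio of the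
    -- two values of `vol`. Both are positive, and the absolute value in the change of variables can
    -- be dropped.
    have hdet : vol j (Ψ y) (dpar Ψ s y (1, 0)) (dpar Ψ s y (0, 1)) = (T' y).det *
        vol j (c.Φ (T y)) (dpar c.Φ quadrant (T y) (1, 0)) (dpar c.Φ quadrant (T y) (0, 1)) := by
      rw [det_prod]
      refine Eq.trans ?_ (vol_map j (c.Φ (T y))
        (mfderivWithin 𝓘(ℝ, ℝ × ℝ) surfModel c.Φ quadrant (T y)) (T' y (1, 0)) (T' y (0, 1)))
      have e1 := hd (1, 0) _ rfl
      have e2 := hd (0, 1) _ rfl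
      refine Eq.trans (hvol _ _ _ _ (hΦT y hy).symm) ?_
      exact congrArg₂ (fun v w : EuclideanSpace ℝ (Fin 2) => vol j (c.Φ (T y)) v w) e1.symm e2.symm
    have p1 := hpos y hy.1
    have p2 := c.vol_pos (T y) (hTD y hy)
    have p3 : 0 < (T' y).det := by
      rw [hdet] at p1
      exact pos_of_mul_pos_left p1 p2.le
    unfold raw
    rw [abs_of_pos p3, hdet, hΦT y hy]
    ring
  have himg : ∫ x in T '' B', c.dens f x = ∫ y in B', raw j Ψ s f y := by
    rw [integral_image_eq_integral_abs_det_fderiv_smul volume hB'm hT' hTinj]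
    refine setIntegral_congr_fun hB'm fun y hy => ?_
    simp only [smul_eq_mul]
    rw [show c.dens f (T y) = raw j c.Φ quadrant f (T y) from if_pos (hTD y hy)]
    exact hdet y hy
  have hsub : T '' B' ⊆ quadrant := by
    rintro _ ⟨y, hy, rfl⟩
    exact (hTD y hy).1
  unfold int
  rw [setIntegral_eq_of_subset_of_forall_sdiff_eq_zero isClosed_quadrant.measurableSet hsub, himg]
  · symm
    refine setIntegral_eq_of_subset_of_forall_sdiff_eq_zero hB inter_subset_left ?_
    rintro y ⟨hy, hy2⟩
    unfold raw
    rw [hfO, zero_mul]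
    exact fun hO => hy2 ⟨hy, hO⟩
  · rintro y ⟨hy, hy2⟩
    unfold dens
    split_ifs with hD
    · unfold raw
      rw [hfB, zero_mul]
      rintro ⟨y', hy', he⟩
      apply hy2
      refine ⟨y', ⟨hy', ?_⟩, ?_⟩
      · rw [mem_preimage, he]; exact c.Φ_mem y hD
      · simp only [T, Function.comp, he]
        exact c.right_inv y hD
    · rfl

end OrientedChart

end Integral

section Integral

variable {S : Type*} [TopologicalSpace S] [ChartedSpace (EuclideanQuadrant 2) S]
  {j : ∀ z : S, TangentSpace surfModel z →L[ℝ] TangentSpace surfModel z}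

theorem mvfderiv_sum {ι : Type*} (t : Finset ι) {f : ι → S → ℝ} {z : S}
    (hf : ∀ i ∈ t, ContMDiffAt surfModel 𝓘(ℝ) 1 (f i) z) (v : TangentSpace surfModel z) :
    mvfderiv surfModel (fun z => ∑ i ∈ t, f i z) z v = ∑ i ∈ t, mvfderiv surfModel (f i) z v := by
  classical
  induction t using Finset.induction_on with
  | empty =>
    simp only [Finset.sum_empty]
    rw [mvfderiv_const]
    rfl
  | insert i t hi ih =>
    have h1 := fun i hi => hf i (Finset.mem_insert_of_mem hi)
    simp only [Finset.sum_insert hi]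
    rw [← ih h1]
    exact DFunLike.congr_fun (mvfderiv_add ((hf i (Finset.mem_insert_self i t)).mdifferentiableAt
      (by simp)) ((contMDiffAt_finsetSum h1).mdifferentiableAt (by simp))) v

theorem dWedge_eq_zero {f : S → ℝ} (γ : ∀ z : S, TangentSpace surfModel z →L[ℝ] ℝ) {z : S} {c : ℝ}
    (hf : f =ᶠ[𝓝 z] fun _ => c) (v w : TangentSpace surfModel z) : dWedge surfModel f γ z v w = 0 := by
  have h : mfderiv surfModel 𝓘(ℝ) f z = 0 := hf.mfderiv_eq.trans mfderiv_const
  have h' : ∀ v, mvfderiv surfModel f z v = 0 := fun v => DFunLike.congr_fun h v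
  simp only [dWedge, h', zero_mul, sub_zero]

/-- The 2-form `f • vol` is continuous. -/
def IsContForm (j : ∀ z : S, TangentSpace surfModel z →L[ℝ] TangentSpace surfModel z)
    (f : S → ℝ) : Prop :=
  ∀ c : OrientedChart j, ContinuousOn (raw j c.Φ quadrant f) c.D

theorem IsContForm.add {f f' : S → ℝ} (h : IsContForm j f) (h' : IsContForm j f') :
    IsContForm j fun z => f z + f' z := fun c =>
  ((h c).add (h' c)).congr fun y _ => by simp only [raw, Pi.add_apply]; ring

theorem IsContForm.sub {f f' : S → ℝ} (h : IsContForm j f) (h' : IsContForm j f') :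
    IsContForm j fun z => f z - f' z := fun c =>
  ((h c).sub (h' c)).congr fun y _ => by simp only [raw, Pi.sub_apply]; ring

theorem IsContForm.mul {f g : S → ℝ} (h : IsContForm j f) (hg : Continuous g) :
    IsContForm j fun z => g z * f z := fun c => c.continuousOn_raw_mul (h c) hg

theorem IsContForm.sum {ι : Type*} (t : Finset ι) {f : ι → S → ℝ} (h : ∀ i ∈ t, IsContForm j (f i)) :
    IsContForm j fun z => ∑ i ∈ t, f i z := fun c =>
  (continuousOn_finsetSum t fun i hi => h i hi c).congr fun y _ => by
    simp only [raw, Finset.sum_mul]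

theorem isContForm_of_hasExtDeriv {γ : ∀ z : S, TangentSpace surfModel z →L[ℝ] ℝ} {f : S → ℝ}
    (h : ∀ z, HasExtDeriv surfModel γ (fun z v w => f z * vol j z v w) z) : IsContForm j f :=
  fun c _ hy => c.continuousWithinAt_raw hy (Eventually.of_forall h)

/-- A finite collection of oriented coordinate patches with a subordinate partition of unity. -/
structure OrientedCover (j : ∀ z : S, TangentSpace surfModel z →L[ℝ] TangentSpace surfModel z)
    (ι : Type*) [Fintype ι] where
  /-- The coordinate patches. -/
  c : ι → OrientedChart j
  /-- The partition of unity. -/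
  f : ι → S → ℝ
  f_smooth : ∀ i, ContMDiff surfModel 𝓘(ℝ) ∞ (f i)
  f_nonneg : ∀ i z, 0 ≤ f i z
  f_supp : ∀ i, tsupport (f i) ⊆ (c i).O
  f_sum : ∀ z, ∑ i, f i z = 1

theorem exists_orientedCover [T2Space S] [CompactSpace S] [IsManifold surfModel ∞ S]
    (hj : IsComplexStructure j) : ∃ t : Finset S, Nonempty (OrientedCover j t) := by
  choose c hc using exists_orientedChart hj
  obtain ⟨t, ht⟩ := isCompact_univ.elim_finite_subcover (fun z => (c z).O)
    (fun z => (c z).isOpen_O) fun z _ => mem_iUnion.2 ⟨z, hc z⟩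
  obtain ⟨f, hf⟩ := SmoothPartitionOfUnity.exists_isSubordinate surfModel (s := (univ : Set S))
    isClosed_univ (fun z : t => (c z).O) (fun z => (c z).isOpen_O) fun z hz => by
      obtain ⟨i, hi, hz⟩ := mem_iUnion₂.1 (ht hz)
      exact mem_iUnion.2 ⟨⟨i, hi⟩, hz⟩
  refine ⟨t, ⟨⟨fun i => c i, fun i => f i, fun i => (f i).contMDiff, fun i z => f.nonneg i z,
    hf, fun z => ?_⟩⟩⟩
  rw [← finsum_eq_sum_of_fintype]
  exact f.sum_eq_one (mem_univ z)

namespace OrientedCover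

variable {ι : Type*} [Fintype ι] (a : OrientedCover j ι)

/-- The integral of the 2-form `f • vol`. -/
def int (f : S → ℝ) : ℝ := ∑ i, (a.c i).int fun z => a.f i z * f z

theorem f_le_one (i : ι) (z : S) : a.f i z ≤ 1 := by
  rw [← a.f_sum z]
  exact Finset.single_le_sum (f := fun i => a.f i z) (fun i _ => a.f_nonneg i z) (Finset.mem_univ i)

theorem f_eq_zero {i : ι} {z : S} (hz : z ∉ tsupport (a.f i)) : a.f i z = 0 :=
  image_eq_zero_of_notMem_tsupport hz

variable [CompactSpace S]

theorem isCompact_tsupport (i : ι) : IsCompact (tsupport (a.f i)) :=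
  (isClosed_tsupport _).isCompact

theorem integrableOn_dens {f : S → ℝ} (hf : IsContForm j f) (i : ι)
    (h0 : ∀ z, z ∉ tsupport (a.f i) → f z = 0) : IntegrableOn ((a.c i).dens f) quadrant :=
  (a.c i).integrableOn_dens (a.isCompact_tsupport i) (a.f_supp i) h0 (hf _)

theorem int_add {f f' : S → ℝ} (hf : IsContForm j f) (hf' : IsContForm j f') :
    a.int (fun z => f z + f' z) = a.int f + a.int f' := by
  unfold int
  rw [← Finset.sum_add_distrib]
  refine Finset.sum_congr rfl fun i _ => ?_
  unfold OrientedChart.int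
  rw [← integral_add (a.integrableOn_dens (hf.mul (a.f_smooth i).continuous) i
    fun z hz => by rw [a.f_eq_zero hz, zero_mul]) (a.integrableOn_dens
    (hf'.mul (a.f_smooth i).continuous) i fun z hz => by rw [a.f_eq_zero hz, zero_mul])]
  refine integral_congr_ae (Eventually.of_forall fun y => ?_)
  simp only [mul_add]
  exact (a.c i).dens_add _ _ y

/-- A sum of non-negative integrals that is `≤ 0` has vanishing terms, and a continuous non-negative
density with zero integral vanishes. -/
theorem eq_zero_of_int_nonpos {f : S → ℝ} (hf : IsContForm j f)
    (h0 : ∀ z, 0 ≤ f z) (hint : a.int f ≤ 0) (z : S) : f z = 0 := by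
  have hd : ∀ i, ∀ y, 0 ≤ (a.c i).dens (fun z => a.f i z * f z) y := by
    intro i y
    unfold OrientedChart.dens raw
    split_ifs with h
    · exact mul_nonneg (mul_nonneg (a.f_nonneg i _) (h0 _)) ((a.c i).vol_pos y h).le
    · exact le_rfl
  have h1 : ∀ i, 0 ≤ (a.c i).int (fun z => a.f i z * f z) := fun i =>
    setIntegral_nonneg isClosed_quadrant.measurableSet fun y _ => hd i y
  have h2 : ∀ i, (a.c i).int (fun z => a.f i z * f z) = 0 := by
    have h3 := (Finset.sum_eq_zero_iff_of_nonneg fun i _ => h1 i).1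
      (le_antisymm hint (Finset.sum_nonneg fun i _ => h1 i))
    exact fun i => h3 i (Finset.mem_univ i)
  have h3 : ∀ i, a.f i z * f z = 0 := by
    intro i
    by_cases hz : z ∈ tsupport (a.f i)
    · have hO := a.f_supp i hz
      have hm := (hf.mul (a.f_smooth i).continuous)
      have hs0 : ∀ z, z ∉ tsupport (a.f i) → a.f i z * f z = 0 :=
        fun z hz => by rw [a.f_eq_zero hz, zero_mul]
      have h4 := (setIntegral_eq_zero_iff_of_nonneg_ae (Eventually.of_forall (hd i))
        (a.integrableOn_dens hm i hs0)).1 (h2 i)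
      -- Vanishing almost everywhere becomes vanishing at every point, edges included, because the
      -- quadrant lies in the closure of its interior.
      have h5 := Measure.eqOn_of_ae_eq h4 ((a.c i).continuousOn_dens (a.isCompact_tsupport i)
        (a.f_supp i) hs0 (hm _)) continuousOn_const quadrant_subset_closure_interior
      have hκ := (a.c i).κ_mem z hO
      have h6 := h5 hκ.1
      have h7 : (a.c i).dens (fun z => a.f i z * f z) ((a.c i).κ z) = _ := if_pos hκ
      rw [h7] at h6
      unfold raw at h6
      rw [(a.c i).left_inv z hO] at h6
      have h8 := (a.c i).vol_pos _ hκ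
      rw [(a.c i).left_inv z hO] at h8
      exact (mul_eq_zero.1 h6).resolve_right h8.ne'
    · rw [a.f_eq_zero hz, zero_mul]
  calc f z = ∑ i, a.f i z * f z := by rw [← Finset.sum_mul, a.f_sum, one_mul]
    _ = 0 := Finset.sum_eq_zero fun i _ => h3 i

variable [IsManifold surfModel ∞ S]

/-- Change of variables for the integral of a 2-form supported in the image of a parametrized
surface. -/
theorem int_eq_setIntegral {Ψ : ℝ × ℝ → S} {s B : Set (ℝ × ℝ)}
    (hBs : B ⊆ s) (hB : MeasurableSet B)
    (hΨ : ∀ y ∈ B, ContMDiffWithinAt 𝓘(ℝ, ℝ × ℝ) surfModel 3 Ψ s y) (hinj : InjOn Ψ B)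
    (hpos : ∀ y ∈ B, 0 < vol j (Ψ y) (dpar Ψ s y (1, 0)) (dpar Ψ s y (0, 1)))
    {f : S → ℝ} (hfB : ∀ z, z ∉ Ψ '' B → f z = 0) (hint : IntegrableOn (raw j Ψ s f) B) :
    a.int f = ∫ y in B, raw j Ψ s f y := by
  have hΨc : ContinuousOn Ψ B := fun y hy => (hΨ y hy).continuousWithinAt.mono hBs
  have hraw : ∀ i y, raw j Ψ s (fun z => a.f i z * f z) y = a.f i (Ψ y) * raw j Ψ s f y := by
    intro i y; unfold raw; ring
  have h1 : ∀ i, (a.c i).int (fun z => a.f i z * f z) = ∫ y in B, a.f i (Ψ y) * raw j Ψ s f y := by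
    intro i
    rw [(a.c i).int_eq_setIntegral hBs hB hΨ hinj hpos]
    · exact integral_congr_ae (Eventually.of_forall (hraw i))
    · intro z hz
      rw [a.f_eq_zero fun h => hz (a.f_supp i h), zero_mul]
    · intro z hz
      rw [hfB z hz, mul_zero]
  unfold int
  simp only [h1]
  rw [← integral_finsetSum]
  · refine integral_congr_ae (Eventually.of_forall fun y => ?_)
    change ∑ i, a.f i (Ψ y) * raw j Ψ s f y = _
    rw [← Finset.sum_mul, a.f_sum, one_mul]
  · intro i _
    refine Integrable.bdd_mul (c := 1) hint
      (((a.f_smooth i).continuous.comp_continuousOn hΨc).aestronglyMeasurable hB)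
      (Eventually.of_forall fun y => ?_)
    rw [Real.norm_eq_abs, abs_of_nonneg (a.f_nonneg i _)]
    exact a.f_le_one i _

/-- The integral of a 2-form supported in a coordinate patch. -/
theorem int_eq_int (i : ι) {f : S → ℝ} (hf : IsContForm j f)
    (h0 : ∀ z, z ∉ tsupport (a.f i) → f z = 0) : a.int f = (a.c i).int f := by
  have hD : ∀ y ∈ (a.c i).D, (a.c i).dens f y = raw j (a.c i).Φ quadrant f y := fun y hy => if_pos hy
  have h1 : (a.c i).int f = ∫ y in (a.c i).D, raw j (a.c i).Φ quadrant f y := by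
    unfold OrientedChart.int
    rw [← setIntegral_congr_fun (a.c i).measurableSet_D hD]
    exact setIntegral_eq_of_subset_of_forall_sdiff_eq_zero isClosed_quadrant.measurableSet
      inter_subset_left fun y hy => if_neg hy.2
  rw [h1]
  refine a.int_eq_setIntegral inter_subset_left (a.c i).measurableSet_D
    (a.c i).Φ_smooth ?_ (a.c i).vol_pos ?_ ?_
  · intro y hy y' hy' h
    rw [← (a.c i).right_inv y hy, ← (a.c i).right_inv y' hy', h]
  · intro z hz
    refine h0 z fun h => hz ⟨_, (a.c i).κ_mem z (a.f_supp i h), (a.c i).left_inv z (a.f_supp i h)⟩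
  · exact ((a.integrableOn_dens hf i h0).mono_set inter_subset_left).congr_fun hD
      (a.c i).measurableSet_D

theorem int_zero : a.int (fun _ => 0) = 0 := by
  simp [int, OrientedChart.int, OrientedChart.dens, raw]

theorem int_sum {κ : Type*} (t : Finset κ) {f : κ → S → ℝ} (hf : ∀ i ∈ t, IsContForm j (f i)) :
    a.int (fun z => ∑ i ∈ t, f i z) = ∑ i ∈ t, a.int (f i) := by
  classical
  induction t using Finset.induction_on with
  | empty => simpa using a.int_zero
  | insert i t hi ih =>
    rw [Finset.sum_insert hi, ← ih fun i hi => hf i (Finset.mem_insert_of_mem hi),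
      ← a.int_add (hf i (Finset.mem_insert_self i t))
      (IsContForm.sum t fun i hi => hf i (Finset.mem_insert_of_mem hi))]
    simp only [Finset.sum_insert hi]

/-- Stokes' theorem for a form which is non-positive on the oriented boundary. -/
theorem int_nonpos (hj : ∀ z v, j z (j z v) = -v)
    {γ : ∀ z : S, TangentSpace surfModel z →L[ℝ] ℝ} {f : S → ℝ}
    (h : ∀ z, HasExtDeriv surfModel γ (fun z v w => f z * vol j z v w) z)
    (h1 : ∀ (c : OrientedChart j) x, 0 < x → (x, 0) ∈ c.D →
      γ (c.Φ (x, 0)) (dpar c.Φ quadrant (x, 0) (1, 0)) ≤ 0)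
    (h2 : ∀ (c : OrientedChart j) t, 0 < t → (0, t) ∈ c.D →
      0 ≤ γ (c.Φ (0, t)) (dpar c.Φ quadrant (0, t) (0, 1))) :
    a.int f ≤ 0 := by
  let w : ι → S → ℝ := fun i => coeff j (dWedge surfModel (a.f i) γ)
  have hf : IsContForm j f := isContForm_of_hasExtDeriv h
  have hγ : ∀ i z, HasExtDeriv surfModel (fun z => a.f i z • γ z)
      (fun z v u => (a.f i z * f z + w i z) * vol j z v u) z := by
    intro i z
    refine ((h z).mul ((a.f_smooth i).contMDiffAt.of_le (by norm_num))).congr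
      (Eventually.of_forall fun _ => rfl) fun v u => ?_
    rw [add_mul, coeff_mul_vol (hj z) (isTwoForm_dWedge _ _ _), mul_assoc]
  -- Continuity of `dfᵢ ∧ γ` comes from writing it as `d(fᵢ γ) - fᵢ dγ`.
  have hw : ∀ i, IsContForm j (w i) := by
    intro i
    have h3 := (isContForm_of_hasExtDeriv (hγ i)).sub (hf.mul (a.f_smooth i).continuous)
    simpa only [add_sub_cancel_left] using h3
  have hw0 : ∀ i z, z ∉ tsupport (a.f i) → w i z = 0 := by
    intro i z hz
    simp only [w, coeff]
    rw [dWedge_eq_zero γ (notMem_tsupport_iff_eventuallyEq.1 hz), zero_div]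
  -- The partition of unity sums to `1`, so the correction terms `dfᵢ ∧ γ` produced by localizing
  -- Stokes' theorem cancel in total.
  have hsum : ∀ z, ∑ i, w i z = 0 := by
    intro z
    simp only [w, coeff, ← Finset.sum_div]
    have h3 : ∀ v, ∑ i, mvfderiv surfModel (a.f i) z v = 0 := by
      intro v
      rw [← mvfderiv_sum _ fun i _ => (a.f_smooth i).contMDiffAt.of_le (by norm_num)]
      simp only [a.f_sum]
      rw [mvfderiv_const]
      rfl
    simp only [dWedge, Finset.sum_sub_distrib, ← Finset.sum_mul, h3, zero_mul, sub_zero, zero_div]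
  have hcomp : ∀ i, (a.c i).int (fun z => a.f i z * f z) + a.int (w i) ≤ 0 := by
    intro i
    have h0 : ∀ z, z ∉ tsupport (a.f i) → a.f i z * f z = 0 := fun z hz => by
      rw [a.f_eq_zero hz, zero_mul]
    rw [a.int_eq_int i (hw i) (hw0 i)]
    have h3 := (a.c i).int_nonpos (fun z _ => hγ i z) (a.isCompact_tsupport i) (a.f_supp i)
      (fun z hz => by rw [a.f_eq_zero hz, zero_smul])
      (fun x hx hD => mul_nonpos_of_nonneg_of_nonpos (a.f_nonneg i _) (h1 _ x hx hD))
      (fun t ht hD => mul_nonneg (a.f_nonneg i _) (h2 _ t ht hD))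
    refine le_trans (le_of_eq ?_) h3
    unfold OrientedChart.int
    rw [← integral_add (a.integrableOn_dens (hf.mul (a.f_smooth i).continuous) i h0)
      (a.integrableOn_dens (hw i) i (hw0 i))]
    exact integral_congr_ae (Eventually.of_forall fun y => ((a.c i).dens_add _ _ y).symm)
  have h4 := Finset.sum_nonpos fun i (_ : i ∈ Finset.univ) => hcomp i
  rw [Finset.sum_add_distrib, ← a.int_sum _ fun i _ => hw i] at h4
  simp only [hsum] at h4
  rw [a.int_zero, add_zero] at h4
  exact h4

end OrientedCover

end Integral

/-! ### The normalized Hamiltonians -/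

section Hamiltonian

/-- The function `h + c`, where the constant `c` is such that `r h'(r) = h(r) + c` for `r = ℓ`. -/
def shifted (ℓ : ℝ) (h : ℝ → ℝ) (r : ℝ) : ℝ := h r + (ℓ * deriv h ℓ - h ℓ)

variable {ℓ : ℝ} {h : ℝ → ℝ}

theorem shifted_self : shifted ℓ h ℓ = ℓ * deriv h ℓ := by
  unfold shifted; ring

theorem deriv_shifted (r : ℝ) : deriv (shifted ℓ h) r = deriv h r := by
  unfold shifted
  exact deriv_add_const _

theorem MonotoneOn.deriv_nonneg_Ici (hd : Differentiable ℝ h) (hm : MonotoneOn h (Ici ℓ)) {r : ℝ}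
    (hr : ℓ ≤ r) : 0 ≤ deriv h r := by
  rw [← (hd r).derivWithin (uniqueDiffOn_Ici ℓ r hr)]
  exact hm.derivWithin_nonneg

/-- Both `h(r) - h(ℓ)` and `ℓ h'(ℓ)` are non-negative by monotonicity. This is the sign needed in
front of `dαₘ`. -/
theorem shifted_nonneg (hℓ : 0 < ℓ) (hd : Differentiable ℝ h) (hm : MonotoneOn h (Ici ℓ)) {r : ℝ}
    (hr : ℓ ≤ r) : 0 ≤ shifted ℓ h r := by
  have h1 := hm (mem_Ici.2 le_rfl) (mem_Ici.2 hr) hr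
  have h2 := mul_nonneg hℓ.le (MonotoneOn.deriv_nonneg_Ici hd hm le_rfl)
  unfold shifted
  linarith

/-- By convexity `h(r) - h(ℓ) ≤ (r - ℓ) h'(r)` and `h'(ℓ) ≤ h'(r)`; add `ℓ` times the second to the
first. This is the sign of the Hamiltonian terms on the ends. -/
theorem shifted_le (hℓ : 0 < ℓ) (hd : Differentiable ℝ h) (hc : ConvexOn ℝ (Ici ℓ) h) {r : ℝ}
    (hr : ℓ ≤ r) : shifted ℓ h r ≤ r * deriv h r := by
  rcases hr.eq_or_lt with rfl | hr'
  · exact shifted_self.le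
  · have h1 := hc.le_slope_of_hasDerivAt (mem_Ici.2 le_rfl) (mem_Ici.2 hr) hr' (hd ℓ).hasDerivAt
    have h2 := hc.slope_le_of_hasDerivAt (mem_Ici.2 le_rfl) (mem_Ici.2 hr) hr' (hd r).hasDerivAt
    have h3 := h1.trans h2
    rw [slope_def_field, div_le_iff₀ (sub_pos.2 hr')] at h2
    have h4 := mul_le_mul_of_nonneg_left h3 hℓ.le
    unfold shifted
    nlinarith

end Hamiltonian

/-! ### The primitive, its exterior derivative, and their pointwise signs -/

section Floer

variable {n : ℕ} {Q : Type*} [TopologicalSpace Q] [ChartedSpace (EuclideanSpace ℝ (Fin n)) Q]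
  [IsManifold (𝓡 n) ∞ Q]
  {S : Type*} [TopologicalSpace S] [ChartedSpace (EuclideanQuadrant 2) S]
  [IsManifold surfModel ∞ S]

/-- The 1-form `u^*λ - ∑ₘ (hₘ(ρ(u)) + cₘ) αₘ`. -/
def primitive (g : Metric n Q) (ℓ : ℝ) {k : ℕ}
    (α : Fin (k + 1) → ∀ z : S, TangentSpace surfModel z →L[ℝ] ℝ)
    (h : Fin (k + 1) → ℝ → ℝ) (u : S → Cot n Q) (z : S) : TangentSpace surfModel z →L[ℝ] ℝ :=
  pullForm surfModel (cotModel n) u liouville z -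
    ∑ m, shifted ℓ (h m) (radial g (u z)) • α m z

/-- The exterior derivative of `primitive`. -/
def curvature (g : Metric n Q) (ℓ : ℝ) {k : ℕ}
    (α : Fin (k + 1) → ∀ z : S, TangentSpace surfModel z →L[ℝ] ℝ)
    (h : Fin (k + 1) → ℝ → ℝ) (u : S → Cot n Q) (z : S) (v w : TangentSpace surfModel z) : ℝ :=
  symplectic (u z) (mfderiv surfModel (cotModel n) u z v) (mfderiv surfModel (cotModel n) u z w) -
    ∑ m, (shifted ℓ (h m) (radial g (u z)) * extDeriv₁ surfModel (α m) z v w +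
      dWedge surfModel (fun z => shifted ℓ (h m) (radial g (u z))) (α m) z v w)

variable {g : Metric n Q} {ℓ : ℝ} {k : ℕ}
    {α : Fin (k + 1) → ∀ z : S, TangentSpace surfModel z →L[ℝ] ℝ}
    {h : Fin (k + 1) → ℝ → ℝ} {u : S → Cot n Q} {z : S}

theorem contMDiffAt_shifted_radial (hh : ∀ m, ContDiff ℝ ∞ (h m))
    (hu : ContMDiffAt surfModel (cotModel n) ∞ u z) (hr : radial g (u z) ≠ 0) (m : Fin (k + 1)) :
    ContMDiffAt surfModel 𝓘(ℝ) ∞ (fun z => shifted ℓ (h m) (radial g (u z))) z := by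
  have h1 : ContMDiffAt surfModel 𝓘(ℝ) ∞ (fun z => radial g (u z)) z :=
    (contMDiffAt_radial g hr).comp z hu
  have h2 : ContDiff ℝ ∞ (shifted ℓ (h m)) := (hh m).add contDiff_const
  exact h2.contMDiff.contMDiffAt.comp z h1

theorem hasExtDeriv_primitive {A : Set S} (hA : IsOpen A) (hz : z ∈ A)
    (hα : ∀ m, SmoothFormOn (α m) A) (hh : ∀ m, ContDiff ℝ ∞ (h m))
    (hu : ContMDiffAt surfModel (cotModel n) ∞ u z) (hr : radial g (u z) ≠ 0) :
    HasExtDeriv surfModel (primitive g ℓ α h u) (curvature g ℓ α h u) z := by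
  have h1 := (hasExtDeriv_liouville (u z)).pullForm (hu.of_le three_le_infty)
  have h2 := fun m => ((hα m).hasExtDeriv hA hz).mul
    ((contMDiffAt_shifted_radial (ℓ := ℓ) hh hu hr m).of_le (by simp))
  exact h1.sub (HasExtDeriv.sum Finset.univ fun m _ => h2 m)

theorem IsTwoForm.sub {θ θ' : TangentSpace surfModel z → TangentSpace surfModel z → ℝ}
    (hθ : IsTwoForm z θ) (hθ' : IsTwoForm z θ') : IsTwoForm z fun v w => θ v w - θ' v w where
  add v v' w := by rw [hθ.add, hθ'.add]; ring
  smul c v w := by rw [hθ.smul, hθ'.smul]; ring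
  alt v w := by rw [hθ.alt, hθ'.alt]; ring

theorem IsTwoForm.mul_add {θ θ' : TangentSpace surfModel z → TangentSpace surfModel z → ℝ}
    (hθ : IsTwoForm z θ) (hθ' : IsTwoForm z θ') (a : ℝ) :
    IsTwoForm z fun v w => a * θ v w + θ' v w where
  add v v' w := by rw [hθ.add, hθ'.add]; ring
  smul c v w := by rw [hθ.smul, hθ'.smul]; ring
  alt v w := by rw [hθ.alt, hθ'.alt]; ring

theorem IsTwoForm.sum {ι : Type*} (t : Finset ι)
    {θ : ι → TangentSpace surfModel z → TangentSpace surfModel z → ℝ}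
    (hθ : ∀ i ∈ t, IsTwoForm z (θ i)) : IsTwoForm z fun v w => ∑ i ∈ t, θ i v w where
  add v v' w := by
    rw [← Finset.sum_add_distrib]
    exact Finset.sum_congr rfl fun i hi => (hθ i hi).add v v' w
  smul c v w := by
    rw [Finset.mul_sum]
    exact Finset.sum_congr rfl fun i hi => (hθ i hi).smul c v w
  alt v w := by
    rw [← Finset.sum_neg_distrib]
    exact Finset.sum_congr rfl fun i hi => (hθ i hi).alt v w

theorem isTwoForm_symplectic (z : S) : IsTwoForm z fun v w => symplectic (u z)
    (mfderiv surfModel (cotModel n) u z v) (mfderiv surfModel (cotModel n) u z w) where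
  add v v' w := (congrArg (symplectic (u z) · _)
    (ContinuousLinearMap.map_add (mfderiv surfModel (cotModel n) u z) v v')).trans
    (symplectic_add_left _ _ _ _)
  smul c v w := (congrArg (symplectic (u z) · _)
    (ContinuousLinearMap.map_smul (mfderiv surfModel (cotModel n) u z) c v)).trans
    (symplectic_smul_left _ _ _ _)
  alt v w := symplectic_swap _ _ _

theorem isTwoForm_curvature (z : S) : IsTwoForm z (curvature g ℓ α h u z) :=
  (isTwoForm_symplectic z).sub (IsTwoForm.sum _ fun m _ =>
    (isTwoForm_extDeriv₁ (α m) z).mul_add (isTwoForm_dWedge _ (α m) z) _)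

theorem eta_eq (hh : ∀ m, ContDiff ℝ ∞ (h m)) (hr : radial g (u z) ≠ 0)
    (v : TangentSpace surfModel z) : eta g α h u z v =
    mfderiv surfModel (cotModel n) u z v -
      (∑ m, α m z v * deriv (h m) (radial g (u z))) • hamVF (radial g) (u z) := by
  unfold eta
  rw [Finset.sum_smul]
  congr 1
  refine Finset.sum_congr rfl fun m _ => ?_
  rw [hamVF_comp_radial g hr ((hh m).differentiable (by simp)).differentiableAt, smul_smul]

theorem mfderiv_eq_eta (hh : ∀ m, ContDiff ℝ ∞ (h m)) (hr : radial g (u z) ≠ 0)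
    (v : TangentSpace surfModel z) : mfderiv surfModel (cotModel n) u z v = eta g α h u z v +
      (∑ m, α m z v * deriv (h m) (radial g (u z))) • hamVF (radial g) (u z) := by
  rw [eta_eq hh hr, sub_add_cancel]

theorem dRadial_eta (hh : ∀ m, ContDiff ℝ ∞ (h m)) (hr : radial g (u z) ≠ 0)
    (v : TangentSpace surfModel z) : dRadial g (u z) (eta g α h u z v) =
      dRadial g (u z) (mfderiv surfModel (cotModel n) u z v) := by
  rw [mfderiv_eq_eta (α := α) hh hr v]
  refine Eq.trans ?_ (ContinuousLinearMap.map_add _ _ _).symm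
  rw [ContinuousLinearMap.map_smul, dRadial_hamVF_radial, smul_zero, add_zero]

theorem mvfderiv_shifted_radial (hh : ∀ m, ContDiff ℝ ∞ (h m)) (hr : radial g (u z) ≠ 0)
    (hu : ContMDiffAt surfModel (cotModel n) ∞ u z) (m : Fin (k + 1))
    (v : TangentSpace surfModel z) :
    mvfderiv surfModel (fun z => shifted ℓ (h m) (radial g (u z))) z v =
      deriv (h m) (radial g (u z)) * dRadial g (u z) (mfderiv surfModel (cotModel n) u z v) := by
  have h2 : ContDiff ℝ ∞ (shifted ℓ (h m)) := (hh m).add contDiff_const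
  rw [← deriv_shifted (ℓ := ℓ), ← mvfderiv_comp_radial g hr (h2.differentiable (by simp)).differentiableAt]
  have h3 : ContMDiffAt (cotModel n) 𝓘(ℝ) ∞ (fun y => shifted ℓ (h m) (radial g y)) (u z) :=
    h2.contMDiff.contMDiffAt.comp (u z) (contMDiffAt_radial g hr)
  exact DFunLike.congr_fun (mvfderiv_comp z (h3.mdifferentiableAt (by simp))
    (hu.mdifferentiableAt (by simp))) v

/-- Substitute `du = η + τ ⊗ X_ρ` with `τ = ∑ hₘ'(ρ) αₘ`. As `ω(X_ρ, ·) = -dρ` and `dρ(X_ρ) = 0`,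
the mixed terms amount to `d(ρ∘u) ∧ τ`, which cancels the sum of the `d(hₘ(ρ∘u)) ∧ αₘ`. -/
theorem curvature_eq (hh : ∀ m, ContDiff ℝ ∞ (h m)) (hr : radial g (u z) ≠ 0)
    (hu : ContMDiffAt surfModel (cotModel n) ∞ u z) (v w : TangentSpace surfModel z) :
    curvature g ℓ α h u z v w = symplectic (u z) (eta g α h u z v) (eta g α h u z w) -
      ∑ m, shifted ℓ (h m) (radial g (u z)) * extDeriv₁ surfModel (α m) z v w := by
  unfold curvature
  rw [Finset.sum_add_distrib]
  simp only [dWedge, mvfderiv_shifted_radial hh hr hu]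
  rw [← dRadial_eta (α := α) hh hr v, ← dRadial_eta (α := α) hh hr w]
  rw [mfderiv_eq_eta (α := α) hh hr v, mfderiv_eq_eta (α := α) hh hr w]
  set X := hamVF (radial g) (u z)
  have hX : ∀ v, symplectic (u z) X v = - dRadial g (u z) v := symplectic_hamVF (radial g) (u z)
  have hX' : ∀ (v : TangentSpace (cotModel n) (u z)) (c : ℝ),
      dRadial g (u z) (v + c • X) = dRadial g (u z) v := fun v c =>
    (ContinuousLinearMap.map_add _ _ _).trans (by
      rw [ContinuousLinearMap.map_smul, dRadial_hamVF_radial, smul_zero, add_zero])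
  simp only [symplectic_add_left, symplectic_add_right, symplectic_smul_left, symplectic_smul_right,
    hX, hX', symplectic_swap (u z) _ X]
  have e : ∀ (a b : TangentSpace surfModel z) (r : ℝ),
      ∑ m, deriv (h m) (radial g (u z)) * r * α m z b =
      r * ∑ m, α m z b * deriv (h m) (radial g (u z)) := by
    intro a b r
    rw [Finset.mul_sum]
    exact Finset.sum_congr rfl fun m _ => by ring
  rw [Finset.sum_sub_distrib, e v, e v]
  ring

/-- The Hamiltonian part comes from `λ(X_{hₘ}) = ρ hₘ'(ρ)`. Its coefficient is zero at `ρ = ℓ` and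
non-negative beyond, which explains the choice of constant in `shifted`. -/
theorem primitive_eq (hh : ∀ m, ContDiff ℝ ∞ (h m)) (hr : radial g (u z) ≠ 0)
    (v : TangentSpace surfModel z) :
    primitive g ℓ α h u z v = liouville (u z) (eta g α h u z v) +
      ∑ m, α m z v * (radial g (u z) * deriv (h m) (radial g (u z)) -
        shifted ℓ (h m) (radial g (u z))) := by
  have h1 : primitive g ℓ α h u z v = liouville (u z) (mfderiv surfModel (cotModel n) u z v) -
      ∑ m, shifted ℓ (h m) (radial g (u z)) * α m z v := by
    unfold primitive
    refine (sub_apply _ _ _).trans (congrArg (_ - ·) ?_)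
    exact sum_apply Finset.univ _ v
  rw [h1, mfderiv_eq_eta (α := α) hh hr v]
  have h2 := ContinuousLinearMap.map_add (liouville (u z)) (eta g α h u z v)
    ((∑ m, α m z v * deriv (h m) (radial g (u z))) • hamVF (radial g) (u z))
  rw [ContinuousLinearMap.map_smul, liouville_hamVF_radial g hr] at h2
  rw [h2, smul_eq_mul, Finset.sum_mul, add_sub_assoc, ← Finset.sum_sub_distrib]
  congr 1
  exact Finset.sum_congr rfl fun m _ => by ring

section CauchyRiemann

variable {j : ∀ z : S, TangentSpace surfModel z →L[ℝ] TangentSpace surfModel z}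
  {J : S → EndField n Q}

theorem eta_complex (hJ : IsCompatible (J z))
    (hCR : ∀ v, eta g α h u z v + J z (u z) (eta g α h u z (j z v)) = 0)
    (v : TangentSpace surfModel z) : eta g α h u z (j z v) = J z (u z) (eta g α h u z v) := by
  have h1 := hJ.sq (u z) (eta g α h u z (j z v))
  rw [eq_neg_of_add_eq_zero_left (hCR v)]
  refine Eq.trans ?_ (ContinuousLinearMap.map_neg _ _).symm
  rw [h1, neg_neg]

theorem sqNorm_nonneg {I : EndField n Q} (hI : IsCompatible I) (x : Cot n Q)
    (v : TangentSpace (cotModel n) x) : 0 ≤ sqNorm I x v := by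
  by_cases hv : v = 0
  · have h1 := symplectic_smul_left x 0 v (I x v)
    rw [zero_smul, zero_mul] at h1
    unfold sqNorm
    rw [← h1, hv]
  · exact (hI.pos x v hv).le

theorem sqNorm_eta_le_curvature (hℓ : 0 < ℓ) (hh : ∀ m, ContDiff ℝ ∞ (h m))
    (hm : ∀ m, MonotoneOn (h m) (Ici ℓ)) (hr : ℓ ≤ radial g (u z))
    (hu : ContMDiffAt surfModel (cotModel n) ∞ u z) (hJ : IsCompatible (J z))
    (hCR : ∀ v, eta g α h u z v + J z (u z) (eta g α h u z (j z v)) = 0)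
    (hα : ∀ m v, extDeriv₁ surfModel (α m) z v (j z v) ≤ 0) (v : TangentSpace surfModel z) :
    sqNorm (J z) (u z) (eta g α h u z v) ≤ curvature g ℓ α h u z v (j z v) := by
  rw [curvature_eq hh (hℓ.trans_le hr).ne' hu, eta_complex hJ hCR]
  have h1 : ∑ m, shifted ℓ (h m) (radial g (u z)) * extDeriv₁ surfModel (α m) z v (j z v) ≤ 0 :=
    Finset.sum_nonpos fun m _ => mul_nonpos_of_nonneg_of_nonpos
      (shifted_nonneg hℓ ((hh m).differentiable (by simp)) (hm m) hr) (hα m v)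
  unfold sqNorm
  linarith

/-- On the normal part of the boundary, `primitive` is `-e^{-f} d(ρ ∘ u) ∘ j`. -/
theorem primitive_normal (hℓ : 0 < ℓ) (hh : ∀ m, ContDiff ℝ ∞ (h m)) (hr : radial g (u z) = ℓ)
    (hJ : IsCompatible (J z)) (hconv : IsConvexNear g ℓ (J z))
    (hCR : ∀ v, eta g α h u z v + J z (u z) (eta g α h u z (j z v)) = 0) :
    ∃ c, 0 < c ∧ ∀ v, primitive g ℓ α h u z v =
      -c * dRadial g (u z) (mfderiv surfModel (cotModel n) u z (j z v)) := by
  have hr0 : radial g (u z) ≠ 0 := by rw [hr]; exact hℓ.ne'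
  obtain ⟨U, f, _, hU, _, hf⟩ := hconv
  refine ⟨(Real.exp (f (u z)))⁻¹, inv_pos.2 (Real.exp_pos _), fun v => ?_⟩
  rw [primitive_eq hh hr0, ← dRadial_eta (α := α) hh hr0, eta_complex hJ hCR, hf _ (hU hr), hr]
  -- At radius `ℓ` the Hamiltonian terms cancel exactly, leaving `λ(η(v)) = -e^{-f} dρ(J η(v))`.
  simp only [shifted_self, sub_self, mul_zero, Finset.sum_const_zero]
  field_simp
  ring

/-- Otherwise the energy inequality forces `η = 0`, so `du` takes values in the line spanned by
`X_ρ`, inside `ker dρ`. Transversality would then give `ker dρ = ⊤`, but `dρ` is nonzero on the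
radial vector. -/
theorem exists_curvature_pos (hℓ : 0 < ℓ) (hh : ∀ m, ContDiff ℝ ∞ (h m))
    (hm : ∀ m, MonotoneOn (h m) (Ici ℓ)) (hr : radial g (u z) = ℓ)
    (hu : ContMDiffAt surfModel (cotModel n) ∞ u z) (hJ : IsCompatible (J z))
    (hCR : ∀ v, eta g α h u z v + J z (u z) (eta g α h u z (j z v)) = 0)
    (hα : ∀ m v, extDeriv₁ surfModel (α m) z v (j z v) ≤ 0)
    (hT : LinearMap.range (mfderiv surfModel (cotModel n) u z).toLinearMap ⊔
      LinearMap.ker (dRadial g (u z)).toLinearMap = ⊤) :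
    ∃ v, 0 < curvature g ℓ α h u z v (j z v) := by
  have hr0 : radial g (u z) ≠ 0 := by rw [hr]; exact hℓ.ne'
  by_contra! hcon
  have h1 : ∀ v, eta g α h u z v = 0 := by
    intro v
    by_contra hv
    have h2 := hJ.pos (u z) _ hv
    have h3 := sqNorm_eta_le_curvature hℓ hh hm hr.ge hu hJ hCR hα v
    unfold sqNorm at h3
    linarith [hcon v]
  have h2 : LinearMap.range (mfderiv surfModel (cotModel n) u z).toLinearMap ≤
      LinearMap.ker (dRadial g (u z)).toLinearMap := by
    rintro _ ⟨v, rfl⟩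
    have h3 := dRadial_eta (α := α) hh hr0 v
    rw [h1] at h3
    exact h3.symm.trans (ContinuousLinearMap.map_zero _)
  rw [sup_eq_right.2 h2] at hT
  have h3 : radialVector (u z) ∈ LinearMap.ker (dRadial g (u z)).toLinearMap := by
    rw [hT]; trivial
  exact hr0 ((dRadial_radialVector g hr0).symm.trans h3)

end CauchyRiemann

/-- A path in `L` stays in one component, so `u` moves it within a single cotangent fibre. There `λ`
vanishes, since the base point is constant. -/
theorem primitive_lagrangian {L : Set S} {q : ConnectedComponents L → Q}
    (hL : LagrangianBoundary L q u) (hα : ∀ m, VanishesAlong (α m) L) {c : ℝ → S}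
    (hc : ContMDiff 𝓘(ℝ) surfModel ∞ c) (hcL : ∀ t, c t ∈ L) (t : ℝ)
    (hu : ContMDiffAt surfModel (cotModel n) ∞ u (c t)) :
    primitive g ℓ α h u (c t) (mfderiv 𝓘(ℝ) surfModel c t (1 : ℝ)) = 0 := by
  have h1 : primitive g ℓ α h u (c t) (mfderiv 𝓘(ℝ) surfModel c t (1 : ℝ)) =
      liouville (u (c t)) (mfderiv surfModel (cotModel n) u (c t) (mfderiv 𝓘(ℝ) surfModel c t (1 : ℝ))) -
      ∑ m, shifted ℓ (h m) (radial g (u (c t))) * α m (c t) (mfderiv 𝓘(ℝ) surfModel c t (1 : ℝ)) := by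
    unfold primitive
    refine (sub_apply _ _ _).trans (congrArg (_ - ·) ?_)
    exact sum_apply Finset.univ _ _
  rw [h1]
  simp only [hα _ c hc hcL t, mul_zero, Finset.sum_const_zero, sub_zero]
  have h2 : ∀ s, (u (c s)).proj = (u (c t)).proj := by
    have hcont : Continuous fun s => (⟨c s, hcL s⟩ : L) := hc.continuous.subtype_mk _
    intro s
    rw [hL ⟨c s, hcL s⟩, hL ⟨c t, hcL t⟩]
    congr 1
    rw [ConnectedComponents.coe_eq_coe']
    exact (isPreconnected_range hcont).subset_connectedComponent ⟨t, rfl⟩ ⟨s, rfl⟩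
  have h3 : HasMFDerivAt 𝓘(ℝ) (𝓡 n) (fun s => (u (c s)).proj) t
      ((mfderiv (cotModel n) (𝓡 n) (fun y : Cot n Q => y.proj) (u (c t))).comp
        ((mfderiv surfModel (cotModel n) u (c t)).comp (mfderiv 𝓘(ℝ) surfModel c t))) :=
    HasMFDerivAt.comp t ((contMDiff_proj _).contMDiffAt.mdifferentiableAt (n := ∞) (by simp)).hasMFDerivAt
      ((hu.mdifferentiableAt (by simp)).hasMFDerivAt.comp t
        ((hc t).mdifferentiableAt (by simp)).hasMFDerivAt)
  have h4 : HasMFDerivAt 𝓘(ℝ) (𝓡 n) (fun s => (u (c s)).proj) t 0 := by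
    rw [show (fun s => (u (c s)).proj) = fun _ => (u (c t)).proj from funext h2]
    exact hasMFDerivAt_const _ _
  have h5 := DFunLike.congr_fun (hasMFDerivAt_unique h3 h4) (1 : ℝ)
  exact (congrArg (show TangentSpace (𝓡 n) (u (c t)).proj →L[ℝ] ℝ from (u (c t)).snd) h5).trans
    (ContinuousLinearMap.map_zero _)

end Floer

/-! ### The sign of the primitive on the oriented boundary -/

theorem planeDet_smul_eq (v w x : EuclideanSpace ℝ (Fin 2)) :
    planeDet v w • x = planeDet x w • v + planeDet v x • w := by
  ext i
  fin_cases i <;> simp [planeDet] <;> ring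

section Surface

variable {S : Type*} [TopologicalSpace S] [ChartedSpace (EuclideanQuadrant 2) S]
  {j : ∀ z : S, TangentSpace surfModel z →L[ℝ] TangentSpace surfModel z}

theorem exists_comb {z : S} {v w : TangentSpace surfModel z} (h : vol j z v w ≠ 0)
    (x : TangentSpace surfModel z) : ∃ a b : ℝ, x = a • v + b • w := by
  have h1 : planeDet v w ≠ 0 := fun h0 => h (by unfold vol; rw [h0, zero_mul])
  refine ⟨(planeDet v w)⁻¹ * planeDet x w, (planeDet v w)⁻¹ * planeDet v x, ?_⟩
  have h2 := congrArg ((planeDet v w)⁻¹ • ·) (planeDet_smul_eq v w x)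
  have h3 : ∀ (c a b : ℝ) (v w x : EuclideanSpace ℝ (Fin 2)), c ≠ 0 → c⁻¹ • (c • x) = c⁻¹ • (a • v + b • w) →
      x = (c⁻¹ * a) • v + (c⁻¹ * b) • w := by
    intro c a b v w x hc h
    rwa [smul_smul, inv_mul_cancel₀ hc, one_smul, smul_add, smul_smul, smul_smul] at h
  exact h3 _ _ _ v w x h1 h2

/-- Orientation: if `(v, w)` is positive, then `j v` lies on the same side of the line through `v`
as `w`. On the bottom edge this says that `j` of the edge direction points inwards. -/
theorem exists_comb_left {z : S} (hj : ∀ v, j z (j z v) = -v) {v w : TangentSpace surfModel z}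
    (h : 0 < vol j z v w) : ∃ a b : ℝ, 0 < b ∧ j z v = a • v + b • w := by
  obtain ⟨a, b, hab⟩ := exists_comb h.ne' (j z v)
  refine ⟨a, b, ?_, hab⟩
  have hv : v ≠ 0 := by
    rintro rfl
    have := vol_comb j z 0 w 0 0 0 1
    simp at this
    exact h.ne' this
  have h1 := vol_pos hj hv
  have h2 := vol_comb j z v w 1 0 a b
  rw [one_smul, zero_smul, add_zero, ← hab] at h2
  rw [h2] at h1
  simp only [one_mul, zero_mul, sub_zero] at h1
  exact pos_of_mul_pos_left h1 h.le

theorem exists_comb_right {z : S} (hj : ∀ v, j z (j z v) = -v) {v w : TangentSpace surfModel z}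
    (h : 0 < vol j z v w) : ∃ a b : ℝ, a < 0 ∧ j z w = a • v + b • w := by
  obtain ⟨a, b, hab⟩ := exists_comb h.ne' (j z w)
  refine ⟨a, b, ?_, hab⟩
  have hw : w ≠ 0 := by
    rintro rfl
    have := vol_comb j z v 0 1 0 0 0
    simp at this
    exact h.ne' this
  have h1 := vol_pos hj hw
  have h2 := vol_comb j z v w 0 1 a b
  rw [one_smul, zero_smul, zero_add, ← hab] at h2
  rw [h2] at h1
  have h3 : 0 < (-a) * vol j z v w := by linarith
  have := pos_of_mul_pos_left h3 h.le
  linarith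

end Surface

/-- At a boundary minimum away from the corner the derivative is zero along the edge and
non-negative inwards. The corner itself has measure zero on the edges and is not needed. -/
theorem IsLocalMinOn.fderiv_quadrant_bottom {r : ℝ × ℝ → ℝ} {r' : ℝ × ℝ →L[ℝ] ℝ} {x : ℝ}
    (hx : 0 < x) (h : IsLocalMinOn r quadrant (x, 0)) (hr : HasFDerivWithinAt r r' quadrant (x, 0)) :
    r' (1, 0) = 0 ∧ 0 ≤ r' (0, 1) := by
  have hc : ∀ v : ℝ × ℝ, (x, (0 : ℝ)) + v ∈ quadrant → 0 ≤ r' v := by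
    intro v hv
    refine h.hasFDerivWithinAt_nonneg hr (mem_posTangentConeAt_of_segment_subset ?_)
    have hq : Convex ℝ quadrant := by
      rw [quadrant_eq]
      exact (convex_Ici 0).prod (convex_Ici 0)
    exact hq.segment_subset ⟨hx.le, le_rfl⟩ hv
  refine ⟨le_antisymm ?_ (hc _ ⟨by simp; linarith, by simp⟩), hc _ ⟨by simp; linarith, by simp⟩⟩
  have h1 := hc (-x, 0) ⟨by simp, by simp⟩
  have h2 : ((-x, 0) : ℝ × ℝ) = (-x) • (1, 0) := by simp
  rw [h2, map_smul, smul_eq_mul] at h1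
  nlinarith

theorem IsLocalMinOn.fderiv_quadrant_left {r : ℝ × ℝ → ℝ} {r' : ℝ × ℝ →L[ℝ] ℝ} {t : ℝ}
    (ht : 0 < t) (h : IsLocalMinOn r quadrant (0, t)) (hr : HasFDerivWithinAt r r' quadrant (0, t)) :
    r' (0, 1) = 0 ∧ 0 ≤ r' (1, 0) := by
  have hc : ∀ v : ℝ × ℝ, ((0 : ℝ), t) + v ∈ quadrant → 0 ≤ r' v := by
    intro v hv
    refine h.hasFDerivWithinAt_nonneg hr (mem_posTangentConeAt_of_segment_subset ?_)
    have hq : Convex ℝ quadrant := by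
      rw [quadrant_eq]
      exact (convex_Ici 0).prod (convex_Ici 0)
    exact hq.segment_subset ⟨le_rfl, ht.le⟩ hv
  refine ⟨le_antisymm ?_ (hc _ ⟨by simp, by simp; linarith⟩), hc _ ⟨by simp, by simp; linarith⟩⟩
  have h1 := hc (0, -t) ⟨by simp, by simp⟩
  have h2 : ((0, -t) : ℝ × ℝ) = (-t) • (0, 1) := by simp
  rw [h2, map_smul, smul_eq_mul] at h1
  nlinarith

section Floer

variable {n : ℕ} {Q : Type*} [TopologicalSpace Q] [ChartedSpace (EuclideanSpace ℝ (Fin n)) Q]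
  [IsManifold (𝓡 n) ∞ Q]
  {S : Type*} [TopologicalSpace S] [ChartedSpace (EuclideanQuadrant 2) S]
  [IsManifold surfModel ∞ S]
  {g : Metric n Q} {ℓ : ℝ} {k : ℕ}
  {α : Fin (k + 1) → ∀ z : S, TangentSpace surfModel z →L[ℝ] ℝ}
  {h : Fin (k + 1) → ℝ → ℝ} {u : S → Cot n Q}

/-- Transfers `primitive_lagrangian` from globally defined paths to a coordinate segment contained
in `L`. -/
theorem primitive_segment {L : Set S} {q : ConnectedComponents L → Q}
    (hL : LagrangianBoundary L q u) (hα : ∀ m, VanishesAlong (α m) L) {Φ : ℝ × ℝ → S}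
    {s B : Set (ℝ × ℝ)} (hBs : B ⊆ s)
    (hΦ : ∀ y ∈ B, ContMDiffWithinAt 𝓘(ℝ, ℝ × ℝ) surfModel ∞ Φ s y) {y v : ℝ × ℝ} {r : ℝ}
    (hr : 0 < r) (hB : ∀ τ, |τ| ≤ r → y + τ • v ∈ B ∧ Φ (y + τ • v) ∈ L)
    (hu : ContMDiffAt surfModel (cotModel n) ∞ u (Φ y)) :
    primitive g ℓ α h u (Φ y) (mfderivWithin 𝓘(ℝ, ℝ × ℝ) surfModel Φ s y v) = 0 := by
  -- `VanishesAlong` tests paths defined on all of `ℝ`. The sine runs back and forth inside the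
  -- segment of radius `r` forever, with velocity `v` at time `0`.
  let P : ℝ → ℝ × ℝ := fun τ => y + (r * Real.sin (τ / r)) • v
  have hP : ∀ τ, P τ ∈ B ∧ Φ (P τ) ∈ L := by
    intro τ
    refine hB _ ?_
    rw [abs_mul, abs_of_pos hr]
    exact mul_le_of_le_one_right hr.le (Real.abs_sin_le_one _)
  have hPs : ContDiff ℝ ∞ P := by
    have h1 : ContDiff ℝ ∞ fun τ : ℝ => r * Real.sin (τ / r) :=
      contDiff_const.mul (Real.contDiff_sin.comp (contDiff_id.div_const r))
    exact contDiff_const.add (h1.smul contDiff_const)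
  have hP0 : P 0 = y := by simp [P]
  have hP' : HasDerivAt P v 0 := by
    have h1 : HasDerivAt (fun τ : ℝ => r * Real.sin (τ / r)) 1 0 := by
      have h2 := (((hasDerivAt_id (0 : ℝ)).div_const r).sin).const_mul r
      simpa [hr.ne'] using h2
    have h2 := (h1.smul_const v).const_add y
    rwa [one_smul] at h2
  have hc : ContMDiff 𝓘(ℝ) surfModel ∞ (fun τ => Φ (P τ)) := by
    intro τ
    have h0 : ContMDiffWithinAt 𝓘(ℝ) 𝓘(ℝ, ℝ × ℝ) ∞ P univ τ := (hPs.contMDiff τ).contMDiffWithinAt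
    have h1 : ContMDiffWithinAt 𝓘(ℝ) surfModel ∞ (Φ ∘ P) univ τ :=
      (hΦ (P τ) (hP τ).1).comp τ h0 fun τ _ => hBs (hP τ).1
    exact contMDiffWithinAt_univ.1 h1
  have h0 := primitive_lagrangian (g := g) (ℓ := ℓ) (h := h) hL hα hc (fun τ => (hP τ).2) 0
    (by rw [hP0]; exact hu)
  have h1 : ∀ x, x = y → primitive g ℓ α h u (Φ x) (mfderivWithin 𝓘(ℝ, ℝ × ℝ) surfModel Φ s x v) = 0 →
      primitive g ℓ α h u (Φ y) (mfderivWithin 𝓘(ℝ, ℝ × ℝ) surfModel Φ s y v) = 0 := by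
    rintro x rfl h; exact h
  refine h1 (P 0) hP0 ?_
  refine Eq.trans (congrArg (primitive g ℓ α h u (Φ (P 0))) ?_) h0
  have h2 : MDifferentiableWithinAt 𝓘(ℝ, ℝ × ℝ) surfModel Φ s (P 0) :=
    (hΦ (P 0) (hP 0).1).mdifferentiableWithinAt (by simp)
  have h3 : HasMFDerivWithinAt 𝓘(ℝ) 𝓘(ℝ, ℝ × ℝ) P univ 0 _ :=
    hP'.hasFDerivAt.hasFDerivWithinAt.hasMFDerivWithinAt
  have h4 := (hasMFDerivWithinAt_univ.1
    (h2.hasMFDerivWithinAt.comp 0 h3 fun τ _ => hBs (hP τ).1)).mfderiv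
  refine Eq.symm ((DFunLike.congr_fun h4 (1 : ℝ)).trans ?_)
  refine congrArg (mfderivWithin 𝓘(ℝ, ℝ × ℝ) surfModel Φ s (P 0)) ?_
  exact one_smul ℝ v

variable {j : ∀ z : S, TangentSpace surfModel z →L[ℝ] TangentSpace surfModel z}
  {J : S → EndField n Q} {N L A : Set S} {q : ConnectedComponents L → Q}

theorem exists_segment {W : Set (ℝ × ℝ)} (hW : IsOpen W) {y : ℝ × ℝ} (hy : y ∈ W) (v : ℝ × ℝ) :
    ∃ r, 0 < r ∧ ∀ τ : ℝ, |τ| ≤ r → y + τ • v ∈ W := by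
  have h1 : ContinuousAt (fun τ : ℝ => y + τ • v) 0 := by fun_prop
  have h2 : (fun τ : ℝ => y + τ • v) ⁻¹' W ∈ 𝓝 0 := h1 (by simpa using hW.mem_nhds hy)
  obtain ⟨r, hr, hrW⟩ := Metric.nhds_basis_closedBall.mem_iff.1 h2
  exact ⟨r, hr, fun τ hτ => hrW (by simpa using hτ)⟩

/-- A solution of the Floer equation on the open subset `A` of the surface, with normal boundary
conditions on `N` and Lagrangian boundary conditions on `L`. -/
structure IsFloerCurve (g : Metric n Q) (ℓ : ℝ)
    (j : ∀ z : S, TangentSpace surfModel z →L[ℝ] TangentSpace surfModel z)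
    (α : Fin (k + 1) → ∀ z : S, TangentSpace surfModel z →L[ℝ] ℝ)
    (h : Fin (k + 1) → ℝ → ℝ) (J : S → EndField n Q) (u : S → Cot n Q) (A N L : Set S)
    (q : ConnectedComponents L → Q) : Prop where
  pos : 0 < ℓ
  isOpen : IsOpen A
  j_sq : ∀ z v, j z (j z v) = -v
  α_smooth : ∀ m, SmoothFormOn (α m) A
  α_lagrangian : ∀ m, VanishesAlong (α m) L
  α_sub : ∀ m, ∀ z ∈ A, ∀ v, extDeriv₁ surfModel (α m) z v (j z v) ≤ 0
  h_smooth : ∀ m, ContDiff ℝ ∞ (h m)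
  h_mono : ∀ m, MonotoneOn (h m) (Ici ℓ)
  h_convex : ∀ m, ConvexOn ℝ (Ici ℓ) (h m)
  J_compatible : ∀ z ∈ A, IsCompatible (J z)
  J_convex : ∀ z ∈ A, IsConvexNear g ℓ (J z)
  u_smooth : ContMDiffOn surfModel (cotModel n) ∞ u A
  le_radial : ∀ z ∈ A, ℓ ≤ radial g (u z)
  cr : SolvesCR g j α h J u A
  normal : NormalBoundary g ℓ u A N
  lagrangian : LagrangianBoundary L q u
  boundary : surfModel.boundary S ∩ A ⊆ N ∪ L
  closedN : ∃ C, IsClosed C ∧ C ∩ A = N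

namespace IsFloerCurve

variable {z : S}


theorem contMDiffAt (H : IsFloerCurve g ℓ j α h J u A N L q) (hz : z ∈ A) : ContMDiffAt surfModel (cotModel n) ∞ u z :=
  H.u_smooth.contMDiffAt (H.isOpen.mem_nhds hz)

theorem radial_ne_zero (H : IsFloerCurve g ℓ j α h J u A N L q) (hz : z ∈ A) : radial g (u z) ≠ 0 :=
  (H.pos.trans_le (H.le_radial z hz)).ne'

theorem hasExtDeriv (H : IsFloerCurve g ℓ j α h J u A N L q) (hz : z ∈ A) :
    HasExtDeriv surfModel (primitive g ℓ α h u) (curvature g ℓ α h u) z :=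
  hasExtDeriv_primitive H.isOpen hz H.α_smooth H.h_smooth (H.contMDiffAt hz) (H.radial_ne_zero hz)

theorem sqNorm_le (H : IsFloerCurve g ℓ j α h J u A N L q) (hz : z ∈ A) (v : TangentSpace surfModel z) :
    sqNorm (J z) (u z) (eta g α h u z v) ≤ curvature g ℓ α h u z v (j z v) :=
  sqNorm_eta_le_curvature H.pos H.h_smooth H.h_mono (H.le_radial z hz) (H.contMDiffAt hz)
    (H.J_compatible z hz) (H.cr z hz) (fun m => H.α_sub m z hz) v

theorem coeff_nonneg (H : IsFloerCurve g ℓ j α h J u A N L q) (hz : z ∈ A) : 0 ≤ coeff j (curvature g ℓ α h u) z :=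
  (isTwoForm_curvature z).coeff_nonneg (H.j_sq z) fun v =>
    (sqNorm_nonneg (H.J_compatible z hz) _ _).trans (H.sqNorm_le hz v)

theorem coeff_pos (H : IsFloerCurve g ℓ j α h J u A N L q) (hz : z ∈ N) : 0 < coeff j (curvature g ℓ α h u) z := by
  rw [← H.normal.preimage] at hz
  obtain ⟨v, hv⟩ := exists_curvature_pos H.pos H.h_smooth H.h_mono hz.2 (H.contMDiffAt hz.1)
    (H.J_compatible z hz.1) (H.cr z hz.1) (fun m => H.α_sub m z hz.1)
    (H.normal.transverse z hz.1 hz.2)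
  exact (isTwoForm_curvature z).coeff_pos (H.j_sq z) hv

/-- Near a point of the Lagrangian part of the boundary, all boundary points are in that part. -/
theorem exists_isOpen_lagrangian (H : IsFloerCurve g ℓ j α h J u A N L q) {Φ : ℝ × ℝ → S} {s V : Set (ℝ × ℝ)} (hV : IsOpen V)
    (hΦ : ContinuousOn Φ (s ∩ V)) {y : ℝ × ℝ} (hy : y ∈ s ∩ V) (hA : Φ y ∈ A) (hN : Φ y ∉ N) :
    ∃ W, IsOpen W ∧ y ∈ W ∧ ∀ y' ∈ s ∩ W, y' ∈ s ∩ V ∧ Φ y' ∈ A ∧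
      (Φ y' ∈ surfModel.boundary S → Φ y' ∈ L) := by
  obtain ⟨C, hC, hCN⟩ := H.closedN
  have hO : IsOpen (A \ C) := H.isOpen.sdiff hC
  have hyO : Φ y ∈ A \ C := ⟨hA, fun h => hN (hCN ▸ ⟨h, hA⟩)⟩
  obtain ⟨W, hW, hWs⟩ := continuousOn_iff'.1 hΦ _ hO
  have hyW : y ∈ W ∩ (s ∩ V) := hWs ▸ ⟨hyO, hy⟩
  refine ⟨W ∩ V, hW.inter hV, ⟨hyW.1, hy.2⟩, fun y' hy' => ?_⟩
  have h1 : y' ∈ Φ ⁻¹' (A \ C) ∩ (s ∩ V) := hWs ▸ ⟨hy'.2.1, hy'.1, hy'.2.2⟩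
  refine ⟨h1.2, h1.1.1, fun hb => (H.boundary ⟨hb, h1.1.1⟩).resolve_left fun h => h1.1.2 ?_⟩
  rw [← hCN] at h
  exact h.1

/-- The derivative of `ρ ∘ u ∘ Φ` and its minimum property at points of `N`. -/
theorem isLocalMinOn (H : IsFloerCurve g ℓ j α h J u A N L q) (c : OrientedChart j) {y : ℝ × ℝ} (hy : y ∈ c.D) (hN : c.Φ y ∈ N) :
    IsLocalMinOn (fun y => radial g (u (c.Φ y))) quadrant y ∧ ∃ r' : ℝ × ℝ →L[ℝ] ℝ,
      HasFDerivWithinAt (fun y => radial g (u (c.Φ y))) r' quadrant y ∧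
      ∀ a b : ℝ, dRadial g (u (c.Φ y)) (mfderiv surfModel (cotModel n) u (c.Φ y)
        (a • dpar c.Φ quadrant y (1, 0) + b • dpar c.Φ quadrant y (0, 1))) =
        a * r' (1, 0) + b * r' (0, 1) := by
  have hN' := hN
  rw [← H.normal.preimage] at hN'
  obtain ⟨hA, hr⟩ := hN'
  have hΦ : ContMDiffWithinAt 𝓘(ℝ, ℝ × ℝ) surfModel 3 c.Φ quadrant y := c.Φ_smooth y hy
  constructor
  · have h1 : ∀ᶠ y' in 𝓝[quadrant] y, c.Φ y' ∈ A :=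
      hΦ.continuousWithinAt.eventually (H.isOpen.mem_nhds hA)
    filter_upwards [h1] with y' hy'
    rw [hr]
    exact H.le_radial _ hy'
  · have h1 : HasMFDerivAt (cotModel n) 𝓘(ℝ) (radial g) (u (c.Φ y)) _ :=
      ((contMDiffAt_radial g (H.radial_ne_zero hA)).mdifferentiableAt (by simp)).hasMFDerivAt
    have h2 := ((H.contMDiffAt hA).mdifferentiableAt (by simp)).hasMFDerivAt
    have h3 := (hΦ.mdifferentiableWithinAt (by norm_num)).hasMFDerivWithinAt
    refine ⟨(dRadial g (u (c.Φ y))).comp ((mfderiv surfModel (cotModel n) u (c.Φ y)).comp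
        (mfderivWithin 𝓘(ℝ, ℝ × ℝ) surfModel c.Φ quadrant y)),
      ?_, fun a b => ?_⟩
    · exact (h1.comp_hasMFDerivWithinAt y (h2.comp_hasMFDerivWithinAt y h3)).hasFDerivWithinAt
    have h6 := ((dRadial g (u (c.Φ y))).comp (mfderiv surfModel (cotModel n) u (c.Φ y))).map_add
        (a • dpar c.Φ quadrant y (1, 0)) (b • dpar c.Φ quadrant y (0, 1))
    refine h6.trans (congrArg₂ (· + ·) ?_ ?_) <;> exact ContinuousLinearMap.map_smul _ _ _

theorem primitive_normal (H : IsFloerCurve g ℓ j α h J u A N L q) (hz : z ∈ N) : ∃ c, 0 < c ∧ ∀ v, primitive g ℓ α h u z v =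
    -c * dRadial g (u z) (mfderiv surfModel (cotModel n) u z (j z v)) := by
  rw [← H.normal.preimage] at hz
  exact IntegratedMax.primitive_normal H.pos H.h_smooth hz.2 (H.J_compatible z hz.1)
    (H.J_convex z hz.1) (H.cr z hz.1)

/-- On `N`, writing `j ∂ₓ = a ∂ₓ + d ∂ᵧ` with `d > 0`, the value is `-b d ∂ᵧ(ρ∘u)` with `b > 0`, and
the inward derivative at the minimum is non-negative. Off `N`, which is closed in `A`, a whole piece
of the edge lies in `L` and the value is zero. -/
theorem primitive_bottom (H : IsFloerCurve g ℓ j α h J u A N L q) (c : OrientedChart j) {x : ℝ} (hx : 0 < x) (hy : (x, 0) ∈ c.D)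
    (hA : c.Φ (x, 0) ∈ A) :
    primitive g ℓ α h u (c.Φ (x, 0)) (dpar c.Φ quadrant (x, 0) (1, 0)) ≤ 0 := by
  by_cases hN : c.Φ (x, 0) ∈ N
  · obtain ⟨h1, r', h2, h5⟩ := H.isLocalMinOn c hy hN
    obtain ⟨h3, h4⟩ := IsLocalMinOn.fderiv_quadrant_bottom hx h1 h2
    obtain ⟨b, hb, hb'⟩ := H.primitive_normal hN
    obtain ⟨a, d, hd, had⟩ := exists_comb_left (H.j_sq _) (c.vol_pos _ hy)
    rw [hb', had, h5, h3]
    have := mul_nonneg hb.le (mul_nonneg hd.le h4)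
    linarith
  · obtain ⟨W, hW, hyW, hWL⟩ := H.exists_isOpen_lagrangian c.isOpen_V c.continuousOn_Φ hy hA hN
    obtain ⟨r, hr, hrW⟩ := exists_segment (hW.inter (isOpen_Ioi.preimage continuous_fst))
      (show (x, (0 : ℝ)) ∈ W ∩ Prod.fst ⁻¹' Ioi 0 from ⟨hyW, hx⟩) (1, 0)
    refine (primitive_segment H.lagrangian H.α_lagrangian inter_subset_left c.Φ_contMDiff hr
      (fun τ hτ => ?_) (H.contMDiffAt hA)).le
    obtain ⟨h1, h2⟩ := hrW τ hτ
    have h3 := hWL ((x, 0) + τ • (1, 0)) ⟨⟨le_of_lt h2, by simp⟩, h1⟩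
    exact ⟨h3.1, h3.2.2 (c.boundary _ h3.1 (Or.inr (by simp)))⟩

theorem primitive_left (H : IsFloerCurve g ℓ j α h J u A N L q) (c : OrientedChart j) {t : ℝ} (ht : 0 < t) (hy : (0, t) ∈ c.D)
    (hA : c.Φ (0, t) ∈ A) :
    0 ≤ primitive g ℓ α h u (c.Φ (0, t)) (dpar c.Φ quadrant (0, t) (0, 1)) := by
  by_cases hN : c.Φ (0, t) ∈ N
  · obtain ⟨h1, r', h2, h5⟩ := H.isLocalMinOn c hy hN
    obtain ⟨h3, h4⟩ := IsLocalMinOn.fderiv_quadrant_left ht h1 h2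
    obtain ⟨b, hb, hb'⟩ := H.primitive_normal hN
    obtain ⟨a, d, hd, had⟩ := exists_comb_right (H.j_sq _) (c.vol_pos _ hy)
    rw [hb', had, h5, h3]
    have := mul_nonneg hb.le (mul_nonneg (neg_nonneg.2 hd.le) h4)
    linarith
  · obtain ⟨W, hW, hyW, hWL⟩ := H.exists_isOpen_lagrangian c.isOpen_V c.continuousOn_Φ hy hA hN
    obtain ⟨r, hr, hrW⟩ := exists_segment (hW.inter (isOpen_Ioi.preimage continuous_snd))
      (show ((0 : ℝ), t) ∈ W ∩ Prod.snd ⁻¹' Ioi 0 from ⟨hyW, ht⟩) (0, 1)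
    refine (primitive_segment H.lagrangian H.α_lagrangian inter_subset_left c.Φ_contMDiff hr
      (fun τ hτ => ?_) (H.contMDiffAt hA)).ge
    obtain ⟨h1, h2⟩ := hrW τ hτ
    have h3 := hWL ((0, t) + τ • (0, 1)) ⟨⟨by simp, le_of_lt h2⟩, h1⟩
    exact ⟨h3.1, h3.2.2 (c.boundary _ h3.1 (Or.inl (by simp)))⟩

end IsFloerCurve

end Floer

/-! ### Strip-like ends in real coordinates, and cutoff functions -/

section Strip

variable {S : Type*} [TopologicalSpace S] [ChartedSpace (EuclideanQuadrant 2) S]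
  {j : ∀ z : S, TangentSpace surfModel z →L[ℝ] TangentSpace surfModel z} {p : S} {ε : ℂ → S}

/-- A strip-like end in real coordinates. -/
def stripMap (ε : ℂ → S) (y : ℝ × ℝ) : S := ε (Complex.equivRealProdCLM.symm y)

theorem equivRealProdCLM_symm_mem {y : ℝ × ℝ} (hy : y ∈ strip) :
    Complex.equivRealProdCLM.symm y ∈ halfStrip := by
  simpa [halfStrip, strip] using hy

theorem equivRealProdCLM_mem {w : ℂ} (hw : w ∈ halfStrip) : Complex.equivRealProdCLM w ∈ strip := by
  simpa [halfStrip, strip] using hw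

theorem image_stripMap : stripMap ε '' strip = ε '' halfStrip := by
  ext z
  constructor
  · rintro ⟨y, hy, rfl⟩
    exact ⟨_, equivRealProdCLM_symm_mem hy, rfl⟩
  · rintro ⟨w, hw, rfl⟩
    exact ⟨_, equivRealProdCLM_mem hw, congrArg ε (Complex.equivRealProdCLM.symm_apply_apply w)⟩

namespace IsNegativeEnd

theorem injOn_stripMap (hε : IsNegativeEnd j p ε) : InjOn (stripMap ε) strip := fun y hy y' hy' h =>
  Complex.equivRealProdCLM.symm.injective
    (hε.inj (equivRealProdCLM_symm_mem hy) (equivRealProdCLM_symm_mem hy') h)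

theorem contMDiff_stripMap (hε : IsNegativeEnd j p ε) {y : ℝ × ℝ} (hy : y ∈ strip) :
    ContMDiffWithinAt 𝓘(ℝ, ℝ × ℝ) surfModel ((⊤ : ℕ∞) : WithTop ℕ∞) (stripMap ε) strip y :=
  (hε.holo.smooth _ (equivRealProdCLM_symm_mem hy)).comp y
    Complex.equivRealProdCLM.symm.contDiff.contMDiff.contMDiffAt.contMDiffWithinAt
    fun _ h => equivRealProdCLM_symm_mem h

theorem dpar_stripMap (hε : IsNegativeEnd j p ε) {y : ℝ × ℝ} (hy : y ∈ strip) (v : ℝ × ℝ) :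
    dpar (stripMap ε) strip y v = mfderivWithin 𝓘(ℝ, ℂ) surfModel ε halfStrip
      (Complex.equivRealProdCLM.symm y) (Complex.equivRealProdCLM.symm v) := by
  have h1 := ((hε.holo.smooth _ (equivRealProdCLM_symm_mem hy)).mdifferentiableWithinAt
    (by simp)).hasMFDerivWithinAt
  have h2 : HasMFDerivWithinAt 𝓘(ℝ, ℝ × ℝ) 𝓘(ℝ, ℂ) Complex.equivRealProdCLM.symm strip y
      (Complex.equivRealProdCLM.symm : ℝ × ℝ →L[ℝ] ℂ) :=
    Complex.equivRealProdCLM.symm.hasFDerivAt.hasFDerivWithinAt.hasMFDerivWithinAt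
  have h3 := (h1.comp y h2 fun _ h => equivRealProdCLM_symm_mem h).mfderivWithin
    (uniqueDiffOn_strip y hy).uniqueMDiffWithinAt
  exact DFunLike.congr_fun h3 v

theorem dpar_snd (hε : IsNegativeEnd j p ε) {y : ℝ × ℝ} (hy : y ∈ strip) :
    dpar (stripMap ε) strip y (0, 1) = j (stripMap ε y) (dpar (stripMap ε) strip y (1, 0)) := by
  rw [hε.dpar_stripMap hy, hε.dpar_stripMap hy]
  have h1 := hε.holo.holo _ (equivRealProdCLM_symm_mem hy) 1
  have e1 : Complex.equivRealProdCLM.symm (0, 1) = Complex.I * 1 := by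
    apply Complex.ext <;> simp
  have e2 : Complex.equivRealProdCLM.symm (1, 0) = 1 := by
    apply Complex.ext <;> simp
  rw [e1, e2]
  exact h1

/-- The end is an immersion because of the condition `α = dt`: if `∂ₛ` mapped to zero, so would `∂ₜ`
by holomorphy, contradicting `α(∂ₜ) = 1`. -/
theorem dpar_ne_zero (hε : IsNegativeEnd j p ε) {α : ∀ z : S, TangentSpace surfModel z →L[ℝ] ℝ}
    (hα : ∀ w ∈ halfStrip, ∀ v : ℂ,
      α (ε w) (mfderivWithin 𝓘(ℝ, ℂ) surfModel ε halfStrip w v) = v.im)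
    {y : ℝ × ℝ} (hy : y ∈ strip) : dpar (stripMap ε) strip y (1, 0) ≠ 0 := by
  intro h0
  have h1 := hα _ (equivRealProdCLM_symm_mem hy) (Complex.equivRealProdCLM.symm (0, 1))
  have h2 := hε.dpar_snd hy
  rw [h0] at h2
  have h3 := h2.trans (ContinuousLinearMap.map_zero _)
  rw [hε.dpar_stripMap hy] at h3
  rw [h3] at h1
  have h4 := (ContinuousLinearMap.map_zero (α (ε (Complex.equivRealProdCLM.symm y)))).symm.trans h1
  simp at h4

theorem vol_stripMap_pos (hε : IsNegativeEnd j p ε) (hj : ∀ z v, j z (j z v) = -v)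
    {α : ∀ z : S, TangentSpace surfModel z →L[ℝ] ℝ}
    (hα : ∀ w ∈ halfStrip, ∀ v : ℂ,
      α (ε w) (mfderivWithin 𝓘(ℝ, ℂ) surfModel ε halfStrip w v) = v.im)
    {y : ℝ × ℝ} (hy : y ∈ strip) : 0 < vol j (stripMap ε y) (dpar (stripMap ε) strip y (1, 0))
      (dpar (stripMap ε) strip y (0, 1)) := by
  rw [hε.dpar_snd hy]
  exact vol_pos (hj _) (hε.dpar_ne_zero hα hy)

theorem stripMap_mem_boundary (hε : IsNegativeEnd j p ε) {y : ℝ × ℝ} (hy : y ∈ strip)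
    (h : y.2 = 0 ∨ y.2 = 1) : stripMap ε y ∈ surfModel.boundary S :=
  hε.sides _ (equivRealProdCLM_symm_mem hy) (by simpa using h)

/-- A cutoff function on a strip-like end. -/
theorem exists_cutoff [T2Space S] [IsManifold surfModel ∞ S] (hε : IsNegativeEnd j p ε) :
    ∃ κ : S → ℝ, ContMDiff surfModel 𝓘(ℝ) ∞ κ ∧ (∀ z, 0 ≤ κ z ∧ κ z ≤ 1) ∧
      κ =ᶠ[𝓝 p] (fun _ => 1) ∧ tsupport κ ⊆ insert p (ε '' halfStrip) ∧
      (∀ y ∈ strip, y.1 = 0 → κ (stripMap ε y) = 0) ∧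
      ∃ R, ∀ y ∈ strip, y.1 ≤ -R → κ =ᶠ[𝓝 (stripMap ε y)] fun _ => 1 := by
  -- The edge `s = 0`. Its image is compact and misses `p`, so the bump function at `p` can be
  -- chosen with support in the end and away from this edge.
  let K : Set (ℝ × ℝ) := Icc (0 : ℝ) 0 ×ˢ Icc (0 : ℝ) 1
  have hK : K ⊆ strip := by
    rintro y ⟨h1, h2⟩
    exact ⟨h1.2, h2⟩
  have hKc : IsClosed (stripMap ε '' K) := by
    refine ((isCompact_Icc.prod isCompact_Icc).image_of_continuousOn fun y hy => ?_).isClosed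
    exact (hε.contMDiff_stripMap (hK hy)).continuousWithinAt.mono hK
  have hpK : p ∉ stripMap ε '' K := fun h =>
    hε.notMem (image_stripMap (ε := ε) ▸ image_mono hK h)
  obtain ⟨f, -, hf⟩ := (SmoothBumpFunction.nhds_basis_tsupport (I := surfModel) p).mem_iff.1
    (inter_mem hε.nhd (hKc.isOpen_compl.mem_nhds hpK))
  have h1 : f =ᶠ[𝓝 p] fun _ => (1 : ℝ) := f.eventuallyEq_one
  refine ⟨f, f.contMDiff, fun z => ⟨f.nonneg, f.le_one⟩, h1, hf.trans inter_subset_left, ?_, ?_⟩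
  · intro y hy h0
    by_contra hne
    refine (hf (subset_tsupport _ hne)).2 ⟨y, ⟨?_, hy.2⟩, rfl⟩
    rw [h0]
    simp
  · have h2 := hε.lim.eventually h1.eventually_nhds
    rw [eventually_inf_principal, eventually_comap] at h2
    obtain ⟨R, hR⟩ := eventually_atBot.1 h2
    exact ⟨-R, fun y hy hyR => hR y.1 (by linarith) _ (by simp) (equivRealProdCLM_symm_mem hy)⟩

end IsNegativeEnd

end Strip

/-! ### The curve on a strip-like end -/

section Floer

variable {n : ℕ} {Q : Type*} [TopologicalSpace Q] [ChartedSpace (EuclideanSpace ℝ (Fin n)) Q]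
  [IsManifold (𝓡 n) ∞ Q]
  {S : Type*} [TopologicalSpace S] [ChartedSpace (EuclideanQuadrant 2) S]
  [IsManifold surfModel ∞ S]
  {g : Metric n Q} {ℓ : ℝ} {k : ℕ}
  {α : Fin (k + 1) → ∀ z : S, TangentSpace surfModel z →L[ℝ] ℝ}
  {h : Fin (k + 1) → ℝ → ℝ} {u : S → Cot n Q}
  {j : ∀ z : S, TangentSpace surfModel z →L[ℝ] TangentSpace surfModel z}
  {J : S → EndField n Q} {N L A : Set S} {q : ConnectedComponents L → Q}

/-- The Floer data and the curve on a strip-like end. -/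
structure IsFloerEnd (g : Metric n Q)
    (j : ∀ z : S, TangentSpace surfModel z →L[ℝ] TangentSpace surfModel z)
    (α : Fin (k + 1) → ∀ z : S, TangentSpace surfModel z →L[ℝ] ℝ)
    (h : Fin (k + 1) → ℝ → ℝ) (J : S → EndField n Q) (u : S → Cot n Q) (A N : Set S)
    (p : S) (ε : ℂ → S) : Prop where
  isEnd : IsNegativeEnd j p ε
  α_end : ∀ m, ∀ w ∈ halfStrip, ∀ v : ℂ,
    α m (ε w) (mfderivWithin 𝓘(ℝ, ℂ) surfModel ε halfStrip w v) = v.im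
  subset : ε '' halfStrip ⊆ A
  disjoint : Disjoint (ε '' halfStrip) N
  energy : geomEnergy g j α h J u A < ⊤
  tame : TameAlongEnd J ε u

theorem preimage_halfStrip :
    Complex.measurableEquivRealProd.symm ⁻¹' (interior halfStrip) = interior strip := by
  have h1 : strip = Complex.equivRealProdCLM.symm.toHomeomorph ⁻¹' halfStrip := by
    ext y
    simp [halfStrip, strip]
  rw [h1, ← Homeomorph.preimage_interior]
  rfl

namespace IsFloerEnd

variable {p : S} {ε : ℂ → S}

theorem stripMap_mem (he : IsFloerEnd g j α h J u A N p ε) {y : ℝ × ℝ} (hy : y ∈ strip) :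
    stripMap ε y ∈ A := he.subset ⟨_, equivRealProdCLM_symm_mem hy, rfl⟩

theorem α_dpar (he : IsFloerEnd g j α h J u A N p ε) {y : ℝ × ℝ} (hy : y ∈ strip)
    (m : Fin (k + 1)) (v : ℝ × ℝ) : α m (stripMap ε y) (dpar (stripMap ε) strip y v) = v.2 := by
  rw [he.isEnd.dpar_stripMap hy]
  exact (he.α_end m _ (equivRealProdCLM_symm_mem hy) _).trans (by simp)

/-- The pullback of `αₘ` to the strip is the constant form `dt`. -/
theorem extDeriv_eq_zero (H : IsFloerCurve g ℓ j α h J u A N L q)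
    (he : IsFloerEnd g j α h J u A N p ε) {y : ℝ × ℝ} (hy : y ∈ strip) (m : Fin (k + 1)) :
    extDeriv₁ surfModel (α m) (stripMap ε y) (dpar (stripMap ε) strip y (1, 0))
      (dpar (stripMap ε) strip y (0, 1)) = 0 := by
  have h1 := ((H.α_smooth m).hasExtDeriv H.isOpen (he.stripMap_mem hy) (stripMap ε) strip y hy
    uniqueDiffOn_strip strip_subset_closure_interior rfl
    ((he.isEnd.contMDiff_stripMap hy).of_le three_le_infty)).2 (1, 0) (0, 1)
  refine h1.symm.trans ?_
  have h2 : ∀ y' ∈ strip, pull surfModel (stripMap ε) strip (α m) y' =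
      ContinuousLinearMap.snd ℝ ℝ ℝ := fun y' hy' =>
    ContinuousLinearMap.ext fun v => he.α_dpar hy' m v
  rw [fderivWithin_congr h2 (h2 y hy)]
  simp

theorem contDiffOn_pull (H : IsFloerCurve g ℓ j α h J u A N L q)
    (he : IsFloerEnd g j α h J u A N p ε) :
    ContDiffOn ℝ 1 (pull surfModel (stripMap ε) strip (primitive g ℓ α h u)) strip := fun y hy =>
  (H.hasExtDeriv (he.stripMap_mem hy) (stripMap ε) strip y hy uniqueDiffOn_strip
    strip_subset_closure_interior rfl ((he.isEnd.contMDiff_stripMap hy).of_le three_le_infty)).1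

/-- On an end the `dαₘ` vanish, so the energy inequality for `dβ` becomes an equality. The `curl` of
the pullback thus serves as a continuous energy density. -/
theorem curl_pull (H : IsFloerCurve g ℓ j α h J u A N L q)
    (he : IsFloerEnd g j α h J u A N p ε) {y : ℝ × ℝ} (hy : y ∈ strip) :
    curl strip (pull surfModel (stripMap ε) strip (primitive g ℓ α h u)) y =
      sqNorm (J (stripMap ε y)) (u (stripMap ε y))
        (eta g α h u (stripMap ε y) (dpar (stripMap ε) strip y (1, 0))) := by
  have hA := he.stripMap_mem hy
  have h1 := (H.hasExtDeriv hA (stripMap ε) strip y hy uniqueDiffOn_strip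
    strip_subset_closure_interior rfl
    ((he.isEnd.contMDiff_stripMap hy).of_le three_le_infty)).2 (1, 0) (0, 1)
  refine h1.trans ((curvature_eq H.h_smooth (H.radial_ne_zero hA) (H.contMDiffAt hA) _ _).trans ?_)
  have h2 : ∑ m, shifted ℓ (h m) (radial g (u (stripMap ε y))) * extDeriv₁ surfModel (α m)
      (stripMap ε y) (dpar (stripMap ε) strip y (1, 0)) (dpar (stripMap ε) strip y (0, 1)) = 0 :=
    Finset.sum_eq_zero fun m _ => by rw [extDeriv_eq_zero H he hy m, mul_zero]
  refine (congrArg (_ - ·) h2).trans ((sub_zero _).trans ?_)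
  unfold sqNorm
  rw [← eta_complex (H.J_compatible _ hA) (H.cr _ hA), ← he.isEnd.dpar_snd hy]
  rfl

theorem sqNorm_snd (H : IsFloerCurve g ℓ j α h J u A N L q)
    (he : IsFloerEnd g j α h J u A N p ε) {y : ℝ × ℝ} (hy : y ∈ strip) :
    sqNorm (J (stripMap ε y)) (u (stripMap ε y))
        (eta g α h u (stripMap ε y) (dpar (stripMap ε) strip y (0, 1))) =
      sqNorm (J (stripMap ε y)) (u (stripMap ε y))
        (eta g α h u (stripMap ε y) (dpar (stripMap ε) strip y (1, 0))) := by
  have hA := he.stripMap_mem hy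
  rw [he.isEnd.dpar_snd hy, eta_complex (H.J_compatible _ hA) (H.cr _ hA)]
  exact (H.J_compatible _ hA).invariant _ _ _

theorem eta_fst (he : IsFloerEnd g j α h J u A N p ε) {y : ℝ × ℝ} (hy : y ∈ strip) :
    eta g α h u (stripMap ε y) (dpar (stripMap ε) strip y (1, 0)) =
      mfderiv surfModel (cotModel n) u (stripMap ε y) (dpar (stripMap ε) strip y (1, 0)) := by
  unfold eta
  simp only [he.α_dpar hy, zero_smul, Finset.sum_const_zero, sub_zero]

theorem pull_snd (H : IsFloerCurve g ℓ j α h J u A N L q)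
    (he : IsFloerEnd g j α h J u A N p ε) {y : ℝ × ℝ} (hy : y ∈ strip) :
    pull surfModel (stripMap ε) strip (primitive g ℓ α h u) y (0, 1) =
      liouville (u (stripMap ε y)) (eta g α h u (stripMap ε y) (dpar (stripMap ε) strip y (0, 1))) +
      ∑ m, (radial g (u (stripMap ε y)) * deriv (h m) (radial g (u (stripMap ε y))) -
        shifted ℓ (h m) (radial g (u (stripMap ε y)))) := by
  refine (primitive_eq H.h_smooth (H.radial_ne_zero (he.stripMap_mem hy))
    (dpar (stripMap ε) strip y (0, 1))).trans ?_
  simp only [he.α_dpar hy, one_mul]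

theorem continuousOn_u (H : IsFloerCurve g ℓ j α h J u A N L q)
    (he : IsFloerEnd g j α h J u A N p ε) : ContinuousOn (fun y => u (stripMap ε y)) strip :=
  H.u_smooth.continuousOn.comp (fun _ hy => (he.isEnd.contMDiff_stripMap hy).continuousWithinAt)
    fun _ hy => he.stripMap_mem hy

/-- Continuity is read off from `pull_snd`: the function is the difference of `β(∂ₜ)` and the
Hamiltonian terms, both continuous. -/
theorem continuousOn_liouville (H : IsFloerCurve g ℓ j α h J u A N L q)
    (he : IsFloerEnd g j α h J u A N p ε) :
    ContinuousOn (fun y => liouville (u (stripMap ε y))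
      (eta g α h u (stripMap ε y) (dpar (stripMap ε) strip y (0, 1)))) strip := by
  have h1 : ContinuousOn (fun y => radial g (u (stripMap ε y))) strip := fun y hy =>
    ContinuousAt.comp_continuousWithinAt (f := fun y => u (stripMap ε y))
      (contMDiffAt_radial g (H.radial_ne_zero (he.stripMap_mem hy))).continuousAt
      (continuousOn_u H he y hy)
  have h2 : ContinuousOn (fun y => pull surfModel (stripMap ε) strip (primitive g ℓ α h u) y (0, 1))
      strip := (contDiffOn_pull H he).continuousOn.clm_apply continuousOn_const
  have h3 : ContinuousOn (fun y => ∑ m, (radial g (u (stripMap ε y)) *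
      deriv (h m) (radial g (u (stripMap ε y))) - shifted ℓ (h m) (radial g (u (stripMap ε y)))))
      strip := by
    refine continuousOn_finsetSum _ fun m _ => (h1.mul ?_).sub ?_
    · exact ((H.h_smooth m).continuous_deriv (by simp)).comp_continuousOn h1
    · have : Continuous (shifted ℓ (h m)) := (H.h_smooth m).continuous.add continuous_const
      exact this.comp_continuousOn h1
  refine (h2.sub h3).congr fun y hy => ?_
  simp only [Pi.sub_apply, pull_snd H he hy, add_sub_cancel_right]

/-- Convexity of the `hₘ` lets the Hamiltonian terms be dropped, so `β(∂ₜ)` is bounded below without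
any bound on `ρ∘u`. -/
theorem le_pull_snd (H : IsFloerCurve g ℓ j α h J u A N L q)
    (he : IsFloerEnd g j α h J u A N p ε) {y : ℝ × ℝ} (hy : y ∈ strip) :
    liouville (u (stripMap ε y)) (eta g α h u (stripMap ε y) (dpar (stripMap ε) strip y (0, 1))) ≤
      pull surfModel (stripMap ε) strip (primitive g ℓ α h u) y (0, 1) := by
  rw [pull_snd H he hy]
  refine le_add_of_nonneg_right (Finset.sum_nonneg fun m _ => sub_nonneg.2 ?_)
  exact shifted_le H.pos ((H.h_smooth m).differentiable (by simp)) (H.h_convex m)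
    (H.le_radial _ (he.stripMap_mem hy))

/-- The sides of the strip lie in the boundary and avoid `N`, hence lie in `L`. The segment of
radius `-s` around `(s, t)` stays in the strip. -/
theorem pull_side (H : IsFloerCurve g ℓ j α h J u A N L q)
    (he : IsFloerEnd g j α h J u A N p ε) {s t : ℝ} (hs : s < 0) (ht : t = 0 ∨ t = 1) :
    pull surfModel (stripMap ε) strip (primitive g ℓ α h u) (s, t) (1, 0) = 0 := by
  have ht' : 0 ≤ t ∧ t ≤ 1 := by rcases ht with rfl | rfl <;> norm_num
  have hmem : ∀ s ≤ 0, (s, t) ∈ strip := fun s hs => ⟨hs, ht'⟩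
  refine primitive_segment H.lagrangian H.α_lagrangian subset_rfl
    (fun y hy => he.isEnd.contMDiff_stripMap hy) (neg_pos.2 hs) (fun τ hτ => ?_)
    (H.contMDiffAt (he.stripMap_mem (hmem s hs.le)))
  have e1 : (s, t) + τ • ((1, 0) : ℝ × ℝ) = (s + τ, t) := by simp
  have h1 : (s + τ, t) ∈ strip := hmem _ (by linarith [(abs_le.1 hτ).2])
  rw [e1]
  refine ⟨h1, (H.boundary ⟨he.isEnd.stripMap_mem_boundary h1 ht, he.stripMap_mem h1⟩).resolve_left ?_⟩
  exact disjoint_left.1 he.disjoint ⟨_, equivRealProdCLM_symm_mem h1, rfl⟩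

/-- The interior of the strip is by itself an admissible holomorphic patch in the supremum defining
the energy, and there `½ (‖η(∂ₛ)‖² + ‖η(∂ₜ)‖²) = ‖η(∂ₛ)‖²`. -/
theorem lintegral_lt_top (H : IsFloerCurve g ℓ j α h J u A N L q)
    (he : IsFloerEnd g j α h J u A N p ε) :
    ∫⁻ y in interior strip, ENNReal.ofReal
      (curl strip (pull surfModel (stripMap ε) strip (primitive g ℓ α h u)) y) < ⊤ := by
  have hO : IsOpen (interior halfStrip) := isOpen_interior
  have hd : ∀ w ∈ interior halfStrip, mfderivWithin 𝓘(ℝ, ℂ) surfModel ε (interior halfStrip) w =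
      mfderivWithin 𝓘(ℝ, ℂ) surfModel ε halfStrip w := by
    intro w hw
    rw [mfderivWithin_of_isOpen hO hw, mfderivWithin_of_mem_nhds (mem_interior_iff_mem_nhds.1 hw)]
  have h1 : IsHolomorphicOn j ε (interior halfStrip) := by
    refine ⟨he.isEnd.holo.smooth.mono interior_subset, fun w hw v => ?_⟩
    rw [hd w hw]
    exact he.isEnd.holo.holo w (interior_subset hw) v
  have h2 : ∀ i i' : Fin 1, i ≠ i' → False := fun i i' hne => hne (Subsingleton.elim _ _)
  have h4 : ∑ _i : Fin 1, ∫⁻ w in interior halfStrip, ENNReal.ofReal (1 / 2 *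
      (sqNorm (J (ε w)) (u (ε w)) (eta g α h u (ε w)
          (mfderivWithin 𝓘(ℝ, ℂ) surfModel ε (interior halfStrip) w (1 : ℂ))) +
        sqNorm (J (ε w)) (u (ε w)) (eta g α h u (ε w)
          (mfderivWithin 𝓘(ℝ, ℂ) surfModel ε (interior halfStrip) w Complex.I)))) ≤
      geomEnergy g j α h J u A := by
    unfold geomEnergy
    refine le_iSup_of_le 1 (le_iSup_of_le (fun _ => interior halfStrip) (le_iSup_of_le (fun _ => ε)
      (le_iSup_of_le (fun _ => ⟨hO, h1, he.isEnd.inj.mono interior_subset,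
        (image_mono interior_subset).trans he.subset⟩)
      (le_iSup_of_le (fun i i' hne => (h2 i i' hne).elim) le_rfl))))
  rw [Fin.sum_univ_one] at h4
  refine lt_of_le_of_lt (le_of_eq ?_) (h4.trans_lt he.energy)
  rw [← Complex.volume_preserving_equiv_real_prod.symm.setLIntegral_comp_preimage_emb
    Complex.measurableEquivRealProd.symm.measurableEmbedding, preimage_halfStrip]
  refine setLIntegral_congr_fun isOpen_interior.measurableSet fun y hy => ?_
  have hy' := interior_subset hy
  have hw : Complex.measurableEquivRealProd.symm y ∈ interior halfStrip := by
    rw [← preimage_halfStrip] at hy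
    exact hy
  congr 1
  rw [curl_pull H he hy']
  have e1 := sqNorm_snd H he hy'
  have e2 := he.isEnd.dpar_stripMap hy' (1, 0)
  have e3 := he.isEnd.dpar_stripMap hy' (0, 1)
  have e4 : Complex.equivRealProdCLM.symm (1, 0) = 1 := by
    apply Complex.ext <;> simp
  have e5 : Complex.equivRealProdCLM.symm (0, 1) = Complex.I := by
    apply Complex.ext <;> simp
  rw [e4] at e2
  rw [e5] at e3
  have e6 : sqNorm (J (stripMap ε y)) (u (stripMap ε y))
      (eta g α h u (stripMap ε y) (dpar (stripMap ε) strip y (1, 0))) = 1 / 2 *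
      (sqNorm (J (stripMap ε y)) (u (stripMap ε y))
        (eta g α h u (stripMap ε y) (dpar (stripMap ε) strip y (1, 0))) +
      sqNorm (J (stripMap ε y)) (u (stripMap ε y))
        (eta g α h u (stripMap ε y) (dpar (stripMap ε) strip y (0, 1)))) := by
    rw [e1]; ring
  rw [e6, e2, e3, hd _ hw]
  rfl

/-- Tameness supplies the hypotheses of the slice estimate: `αₘ(∂ₛ) = 0` gives `∂ₛ(ψ∘u) =
dψ(η(∂ₛ))`, and `η(∂ₜ)` has the same norm as `η(∂ₛ)`. -/
theorem exists_small (H : IsFloerCurve g ℓ j α h J u A N L q)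
    (he : IsFloerEnd g j α h J u A N p ε) {c : ℝ} (hc : 0 < c) (R₀ : ℝ) :
    ∃ R, R₀ ≤ R ∧ 0 ≤ R ∧ ∫ t in (0 : ℝ)..1, |liouville (u (stripMap ε (-R, t)))
      (eta g α h u (stripMap ε (-R, t)) (dpar (stripMap ε) strip (-R, t) (0, 1)))| < c := by
  obtain ⟨C, ψ, hψ, ht⟩ := he.tame
  refine exists_small_slice (C := C) (ψ := fun y => ψ (u (stripMap ε y)))
    (ψ' := fun y => mvfderiv (cotModel n) ψ (u (stripMap ε y))
      (eta g α h u (stripMap ε y) (dpar (stripMap ε) strip y (1, 0))))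
    (continuousOn_curl uniqueDiffOn_strip (contDiffOn_pull H he))
    (hψ.continuous.comp_continuousOn (continuousOn_u H he)) (continuousOn_liouville H he) ?_
    (lintegral_lt_top H he) ?_ ?_ ?_ hc R₀
  · intro y hy
    rw [curl_pull H he hy]
    exact sqNorm_nonneg (H.J_compatible _ (he.stripMap_mem hy)) _ _
  · intro y hy hy0
    have hA := he.stripMap_mem hy
    have h1 : HasMFDerivAt (cotModel n) 𝓘(ℝ) ψ (u (stripMap ε y)) _ :=
      (hψ.contMDiffAt.mdifferentiableAt (by simp)).hasMFDerivAt
    have h2 := ((H.contMDiffAt hA).mdifferentiableAt (by simp)).hasMFDerivAt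
    have h3 := ((he.isEnd.contMDiff_stripMap hy).mdifferentiableWithinAt (by simp)).hasMFDerivWithinAt
    have h4 : HasFDerivWithinAt (fun y => ψ (u (stripMap ε y))) _ strip y :=
      (h1.comp_hasMFDerivWithinAt y (h2.comp_hasMFDerivWithinAt y h3)).hasFDerivWithinAt
    have h5 : HasDerivWithinAt (fun s : ℝ => (s, y.2)) (1, 0) (Iic 0) y.1 :=
      ((hasDerivAt_id y.1).prodMk (hasDerivAt_const y.1 y.2)).hasDerivWithinAt
    have hmaps : MapsTo (fun s : ℝ => (s, y.2)) (Iic 0) strip := fun s hs => ⟨hs, hy.2⟩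
    have h6 := (HasFDerivWithinAt.comp_hasDerivWithinAt y.1 h4 h5 hmaps).hasDerivAt
      (Iic_mem_nhds hy0)
    rw [he.eta_fst hy]
    exact h6
  · intro y hy _
    rw [curl_pull H he hy]
    exact (ht _ (equivRealProdCLM_symm_mem hy) _).2
  · intro y hy
    rw [curl_pull H he hy, ← sqNorm_snd H he hy]
    exact (ht _ (equivRealProdCLM_symm_mem hy) _).1

/-- The boundary term at a puncture has the right sign. -/
theorem int_cutoff_nonpos {ι : Type*} [Fintype ι] [CompactSpace S] (a : OrientedCover j ι)
    (H : IsFloerCurve g ℓ j α h J u A N L q)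
    (he : IsFloerEnd g j α h J u A N p ε) {κ : S → ℝ} (hκ : ContMDiff surfModel 𝓘(ℝ) ∞ κ)
    (hκ0 : ∀ z, 0 ≤ κ z) (hκp : κ =ᶠ[𝓝 p] fun _ => 1)
    (hκs : tsupport κ ⊆ insert p (ε '' halfStrip))
    (hκe : ∀ y ∈ strip, y.1 = 0 → κ (stripMap ε y) = 0)
    {R : ℝ} (hκR : ∀ y ∈ strip, y.1 ≤ -R → κ =ᶠ[𝓝 (stripMap ε y)] fun _ => 1) :
    a.int (coeff j (dWedge surfModel κ (primitive g ℓ α h u))) ≤ 0 := by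
  set b := pull surfModel (stripMap ε) strip (primitive g ℓ α h u) with hb
  have hbs : ContDiffOn ℝ 1 b strip := contDiffOn_pull H he
  have hk : ContDiffOn ℝ 1 (fun y => κ (stripMap ε y)) strip := by
    intro y hy
    have h1 := hκ.contMDiffAt.comp_contMDiffWithinAt y (he.isEnd.contMDiff_stripMap hy)
    exact (contMDiffWithinAt_iff_contDiffWithinAt.1 h1).of_le (by norm_num)
  have hraw : ∀ y ∈ strip, raw j (stripMap ε) strip
      (coeff j (dWedge surfModel κ (primitive g ℓ α h u))) y =
      fderivWithin ℝ (fun y => κ (stripMap ε y)) strip y (1, 0) * b y (0, 1) -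
      fderivWithin ℝ (fun y => κ (stripMap ε y)) strip y (0, 1) * b y (1, 0) := by
    intro y hy
    have h1 : ∀ v, fderivWithin ℝ (fun y => κ (stripMap ε y)) strip y v =
        mvfderiv surfModel κ (stripMap ε y) (dpar (stripMap ε) strip y v) :=
      fderivWithin_comp_eq_mvfderiv (uniqueDiffOn_strip y hy)
        (hκ.contMDiffAt.mdifferentiableAt (by simp))
        ((he.isEnd.contMDiff_stripMap hy).mdifferentiableWithinAt (by simp))
    unfold raw
    rw [coeff_mul_vol (H.j_sq _) (isTwoForm_dWedge _ _ _), h1, h1]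
    rfl
  -- Far out `κ` is constant, so the form is supported in a compact rectangle and is integrable.
  have hzero : ∀ y ∈ strip, y.1 ≤ -R → raw j (stripMap ε) strip
      (coeff j (dWedge surfModel κ (primitive g ℓ α h u))) y = 0 := by
    intro y hy hyR
    unfold raw coeff
    rw [dWedge_eq_zero _ (hκR y hy hyR), zero_div, zero_mul]
  have hcont : ContinuousOn (raw j (stripMap ε) strip
      (coeff j (dWedge surfModel κ (primitive g ℓ α h u)))) strip := by
    have h1 := hk.continuousOn_fderivWithin uniqueDiffOn_strip le_rfl
    have h2 := hbs.continuousOn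
    exact (((h1.clm_apply continuousOn_const).mul (h2.clm_apply continuousOn_const)).sub
      ((h1.clm_apply continuousOn_const).mul (h2.clm_apply continuousOn_const))).congr hraw
  have hint : IntegrableOn (raw j (stripMap ε) strip
      (coeff j (dWedge surfModel κ (primitive g ℓ α h u)))) strip := by
    have hsub : Icc (-R) 0 ×ˢ Icc 0 1 ⊆ strip := by
      rintro y ⟨h1, h2⟩
      exact ⟨h1.2, h2⟩
    refine IntegrableOn.of_forall_sdiff_eq_zero ((hcont.mono hsub).integrableOn_compact
      (isCompact_Icc.prod isCompact_Icc)) isClosed_strip.measurableSet ?_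
    rintro y ⟨hy, hy2⟩
    refine hzero y hy ?_
    by_contra! hlt
    exact hy2 ⟨⟨hlt.le, hy.1⟩, hy.2⟩
  rw [a.int_eq_setIntegral subset_rfl isClosed_strip.measurableSet
    (fun y hy => (he.isEnd.contMDiff_stripMap hy).of_le three_le_infty) he.isEnd.injOn_stripMap
    (fun y hy => he.isEnd.vol_stripMap_pos H.j_sq (he.α_end 0) hy) ?_ hint]
  · rw [setIntegral_congr_fun isClosed_strip.measurableSet hraw]
    refine integral_strip_nonpos hbs hk (fun y hy hyR => (hκR y hy hyR).self_of_nhds) hκe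
      (fun y _ => hκ0 _) ?_ (fun s hs => ⟨pull_side H he hs (Or.inl rfl), pull_side H he hs (Or.inr rfl)⟩)
      (continuousOn_liouville H he) (fun y hy => (neg_abs_le _).trans (le_pull_snd H he hy))
      fun c hc R₀ => exists_small H he hc R₀
    intro y hy
    rw [curl_pull H he hy]
    exact sqNorm_nonneg (H.J_compatible _ (he.stripMap_mem hy)) _ _
  · intro z hz
    rw [image_stripMap] at hz
    unfold coeff
    by_cases hzp : z = p
    · rw [hzp, dWedge_eq_zero _ hκp, zero_div]
    · have h1 : z ∉ tsupport κ := fun h => (hκs h).elim hzp hz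
      rw [dWedge_eq_zero _ (notMem_tsupport_iff_eventuallyEq.1 h1), zero_div]

end IsFloerEnd

end Floer

/-! ### The global argument on the compact surface -/

section Floer

variable {n : ℕ} {Q : Type*} [TopologicalSpace Q] [ChartedSpace (EuclideanSpace ℝ (Fin n)) Q]
  [IsManifold (𝓡 n) ∞ Q]
  {S : Type*} [TopologicalSpace S] [T2Space S] [CompactSpace S]
  [ChartedSpace (EuclideanQuadrant 2) S] [IsManifold surfModel ∞ S]
  {g : Metric n Q} {ℓ : ℝ} {k : ℕ}
  {α : Fin (k + 1) → ∀ z : S, TangentSpace surfModel z →L[ℝ] ℝ}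
  {h : Fin (k + 1) → ℝ → ℝ} {u : S → Cot n Q}
  {j : ∀ z : S, TangentSpace surfModel z →L[ℝ] TangentSpace surfModel z}
  {J : S → EndField n Q} {N L A : Set S} {q : ConnectedComponents L → Q}

theorem isOpen_punctured {e : ℕ} (p : Fin e → S) : IsOpen (punctured p) :=
  (finite_range p).isClosed.isOpen_compl

theorem IsFloerCurve.hasExtDeriv_mul (H : IsFloerCurve g ℓ j α h J u A N L q) {κ : S → ℝ}
    (hκ : ContMDiff surfModel 𝓘(ℝ) ∞ κ) {z : S} (hz : z ∈ A) :
    HasExtDeriv surfModel (fun z => κ z • primitive g ℓ α h u z)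
      (fun z v w => (κ z * coeff j (curvature g ℓ α h u) z +
        coeff j (dWedge surfModel κ (primitive g ℓ α h u)) z) * vol j z v w) z := by
  refine ((H.hasExtDeriv hz).mul (hκ.contMDiffAt.of_le (by norm_num))).congr
    (Eventually.of_forall fun _ => rfl) fun v w => ?_
  rw [add_mul, mul_assoc, coeff_mul_vol (H.j_sq z) (isTwoForm_curvature z),
    coeff_mul_vol (H.j_sq z) (isTwoForm_dWedge _ _ z)]

/-- On `A` the form is `d(κβ) - κ dβ`, a difference of continuous forms. Near a point outside `A`,
where `β` is not controlled, `κ` is constant and the form is zero. -/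
theorem IsFloerCurve.isContForm_dWedge (H : IsFloerCurve g ℓ j α h J u A N L q) {κ : S → ℝ}
    (hκ : ContMDiff surfModel 𝓘(ℝ) ∞ κ) (hκA : ∀ z, z ∉ A → ∃ c, κ =ᶠ[𝓝 z] fun _ => c) :
    IsContForm j (coeff j (dWedge surfModel κ (primitive g ℓ α h u))) := by
  intro c y hy
  by_cases hA : c.Φ y ∈ A
  · have hev : ∀ᶠ z in 𝓝 (c.Φ y), z ∈ A := H.isOpen.mem_nhds hA
    have h1 := c.continuousWithinAt_raw hy (hev.mono fun z hz => H.hasExtDeriv_mul hκ hz)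
    have h2 : ContinuousWithinAt (raw j c.Φ quadrant (coeff j (curvature g ℓ α h u))) c.D y := by
      refine c.continuousWithinAt_raw (γ := primitive g ℓ α h u) hy (hev.mono fun z hz => ?_)
      refine (H.hasExtDeriv hz).congr (Eventually.of_forall fun _ => rfl) fun v w => ?_
      rw [coeff_mul_vol (H.j_sq z) (isTwoForm_curvature z)]
    have h3 := hκ.continuous.continuousAt.comp_continuousWithinAt (c.continuousOn_Φ y hy)
    refine (h1.sub (h3.mul h2)).congr (fun y' _ => ?_) ?_ <;>
    · simp only [raw, Function.comp, Pi.sub_apply, Pi.mul_apply]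
      ring
  · obtain ⟨r, hr⟩ := hκA _ hA
    have h1 : ∀ᶠ y' in 𝓝[c.D] y, κ =ᶠ[𝓝 (c.Φ y')] fun _ => r :=
      (c.continuousOn_Φ y hy).eventually hr.eventually_nhds
    have h2 : ∀ y', (κ =ᶠ[𝓝 (c.Φ y')] fun _ => r) → raw j c.Φ quadrant
        (coeff j (dWedge surfModel κ (primitive g ℓ α h u))) y' = 0 := by
      intro y' hy'
      unfold raw coeff
      rw [dWedge_eq_zero _ hy', zero_div, zero_mul]
    exact (continuousWithinAt_const (b := (0 : ℝ))).congr_of_eventuallyEq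
      (h1.mono h2) (h2 y hr)

theorem IsFloerCurve.false {e : ℕ} {p : Fin e → S} (hp : Function.Injective p) {ε : Fin e → ℂ → S}
    (hj : IsComplexStructure j)
    (hεdisj : Pairwise fun i i' => Disjoint (ε i '' halfStrip) (ε i' '' halfStrip))
    (H : IsFloerCurve g ℓ j α h J u (punctured p) N L q)
    (he : ∀ i, IsFloerEnd g j α h J u (punctured p) N (p i) (ε i)) (hN : N.Nonempty) : False := by
  obtain ⟨t, ⟨a⟩⟩ := exists_orientedCover hj
  choose κ hκ hκ01 hκp hκs hκe R hκR using fun i => (he i).isEnd.exists_cutoff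
  set β := primitive g ℓ α h u with hβ
  have hnot : ∀ i i', i ≠ i' → ∀ z ∈ insert (p i) (ε i '' halfStrip),
      z ∉ insert (p i') (ε i' '' halfStrip) := by
    intro i i' hne z hz hz'
    rcases hz with rfl | hz <;> rcases hz' with hz' | hz'
    · exact hne (hp hz')
    · exact (he i').subset hz' ⟨i, rfl⟩
    · exact (he i).subset hz ⟨i', hz'.symm⟩
    · exact disjoint_left.1 (hεdisj hne) hz hz'
  have hκ0 : ∀ i i', i ≠ i' → κ i' =ᶠ[𝓝 (p i)] fun _ => 0 := fun i i' hne =>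
    notMem_tsupport_iff_eventuallyEq.1 fun hz =>
      hnot i i' hne (p i) (mem_insert _ _) (hκs i' hz)
  have hκc : ∀ i z, z ∉ punctured p → ∃ c, κ i =ᶠ[𝓝 z] fun _ => c := by
    intro i z hz
    obtain ⟨i', rfl⟩ := not_not.1 hz
    by_cases hi : i' = i
    · exact ⟨1, hi ▸ hκp i'⟩
    · exact ⟨0, hκ0 i' i hi⟩
  -- Vanishes near every puncture, so `χ β` is a `C¹` form on the whole compact surface.
  let χ : S → ℝ := fun z => 1 - ∑ i, κ i z
  have hχ : ContMDiff surfModel 𝓘(ℝ) ∞ χ := contMDiff_const.sub (contMDiff_finsetSum fun i _ => hκ i)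
  have hχp : ∀ i, χ =ᶠ[𝓝 (p i)] fun _ => 0 := by
    intro i
    have h1 : ∀ᶠ z in 𝓝 (p i), ∀ i' ∈ Finset.univ, κ i' z = if i' = i then 1 else 0 := by
      rw [Filter.eventually_all_finset]
      intro i' _
      split_ifs with hi
      · rw [hi]; exact hκp i
      · exact hκ0 i i' (Ne.symm hi)
    filter_upwards [h1] with z hz
    simp only [χ]
    rw [Finset.sum_congr rfl hz]
    simp
  have hχ0 : ∀ z, 0 ≤ χ z := by
    intro z
    simp only [χ, sub_nonneg]
    -- The supports of the cutoffs are disjoint, so at most one term of the sum is nonzero, and it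
    -- is at most `1`.
    by_cases hz : ∃ i, κ i z ≠ 0
    · obtain ⟨i, hi⟩ := hz
      rw [Finset.sum_eq_single i]
      · exact (hκ01 i z).2
      · intro i' _ hne
        by_contra hi'
        exact hnot i i' hne.symm z (hκs i (subset_tsupport _ hi)) (hκs i' (subset_tsupport _ hi'))
      · exact fun h => absurd (Finset.mem_univ i) h
    · push Not at hz
      simp [hz]
  have hχA : ∀ z, z ∉ punctured p → χ =ᶠ[𝓝 z] fun _ => 0 := by
    intro z hz
    obtain ⟨i, rfl⟩ := not_not.1 hz
    exact hχp i
  let f : S → ℝ := fun z => χ z * coeff j (curvature g ℓ α h u) z + coeff j (dWedge surfModel χ β) z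
  have hf : ∀ z, HasExtDeriv surfModel (fun z => χ z • β z) (fun z v w => f z * vol j z v w) z := by
    intro z
    by_cases hz : z ∈ punctured p
    · exact H.hasExtDeriv_mul hχ hz
    · have h1 := hχA z hz
      refine (hasExtDeriv_zero z).congr (h1.mono fun z hz => ?_) fun v w => ?_
      · rw [hz, zero_smul]
      · simp only [f]
        rw [h1.self_of_nhds, zero_mul, zero_add, coeff, dWedge_eq_zero β h1, zero_div, zero_mul]
  have hint : a.int f ≤ 0 := by
    refine a.int_nonpos H.j_sq hf ?_ ?_
    · intro c x hx hD
      by_cases hA : c.Φ (x, 0) ∈ punctured p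
      · exact mul_nonpos_of_nonneg_of_nonpos (hχ0 _) (H.primitive_bottom c hx hD hA)
      · rw [(hχA _ hA).self_of_nhds, zero_smul]
        rfl
    · intro c x hx hD
      by_cases hA : c.Φ (0, x) ∈ punctured p
      · exact mul_nonneg (hχ0 _) (H.primitive_left c hx hD hA)
      · rw [(hχA _ hA).self_of_nhds, zero_smul]
        rfl
  let w : Fin e → S → ℝ := fun i => coeff j (dWedge surfModel (κ i) β)
  have hw : ∀ i, IsContForm j (w i) := fun i => H.isContForm_dWedge (hκ i) (hκc i)
  -- The Leibniz rule `χ dβ = d(χβ) - dχ ∧ β` together with `dχ = -∑ dκᵢ`.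
  have hfw : ∀ z, χ z * coeff j (curvature g ℓ α h u) z = f z + ∑ i, w i z := by
    intro z
    have h1 : ∀ v, mvfderiv surfModel χ z v = - ∑ i, mvfderiv surfModel (κ i) z v := by
      intro v
      have h2 : ContMDiffAt surfModel 𝓘(ℝ) 1 (fun z => ∑ i, κ i z) z :=
        (contMDiff_finsetSum fun i _ => hκ i).contMDiffAt.of_le (by norm_num)
      have h3 := DFunLike.congr_fun (mvfderiv_sub (g := fun _ : S => (1 : ℝ))
        (mdifferentiableAt_const (c := (1 : ℝ))) (h2.mdifferentiableAt (by simp))) v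
      rw [mvfderiv_const] at h3
      rw [← mvfderiv_sum _ fun i _ => (hκ i).contMDiffAt.of_le (by norm_num)]
      exact h3.trans (zero_sub _)
    simp only [f, w, coeff, ← Finset.sum_div]
    rw [add_assoc, ← add_div]
    simp only [dWedge, h1, Finset.sum_sub_distrib, ← Finset.sum_mul]
    ring
  have hint2 : a.int (fun z => χ z * coeff j (curvature g ℓ α h u) z) ≤ 0 := by
    simp only [hfw]
    rw [a.int_add (isContForm_of_hasExtDeriv hf) (IsContForm.sum _ fun i _ => hw i),
      a.int_sum _ fun i _ => hw i]
    refine add_nonpos hint (Finset.sum_nonpos fun i _ => ?_)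
    exact IsFloerEnd.int_cutoff_nonpos a H (he i) (hκ i) (fun z => (hκ01 i z).1) (hκp i) (hκs i)
      (hκe i) (hκR i)
  have hcont : IsContForm j fun z => χ z * coeff j (curvature g ℓ α h u) z := by
    simp only [hfw]
    exact (isContForm_of_hasExtDeriv hf).add (IsContForm.sum _ fun i _ => hw i)
  have hnn : ∀ z, 0 ≤ χ z * coeff j (curvature g ℓ α h u) z := by
    intro z
    by_cases hz : z ∈ punctured p
    · exact mul_nonneg (hχ0 z) (H.coeff_nonneg hz)
    · rw [(hχA z hz).self_of_nhds, zero_mul]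
  obtain ⟨z, hz⟩ := hN
  have h1 := a.eq_zero_of_int_nonpos hcont hnn hint2 z
  have hzA : z ∈ punctured p := by
    rw [← H.normal.preimage] at hz
    exact hz.1
  -- `N` meets neither the ends nor the punctures, so all cutoffs vanish there and `χ dβ = 0`
  -- contradicts `dβ > 0` at `z`.
  have h2 : χ z = 1 := by
    have h3 : ∀ i, κ i z = 0 := by
      intro i
      by_contra hne
      rcases hκs i (subset_tsupport _ hne) with h4 | h4
      · exact hzA ⟨i, h4.symm⟩
      · exact disjoint_left.1 (he i).disjoint h4 hz
    simp [χ, h3]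
  rw [h2, one_mul] at h1
  exact (H.coeff_pos hz).ne' h1

end Floer

end IntegratedMax

end

theorem mainTheorem9
    -- a smooth manifold with a Riemannian metric, and a radius
    {n : ℕ} {Q : Type*} [TopologicalSpace Q] [T2Space Q] [SecondCountableTopology Q]
    [ChartedSpace (EuclideanSpace ℝ (Fin n)) Q] [IsManifold (𝓡 n) ∞ Q]
    (g : IntegratedMax.Metric n Q) (ℓ : ℝ) (hℓ : 0 < ℓ)
    -- a compact Riemann surface with boundary
    {S : Type*} [TopologicalSpace S] [T2Space S] [CompactSpace S]
    [ChartedSpace (EuclideanQuadrant 2) S] [IsManifold IntegratedMax.surfModel ∞ S]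
    (j : ∀ z : S, TangentSpace IntegratedMax.surfModel z →L[ℝ]
      TangentSpace IntegratedMax.surfModel z)
    (hj : IntegratedMax.IsComplexStructure j)
    -- boundary punctures with negative strip-like ends
    {e : ℕ} (p : Fin e → S) (hp : Function.Injective p)
    (hpb : ∀ i, p i ∈ IntegratedMax.surfModel.boundary S)
    (ε : Fin e → ℂ → S) (hε : ∀ i, IntegratedMax.IsNegativeEnd j (p i) (ε i))
    (hεsub : ∀ i, ε i '' IntegratedMax.halfStrip ⊆ IntegratedMax.punctured p)
    (hεdisj : Pairwise fun i i' =>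
      Disjoint (ε i '' IntegratedMax.halfStrip) (ε i' '' IntegratedMax.halfStrip))
    -- the normal part `N` and the Lagrangian part `L` of the boundary
    (N L : Set S) (hNL : IntegratedMax.IsBoundaryDecomposition p N L) (hN : N.Nonempty)
    (hNε : ∀ i, Disjoint (ε i '' IntegratedMax.halfStrip) N)
    (q : ConnectedComponents L → Q)
    -- Floer data
    {k : ℕ} (α : Fin (k + 1) → ∀ z : S, TangentSpace IntegratedMax.surfModel z →L[ℝ] ℝ)
    (h : Fin (k + 1) → ℝ → ℝ) (J : S → IntegratedMax.EndField n Q)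
    (hF : IntegratedMax.IsFloerData g ℓ j p ε L α h J) :
    ¬ ∃ u : S → IntegratedMax.Cot n Q,
      ContMDiffOn IntegratedMax.surfModel (IntegratedMax.cotModel n) ∞ u
        (IntegratedMax.punctured p) ∧
      (∀ z ∈ IntegratedMax.punctured p, ℓ ≤ IntegratedMax.radial g (u z)) ∧
      IntegratedMax.SolvesCR g j α h J u (IntegratedMax.punctured p) ∧
      IntegratedMax.NormalBoundary g ℓ u (IntegratedMax.punctured p) N ∧
      IntegratedMax.LagrangianBoundary L q u ∧
      IntegratedMax.geomEnergy g j α h J u (IntegratedMax.punctured p) < ⊤ ∧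
      ∀ i, IntegratedMax.TameAlongEnd J (ε i) u := by
  rintro ⟨u, hu, hr, hCR, hnormal, hlag, henergy, htame⟩
  have H : IntegratedMax.IsFloerCurve g ℓ j α h J u (IntegratedMax.punctured p) N L q :=
    { pos := hℓ
      isOpen := IntegratedMax.isOpen_punctured p
      j_sq := hj.sq
      α_smooth := hF.α_smooth
      α_lagrangian := hF.α_lagrangian
      α_sub := hF.α_sub
      h_smooth := hF.h_smooth
      h_mono := hF.h_mono
      h_convex := hF.h_convex
      J_compatible := hF.J_compatible
      J_convex := hF.J_convex
      u_smooth := hu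
      le_radial := hr
      cr := hCR
      normal := hnormal
      lagrangian := hlag
      boundary := hNL.union.ge
      closedN := by
        obtain ⟨C, hC, hCN⟩ := isClosed_induced_iff.1 hNL.closedN
        refine ⟨C, hC, ?_⟩
        have h1 : N ⊆ IntegratedMax.punctured p := fun z hz => (hNL.union.le (Or.inl hz)).2
        have h2 := (Subtype.preimage_coe_eq_preimage_coe_iff).1 hCN
        rw [inter_comm C, h2, inter_eq_right.2 h1] }
  exact H.false hp hj hεdisj
    (fun i => ⟨hε i, fun m => hF.α_ends m i, hεsub i, hNε i, henergy, htame i⟩) hN
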